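/- A Boolean network $N=(G,f)$ of dimension $n$ consists of a directed graph $G$ (its interaction graph; loops are allowed) on a set $V$ of $n$ vertices and of functions $f_v:\{0,1\}^{G^-(v)}\to\{0,1\}$, $v\in V$, where $G^-(v)$ is the set of in-neighbours of $v$. Its asynchronous state transition graph $\mathrm{ASTG}(N)$ has vertex set $\{0,1\}^{V}$ and an edge $x\to y$ whenever $x$ and $y$ differ in exactly one coordinate $v$ and $f_v(x\restriction G^-(v))=y_v$. The set $\mathcal A(N)$ of attractors of $N$ consists of the terminal strongly connected components of $\mathrm{ASTG}(N)$. The strong modules of $N$ are the vertex sets of the strongly connected components of $G$. Let $I_1,\dots,I_k$ be the strong modules of $N$, listed without repetition in such an order that $G$ has no edge from $I_j$ to $I_i$ for $i<j$. For sets $a_j\subseteq\{0,1\}^{I_j}$ $(j<i)$, let $N_i^{a_1,\dots,a_{i-1}}$ be the network on $I_i$ whose asynchronous state transition graph is the edge union, over all $x\in a_1\times\dots\times a_{i-1}$, of those of the networks obtained from $N$ by freezing the coordinates in $I_1\cup\dots\cup I_{i-1}$ at $x$ and keeping only the functions $f_v$ with $v\in I_i$. A factorized representation of the attractors of $N$ consists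 of such a list $I_1,\dots,I_k$ and, for each $i$, of a list $P_i$ of indices $j<i$ and an explicit table that assigns to tuples $(a_j)_{j\in P_i}$ of sets $a_j\subseteq\{0,1\}^{I_j}$ lists of subsets of $\{0,1\}^{I_i}$ (all sets being written out state by state), such that * whenever $a_1,\dots,a_{i-1}$ have been chosen successively according to the tables, the sets that the $i$-th table lists for $(a_j)_{j\in P_i}$ are exactly the attractors of $N_i^{a_1,\dots,a_{i-1}}$; * $(a_1,\dots,a_k)\mapsto a_1\times\dots\times a_k$ is a bijection from the set of all tuples chosen successively according to the tables onto $\mathcal A(N)$. **Theorem.** Let $F$ be a family of Boolean networks (of all dimensions) that is sparse (the in-degrees of the interaction graphs of its members are bounded by a constant) and has bounded strong modules (the cardinalities of the strong modules of its members are bounded by a constant). Then there are a program for a random access machine (with unit cost, and with addition and truncated subtraction of natural numbers as its only arithmetic operations) and a function $T:\mathbb N\to\mathbb N$ with $T(n)=\mathcal O(n^3)$ such that, for every $n$ and every $N\in F$ of dimension $n$, the program, given $N$ (each vertex with its list of in-neighbours and the truth table of its function), halts after at most $T(n)$ steps and outputs a factorized representation of the attractors of $N$. In particular, such a representation can be computed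 in polynomial time in the dimension. -/

import Mathlib

open Filter Asymptotics

/-! ### Boolean networks, asynchronous state transition graphs, attractors -/

/-- A Boolean network: an interaction graph `G` (loops allowed) and, for each vertex `v`, a
function `f v` of the states of the in-neighbours of `v`. -/
structure BooleanNetwork (V : Type*) where
  /-- the interaction graph -/
  G : Digraph V
  /-- the local functions -/
  f : ∀ v : V, ({u : V // G.Adj u v} → Bool) → Bool

/-- The attractors of a directed graph `r`: its terminal strongly connected components. -/
def attractors {S : Type*} (r : S → S → Prop) : Set (Set S) :=
  {a | (∃ x, a = {y | Relation.ReflTransGen r x y ∧ Relation.ReflTransGen r y x}) ∧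
    ∀ y ∈ a, ∀ z, r y z → z ∈ a}

namespace BooleanNetwork

variable {V : Type*}

/-- The asynchronous state transition graph: `x → y` when `x` and `y` differ in exactly one
coordinate `v`, and `f v` evaluated at `x` is `y v`. -/
def astg (N : BooleanNetwork V) (x y : V → Bool) : Prop :=
  ∃ v, N.f v (fun u => x u.1) = y v ∧ y v ≠ x v ∧ ∀ u, u ≠ v → y u = x u

/-- The strong modules: (vertex sets of) strongly connected components of the interaction graph. -/
def IsStrongModule (N : BooleanNetwork V) (C : Set V) : Prop :=
  ∃ v, C = {u | Relation.ReflTransGen N.G.Adj v u ∧ Relation.ReflTransGen N.G.Adj u v}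

open Classical in
/-- The network on the vertex set `J`, with the induced interaction graph, in which the inputs
that lie outside `J` are frozen at their values in the state `x`. -/
noncomputable def control (N : BooleanNetwork V) (J : Set V) (x : V → Bool) :
    BooleanNetwork J where
  G := ⟨fun u v => N.G.Adj u v⟩
  f v y := N.f v (fun u => if h : u.1 ∈ J then y ⟨⟨u.1, h⟩, u.2⟩ else x u.1)

/-- The network on `J` controlled by a set `A` of states, given by its asynchronous state
transition graph: the edge union, over `x ∈ A`, of the graphs of the networks controlled by `x`. -/
def controlledAstg (N : BooleanNetwork V) (J : Set V) (A : Set (V → Bool)) (y y' : J → Bool) :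
    Prop :=
  ∃ x ∈ A, (N.control J x).astg y y'

end BooleanNetwork

/-- A family of Boolean networks is sparse when in-degrees are bounded by a constant. -/
def IsSparse (F : ∀ n : ℕ, Set (BooleanNetwork (Fin n))) : Prop :=
  ∃ d : ℕ, ∀ n, ∀ N ∈ F n, ∀ v : Fin n, {u | N.G.Adj u v}.ncard ≤ d

/-- A family of Boolean networks has bounded strong modules when the cardinality of strong modules
is bounded by a constant. -/
def HasBoundedStrongModules (F : ∀ n : ℕ, Set (BooleanNetwork (Fin n))) : Prop :=
  ∃ c : ℕ, ∀ n, ∀ N ∈ F n, ∀ C : Set (Fin n), N.IsStrongModule C → C.ncard ≤ c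

/-! ### Factorized representations -/

/-- An explicit list of states of a module, each state being the list of its bits. -/
abbrev StateList := List (List Bool)

/-- One level of a factorized representation: the list of vertices of a module, the (indices of
the) earlier modules on which its attractors depend, and a table. Each row of the table consists of
one explicit set of states for each of these earlier modules, and of an explicit list of sets of
states of the module itself. -/
structure Block (n : ℕ) where
  /-- the vertices of the module, in the order in which states are written -/
  verts : List (Fin n)
  /-- indices of the earlier modules that the table refers to -/
  parents : List ℕ
  /-- the table -/
  rows : List (List StateList × List StateList)

namespace Block

variable {n : ℕ}

/-- The vertex set of the module. -/
def support (b : Block n) : Set (Fin n) := {v | v ∈ b.verts}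

/-- The set of states of the module that is written as the list `l`. -/
def toSet (b : Block n) (l : StateList) : Set (b.support → Bool) :=
  {y | b.verts.attach.map (fun v => y ⟨v.1, v.2⟩) ∈ l}

end Block

/-- (The data of) a factorized representation: a list of modules with their tables. -/
abbrev FactorizedRep (n : ℕ) := List (Block n)

namespace FactorizedRep

variable {n : ℕ}

/-- A choice of a set `a i` of states of each module. -/
abbrev Choice (R : FactorizedRep n) := ∀ i : Fin R.length, Set ((R.get i).support → Bool)

/-- The sets of states that the table of module `i` lists, in the rows that are labelled by the
sets chosen for the parents of `i`. -/
def lookup (R : FactorizedRep n) (i : Fin R.length) (a : R.Choice) :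
    Set (Set ((R.get i).support → Bool)) :=
  {s | ∃ row ∈ (R.get i).rows,
    List.Forall₂ (fun (p : ℕ) (κ : StateList) =>
      ∃ h : p < R.length, (R.get ⟨p, h⟩).toSet κ = a ⟨p, h⟩) (R.get i).parents row.1 ∧
    ∃ l ∈ row.2, (R.get i).toSet l = s}

/-- The elements `(a₁, …, aₖ)` of the dependent sum described by the tables. -/
def Admissible (R : FactorizedRep n) (a : R.Choice) : Prop :=
  ∀ i, a i ∈ R.lookup i a

/-- The Cartesian product `a₁ × ⋯ × aₖ`, as a set of states of the whole network. -/
def product (R : FactorizedRep n) (a : R.Choice) : Set (Fin n → Bool) :=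
  {x | ∀ i, (fun v : (R.get i).support => x v.1) ∈ a i}

/-- The states of the network whose restrictions to the modules before `i` are in
`a₁ × ⋯ × aᵢ₋₁`. (The later coordinates are free; module `i` does not read them.) -/
def context (R : FactorizedRep n) (i : Fin R.length) (a : R.Choice) : Set (Fin n → Bool) :=
  {x | ∀ j, j < i → (fun v : (R.get j).support => x v.1) ∈ a j}

/-- `R` is a factorized representation of the attractors of `N`. -/
structure Represents (R : FactorizedRep n) (N : BooleanNetwork (Fin n)) : Prop where
  /-- vertices are listed without repetition -/
  nodup : ∀ i, (R.get i).verts.Nodup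
  /-- the modules are the strong modules of `N` -/
  strong : ∀ C : Set (Fin n), N.IsStrongModule C ↔ ∃ i, (R.get i).support = C
  /-- every strong module is listed once -/
  distinct : Function.Injective fun i => (R.get i).support
  /-- edges never go from a module to an earlier one -/
  topological : ∀ i j, ∀ u ∈ (R.get i).support, ∀ v ∈ (R.get j).support, N.G.Adj u v → i ≤ j
  /-- tables refer to earlier modules only -/
  earlier : ∀ i, ∀ p ∈ (R.get i).parents, p < i.1
  /-- the states listed in the table of a module have as many bits as the module has vertices -/
  length_eq : ∀ i, ∀ row ∈ (R.get i).rows, ∀ l ∈ row.2, ∀ w ∈ l,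
    w.length = (R.get i).verts.length
  /-- once `a₁, …, aᵢ₋₁` are chosen according to the tables, the table of module `i` lists exactly
  the attractors of module `i` controlled by `a₁ × ⋯ × aᵢ₋₁` -/
  modules : ∀ (a : R.Choice) (i : Fin R.length), (∀ j, j < i → a j ∈ R.lookup j a) →
    R.lookup i a = attractors (N.controlledAstg (R.get i).support (R.context i a))
  /-- the attractors of `N` are the products `a₁ × ⋯ × aₖ`, each obtained exactly once -/
  attractors : Set.BijOn R.product {a | R.Admissible a} (attractors N.astg)

end FactorizedRep

/-! ### Encodings as lists of numbers -/

/-- Self-delimiting encoding of a list: its length, followed by the codes of its entries. -/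
def encodeList {α : Type*} (e : α → List ℕ) (l : List α) : List ℕ :=
  l.length :: l.flatMap e

/-- Encoding of a list of states. -/
def StateList.encode (l : StateList) : List ℕ :=
  encodeList (encodeList fun b : Bool => [b.toNat]) l

/-- Encoding of a module with its table. -/
def Block.encode {n : ℕ} (b : Block n) : List ℕ :=
  encodeList (fun v : Fin n => [v.1]) b.verts ++ encodeList (fun p : ℕ => [p]) b.parents ++
    encodeList (fun row : List StateList × List StateList =>
      encodeList StateList.encode row.1 ++ encodeList StateList.encode row.2) b.rows

/-- Encoding of a factorized representation. -/
def FactorizedRep.encode {n : ℕ} (R : FactorizedRep n) : List ℕ :=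
  encodeList Block.encode R

namespace BooleanNetwork

variable {n : ℕ}

open Classical in
/-- The list of in-neighbours of `v`, in increasing order. -/
noncomputable def inNbrs (N : BooleanNetwork (Fin n)) (v : Fin n) : List (Fin n) :=
  (List.finRange n).filter fun u => N.G.Adj u v

/-- The truth table of `f v`: entry number `k` is the value of `f v` at the state in which the
`j`-th in-neighbour of `v` has as value the `j`-th binary digit of `k`. -/
noncomputable def truthTable (N : BooleanNetwork (Fin n)) (v : Fin n) : List ℕ :=
  (List.range (2 ^ (N.inNbrs v).length)).map fun k =>
    (N.f v fun u => k.testBit ((N.inNbrs v).idxOf u.1)).toNat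

/-- Encoding of a network: its dimension, followed, for each vertex, by its in-neighbours and its
truth table. -/
noncomputable def encode (N : BooleanNetwork (Fin n)) : List ℕ :=
  n :: (List.finRange n).flatMap fun v =>
    encodeList (fun u : Fin n => [u.1]) (N.inNbrs v) ++ N.truthTable v

end BooleanNetwork

/-! ### Random access machines -/

/-- Programs of a random access machine with registers and arrays of natural numbers, both named
by numerals (so a program uses finitely many of them), and a write-only output tape. The only
arithmetic operations are addition and truncated subtraction. -/
inductive Program : Type
  /-- `reg r := k` -/
  | const (r k : ℕ) : Program
  /-- `reg r := reg p + reg q` -/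
  | add (r p q : ℕ) : Program
  /-- `reg r := reg p - reg q`, truncated at zero -/
  | sub (r p q : ℕ) : Program
  /-- `reg r := arr A [reg p]` -/
  | load (r A p : ℕ) : Program
  /-- `arr A [reg p] := reg q` -/
  | store (A p q : ℕ) : Program
  /-- append `reg r` to the output -/
  | print (r : ℕ) : Program
  /-- sequential composition -/
  | seq (P Q : Program) : Program
  /-- if `reg r` is non-zero then `P` else `Q` -/
  | ite (r : ℕ) (P Q : Program) : Program
  /-- while `reg r` is non-zero do `P` -/
  | loop (r : ℕ) (P : Program) : Program

/-- The states of the machine. -/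
structure MachineState where
  /-- contents of the registers -/
  reg : ℕ → ℕ
  /-- contents of the arrays -/
  arr : ℕ → ℕ → ℕ
  /-- the output written so far -/
  out : List ℕ

namespace MachineState

/-- Assignment to a register. -/
def setReg (s : MachineState) (r k : ℕ) : MachineState :=
  { s with reg := Function.update s.reg r k }

/-- Assignment to an array cell. -/
def setArr (s : MachineState) (A p k : ℕ) : MachineState :=
  { s with arr := Function.update s.arr A (Function.update (s.arr A) p k) }

/-- Appending a number to the output. -/
def emit (s : MachineState) (k : ℕ) : MachineState :=
  { s with out := s.out ++ [k] }

/-- The initial state: the input stands in array `0`, everything else is zero. -/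
def init (input : List ℕ) : MachineState where
  reg := fun _ => 0
  arr := fun A p => if A = 0 then input.getD p 0 else 0
  out := []

end MachineState

/-- `Exec P s t s'`: started in state `s`, the program `P` halts in state `s'` after exactly `t`
steps. Each assignment, print instruction and test of a register is one step. -/
inductive Exec : Program → MachineState → ℕ → MachineState → Prop
  | const (s : MachineState) (r k : ℕ) : Exec (.const r k) s 1 (s.setReg r k)
  | add (s : MachineState) (r p q : ℕ) : Exec (.add r p q) s 1 (s.setReg r (s.reg p + s.reg q))
  | sub (s : MachineState) (r p q : ℕ) : Exec (.sub r p q) s 1 (s.setReg r (s.reg p - s.reg q))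
  | load (s : MachineState) (r A p : ℕ) :
      Exec (.load r A p) s 1 (s.setReg r (s.arr A (s.reg p)))
  | store (s : MachineState) (A p q : ℕ) :
      Exec (.store A p q) s 1 (s.setArr A (s.reg p) (s.reg q))
  | print (s : MachineState) (r : ℕ) : Exec (.print r) s 1 (s.emit (s.reg r))
  | seq {P Q : Program} {s s₁ s₂ : MachineState} {t₁ t₂ : ℕ} :
      Exec P s t₁ s₁ → Exec Q s₁ t₂ s₂ → Exec (.seq P Q) s (t₁ + t₂) s₂
  | ite_true {r : ℕ} {P Q : Program} {s s' : MachineState} {t : ℕ} :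
      s.reg r ≠ 0 → Exec P s t s' → Exec (.ite r P Q) s (t + 1) s'
  | ite_false {r : ℕ} {P Q : Program} {s s' : MachineState} {t : ℕ} :
      s.reg r = 0 → Exec Q s t s' → Exec (.ite r P Q) s (t + 1) s'
  | loop_exit {r : ℕ} {P : Program} {s : MachineState} :
      s.reg r = 0 → Exec (.loop r P) s 1 s
  | loop_next {r : ℕ} {P : Program} {s s₁ s₂ : MachineState} {t₁ t₂ : ℕ} :
      s.reg r ≠ 0 → Exec P s t₁ s₁ → Exec (.loop r P) s₁ t₂ s₂ →
        Exec (.loop r P) s (t₁ + t₂ + 1) s₂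

/-- On input `input`, the program `P` halts after exactly `t` steps with output `output`. -/
def Program.Computes (P : Program) (input : List ℕ) (t : ℕ) (output : List ℕ) : Prop :=
  ∃ s', Exec P (MachineState.init input) t s' ∧ s'.out = output

/-!
The attractors of a network factor along its strong modules. If `B` is an attractor of the part of
the network that lies before a module, then the states over `B` evolve as follows: the `B`-part can
be moved to any other state of `B` without touching the module, so that the module moves according
to the union, over all states in `B`, of its controlled transition graphs. Hence the attractors over
`B` are the products of `B` with the attractors of the module controlled by `B`. This is proved
directly for the whole network, in `BooleanNetwork.product_mem_attractors` and
`BooleanNetwork.attractor_eq_product`. A module reads only the modules of its in-neighbours, its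
*parents*, and so its attractors depend only on the sets chosen for them.

For sparse networks with bounded strong modules, a module together with the way in which it reads
its parents is described by a bounded number of bounded numbers, its `Profile`. There are finitely
many relevant profiles, and each determines the rows of the table (`tableRows`); they are correct by
`IsModuleLabelling.represents`. So the table of a module can be printed in constant time by a
decision tree over the entries of the profile (`ForProgram.dispatch`), with fixed lists at its
leaves.

It remains to find the strong modules in a topological order. A vertex reaches at least as many
vertices as each of its descendants, and equally many exactly if the two lie in the same strong
module. So the modules, represented by their largest vertices, are numbered by decreasing numbers of
descendants, ties being broken by these representatives (`isModuleLabelling_rank`). Descendants of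
one vertex are found by `n` rounds of marking successors, which takes quadratic time.

The machine program is written in a small language (`ForProgram`) all of whose loops run exactly `n`
times. Its semantics is a total function, so that correctness is a statement about functions of
states, and the running time of the compiled program is `O(n ^ k)` for loops nested to depth `k`
(`ForProgram.cost_le`, `ForProgram.exec_compile`); here `k = 3`.
-/

/-! ### A language of for-programs -/

/-- Arithmetic expressions over the variables and arrays of a machine state. -/
inductive NumExpr : Type
  /-- the variable `x` -/
  | var (x : ℕ) : NumExpr
  /-- a numeral -/
  | num (k : ℕ) : NumExpr
  /-- the entry of array `A` at `e` -/
  | get (A : ℕ) (e : NumExpr) : NumExpr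
  /-- sum -/
  | add (e e' : NumExpr) : NumExpr
  /-- truncated difference -/
  | sub (e e' : NumExpr) : NumExpr

/-- Programs all of whose loops run exactly `n` times, where `n` is a fixed dimension. Their
semantics is a total function, and their running time has a bound that can be read off from the
text of the program. -/
inductive ForProgram : Type
  /-- do nothing -/
  | skip : ForProgram
  /-- assignment to the variable `x` -/
  | assign (x : ℕ) (e : NumExpr) : ForProgram
  /-- assignment of `e'` to the entry of array `A` at `e` -/
  | put (A : ℕ) (e e' : NumExpr) : ForProgram
  /-- append a number to the output -/
  | print (e : NumExpr) : ForProgram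
  /-- sequential composition -/
  | seq (P Q : ForProgram) : ForProgram
  /-- `P` if `e` is non-zero, else `Q` -/
  | ite (e : NumExpr) (P Q : ForProgram) : ForProgram
  /-- execute `P` for `x = 0, …, n - 1` -/
  | loop (x : ℕ) (P : ForProgram) : ForProgram

namespace MachineState

variable (s : MachineState)

@[simp] theorem setReg_reg (r k : ℕ) : (s.setReg r k).reg = Function.update s.reg r k := rfl
@[simp] theorem setReg_arr (r k : ℕ) : (s.setReg r k).arr = s.arr := rfl
@[simp] theorem setReg_out (r k : ℕ) : (s.setReg r k).out = s.out := rfl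
@[simp] theorem setArr_reg (A p k : ℕ) : (s.setArr A p k).reg = s.reg := rfl
@[simp] theorem setArr_arr (A p k : ℕ) :
    (s.setArr A p k).arr = Function.update s.arr A (Function.update (s.arr A) p k) := rfl
@[simp] theorem setArr_out (A p k : ℕ) : (s.setArr A p k).out = s.out := rfl
@[simp] theorem emit_reg (k : ℕ) : (s.emit k).reg = s.reg := rfl
@[simp] theorem emit_arr (k : ℕ) : (s.emit k).arr = s.arr := rfl
@[simp] theorem emit_out (k : ℕ) : (s.emit k).out = s.out ++ [k] := rfl

end MachineState

namespace NumExpr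

/-- The value of an expression. -/
def eval (s : MachineState) : NumExpr → ℕ
  | var x => s.reg x
  | num k => k
  | get A e => s.arr A (e.eval s)
  | add e e' => e.eval s + e'.eval s
  | sub e e' => e.eval s - e'.eval s

/-- Machine code that puts the value of an expression into the register `2 * t + 2`. Register `0`
holds the dimension, odd registers hold the variables, and the positive even registers from
`2 * t + 2` on serve as scratch space. -/
def compile (t : ℕ) : NumExpr → Program
  | var x => .seq (.const (2 * t + 2) 0) (.add (2 * t + 2) (2 * x + 1) (2 * t + 2))
  | num k => .const (2 * t + 2) k
  | get A e => .seq (e.compile t) (.load (2 * t + 2) A (2 * t + 2))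
  | add e e' => .seq (e.compile t) (.seq (e'.compile (t + 1))
      (.add (2 * t + 2) (2 * t + 2) (2 * (t + 1) + 2)))
  | sub e e' => .seq (e.compile t) (.seq (e'.compile (t + 1))
      (.sub (2 * t + 2) (2 * t + 2) (2 * (t + 1) + 2)))

/-- The number of steps of the compiled expression. -/
def cost : NumExpr → ℕ
  | var _ => 2
  | num _ => 1
  | get _ e => e.cost + 1
  | add e e' => e.cost + (e'.cost + 1)
  | sub e e' => e.cost + (e'.cost + 1)

end NumExpr

namespace ForProgram

/-- The effect of a for-program in dimension `n`. -/
def run (n : ℕ) : ForProgram → MachineState → MachineState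
  | skip, s => s
  | assign x e, s => s.setReg x (e.eval s)
  | put A e e', s => s.setArr A (e.eval s) (e'.eval s)
  | print e, s => s.emit (e.eval s)
  | seq P Q, s => Q.run n (P.run n s)
  | ite e P Q, s => if e.eval s ≠ 0 then P.run n s else Q.run n s
  | loop x P, s => (List.range n).foldl (fun s j => P.run n (s.setReg x j)) s

/-- Machine code for a for-program, with the conventions of `NumExpr.compile`. -/
def compile (t : ℕ) : ForProgram → Program
  | skip => .const (2 * t + 2) 0
  | assign x e => .seq (e.compile t) (.seq (.const (2 * x + 1) 0)
      (.add (2 * x + 1) (2 * t + 2) (2 * x + 1)))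
  | put A e e' => .seq (e.compile t) (.seq (e'.compile (t + 1))
      (.store A (2 * t + 2) (2 * (t + 1) + 2)))
  | print e => .seq (e.compile t) (.print (2 * t + 2))
  | seq P Q => .seq (P.compile t) (Q.compile t)
  | ite e P Q => .seq (e.compile t) (.ite (2 * t + 2) (P.compile t) (Q.compile t))
  | loop x P => .seq (.const (2 * (t + 1) + 2) 0) (.seq (.const (2 * t + 2) 0)
      (.seq (.add (2 * t + 2) 0 (2 * t + 2))
        (.loop (2 * t + 2) (.seq (.const (2 * x + 1) 0)
          (.seq (.add (2 * x + 1) (2 * (t + 1) + 2) (2 * x + 1))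
            (.seq (P.compile (t + 2)) (.seq (.const (2 * (t + 2) + 2) 1)
              (.seq (.add (2 * (t + 1) + 2) (2 * (t + 1) + 2) (2 * (t + 2) + 2))
                (.sub (2 * t + 2) (2 * t + 2) (2 * (t + 2) + 2))))))))))

/-- An upper bound for the number of steps of the compiled program. -/
def cost (n : ℕ) : ForProgram → ℕ
  | skip => 1
  | assign _ e => e.cost + 2
  | put _ e e' => e.cost + (e'.cost + 1)
  | print e => e.cost + 1
  | seq P Q => P.cost n + Q.cost n
  | ite e P Q => e.cost + (max (P.cost n) (Q.cost n) + 1)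
  | loop _ P => n * (P.cost n + 6) + 4

/-- The nesting depth of loops. -/
def depth : ForProgram → ℕ
  | skip => 0
  | assign _ _ => 0
  | put _ _ _ => 0
  | print _ => 0
  | seq P Q => max P.depth Q.depth
  | ite _ P Q => max P.depth Q.depth
  | loop _ P => P.depth + 1

theorem cost_le (P : ForProgram) : ∃ C : ℕ, ∀ n, P.cost n ≤ C * (n + 1) ^ P.depth := by
  have key (k l C n : ℕ) (h : k ≤ l) : C * (n + 1) ^ k ≤ C * (n + 1) ^ l :=
    Nat.mul_le_mul_left _ (Nat.pow_le_pow_right (Nat.succ_pos _) h)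
  induction P with
  | skip => exact ⟨1, fun n => by simp [cost, depth]⟩
  | assign x e => exact ⟨e.cost + 2, fun n => by simp [cost, depth]⟩
  | put A e e' => exact ⟨e.cost + (e'.cost + 1), fun n => by simp [cost, depth]⟩
  | print e => exact ⟨e.cost + 1, fun n => by simp [cost, depth]⟩
  | seq P Q hP hQ =>
    obtain ⟨C, hC⟩ := hP
    obtain ⟨D, hD⟩ := hQ
    refine ⟨C + D, fun n => ?_⟩
    have h1 := (hC n).trans (key _ _ C n (le_max_left P.depth Q.depth))
    have h2 := (hD n).trans (key _ _ D n (le_max_right P.depth Q.depth))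
    simp only [cost, depth]
    linarith [add_mul C D ((n + 1) ^ max P.depth Q.depth)]
  | ite e P Q hP hQ =>
    obtain ⟨C, hC⟩ := hP
    obtain ⟨D, hD⟩ := hQ
    refine ⟨C + D + e.cost + 1, fun n => ?_⟩
    have h1 := (hC n).trans (key _ _ C n (le_max_left P.depth Q.depth))
    have h2 := (hD n).trans (key _ _ D n (le_max_right P.depth Q.depth))
    have h3 := key 0 (max P.depth Q.depth) (e.cost + 1) n (Nat.zero_le _)
    have h4 : max (P.cost n) (Q.cost n) ≤ P.cost n + Q.cost n := by omega
    simp only [cost, depth]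
    nlinarith
  | loop x P hP =>
    obtain ⟨C, hC⟩ := hP
    refine ⟨C + 10, fun n => ?_⟩
    have h1 : n * P.cost n ≤ (n + 1) * (C * (n + 1) ^ P.depth) :=
      Nat.mul_le_mul (Nat.le_succ n) (hC n)
    have h2 : 1 ≤ (n + 1) ^ P.depth := Nat.one_le_pow _ _ (Nat.succ_pos n)
    have h3 : (n + 1) * 10 * 1 ≤ (n + 1) * 10 * (n + 1) ^ P.depth := Nat.mul_le_mul_left _ h2
    simp only [cost, depth, pow_succ]
    nlinarith

end ForProgram

/-! ### Correctness of the compilation -/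

/-- The machine state `m` represents the state `s` of a for-program in dimension `n`. Nothing is
said about the scratch registers. -/
structure Simulates (n : ℕ) (s m : MachineState) : Prop where
  dim : m.reg 0 = n
  var : ∀ x, m.reg (2 * x + 1) = s.reg x
  arr : m.arr = s.arr
  out : m.out = s.out

namespace Simulates

variable {n : ℕ} {s m : MachineState}

theorem setReg_scratch (h : Simulates n s m) (t k : ℕ) :
    Simulates n s (m.setReg (2 * t + 2) k) := by
  refine ⟨?_, fun x => ?_, h.arr, h.out⟩
  · simpa [Function.update] using h.dim
  · have : 2 * x ≠ 2 * t + 1 := by omega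
    simpa [Function.update, this] using h.var x

theorem setReg_var (h : Simulates n s m) (x k : ℕ) :
    Simulates n (s.setReg x k) (m.setReg (2 * x + 1) k) := by
  refine ⟨?_, fun y => ?_, h.arr, h.out⟩
  · simpa [Function.update] using h.dim
  · by_cases hy : y = x <;> simp [Function.update, hy, h.var]

end Simulates

theorem NumExpr.exec_compile {n : ℕ} {s : MachineState} (e : NumExpr) :
    ∀ (t : ℕ) (m : MachineState), Simulates n s m →
      ∃ m', Exec (e.compile t) m e.cost m' ∧ m'.reg (2 * t + 2) = e.eval s ∧
        Simulates n s m' ∧ ∀ j < t, m'.reg (2 * j + 2) = m.reg (2 * j + 2) := by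
  have old (t k : ℕ) (m : MachineState) (j : ℕ) (hj : j < t) :
      (m.setReg (2 * t + 2) k).reg (2 * j + 2) = m.reg (2 * j + 2) := by
    have : j ≠ t := by omega
    simp [Function.update, this]
  induction e with
  | var x =>
    intro t m h
    refine ⟨_, .seq (.const _ _ _) (.add _ _ _ _), ?_,
      (h.setReg_scratch _ _).setReg_scratch _ _, ?_⟩
    · have : 2 * x ≠ 2 * t + 1 := by omega
      simp [Function.update, NumExpr.eval, h.var, this]
    · intro j hj
      rw [old _ _ _ _ hj, old _ _ _ _ hj]
  | num k =>
    intro t m h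
    exact ⟨_, .const _ _ _, by simp [NumExpr.eval], h.setReg_scratch _ _, old _ _ _⟩
  | get A e ih =>
    intro t m h
    obtain ⟨m', hm, hv, hs, ho⟩ := ih t m h
    refine ⟨_, .seq hm (.load _ _ _ _), ?_, hs.setReg_scratch _ _, fun j hj => ?_⟩
    · simp [NumExpr.eval, hv, hs.arr]
    · rw [old _ _ _ _ hj, ho j hj]
  | add e e' ih ih' =>
    intro t m h
    obtain ⟨m', hm, hv, hs, ho⟩ := ih t m h
    obtain ⟨m'', hm', hv', hs', ho'⟩ := ih' (t + 1) m' hs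
    refine ⟨_, .seq hm (.seq hm' (.add _ _ _ _)), ?_, hs'.setReg_scratch _ _, fun j hj => ?_⟩
    · simp [NumExpr.eval, hv', ho' t (Nat.lt_succ_self t), hv]
    · rw [old _ _ _ _ hj, ho' j (by omega), ho j hj]
  | sub e e' ih ih' =>
    intro t m h
    obtain ⟨m', hm, hv, hs, ho⟩ := ih t m h
    obtain ⟨m'', hm', hv', hs', ho'⟩ := ih' (t + 1) m' hs
    refine ⟨_, .seq hm (.seq hm' (.sub _ _ _ _)), ?_, hs'.setReg_scratch _ _, fun j hj => ?_⟩
    · simp [NumExpr.eval, hv', ho' t (Nat.lt_succ_self t), hv]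
    · rw [old _ _ _ _ hj, ho' j (by omega), ho j hj]

theorem MachineState.setReg_setReg (s : MachineState) (x k l : ℕ) :
    (s.setReg x k).setReg x l = s.setReg x l := by
  simp [MachineState.setReg]

theorem MachineState.setReg_odd_even (m : MachineState) (x k j : ℕ) :
    (m.setReg (2 * x + 1) k).reg (2 * j + 2) = m.reg (2 * j + 2) := by
  have : 2 * j + 2 ≠ 2 * x + 1 := by omega
  simp [Function.update, this]

/-- Compiled for-programs do what they should, within the time bound `ForProgram.cost`. -/
theorem ForProgram.exec_compile {n : ℕ} (P : ForProgram) :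
    ∀ (t : ℕ) (s m : MachineState), Simulates n s m →
      ∃ τ ≤ P.cost n, ∃ m', Exec (P.compile t) m τ m' ∧ Simulates n (P.run n s) m' ∧
        ∀ j < t, m'.reg (2 * j + 2) = m.reg (2 * j + 2) := by
  induction P with
  | skip =>
    intro t s m h
    refine ⟨1, le_rfl, _, .const _ _ _, h.setReg_scratch _ _, fun j hj => ?_⟩
    have : j ≠ t := by omega
    simp [Function.update, this]
  | assign x e =>
    intro t s m h
    obtain ⟨m', hm, hv, hs, ho⟩ := e.exec_compile t m h
    refine ⟨_, ?_, _, .seq hm (.seq (.const _ _ _) (.add _ _ _ _)), ?_, fun j hj => ?_⟩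
    · simp [cost]
    · rw [MachineState.setReg_setReg, MachineState.setReg_odd_even, hv]
      have := hs.setReg_var x (e.eval s)
      simpa [run] using this
    · rw [MachineState.setReg_odd_even, MachineState.setReg_odd_even, ho j hj]
  | put A e e' =>
    intro t s m h
    obtain ⟨m', hm, hv, hs, ho⟩ := e.exec_compile t m h
    obtain ⟨m'', hm', hv', hs', ho'⟩ := e'.exec_compile (t + 1) m' hs
    refine ⟨_, le_rfl, _, .seq hm (.seq hm' (.store _ _ _ _)), ?_, fun j hj => ?_⟩
    · refine ⟨hs'.dim, hs'.var, ?_, hs'.out⟩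
      simp [run, hv', ho' t (Nat.lt_succ_self t), hv, hs'.arr]
    · exact (ho' j (by omega)).trans (ho j hj)
  | print e =>
    intro t s m h
    obtain ⟨m', hm, hv, hs, ho⟩ := e.exec_compile t m h
    refine ⟨_, le_rfl, _, .seq hm (.print _ _), ?_, ho⟩
    exact ⟨hs.dim, hs.var, hs.arr, by simp [run, hv, hs.out]⟩
  | seq P Q hP hQ =>
    intro t s m h
    obtain ⟨τ, hτ, m', hm, hs, ho⟩ := hP t s m h
    obtain ⟨τ', hτ', m'', hm', hs', ho'⟩ := hQ t _ m' hs
    exact ⟨_, add_le_add hτ hτ', m'', .seq hm hm', hs', fun j hj => (ho' j hj).trans (ho j hj)⟩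
  | ite e P Q hP hQ =>
    intro t s m h
    obtain ⟨m', hm, hv, hs, ho⟩ := e.exec_compile t m h
    by_cases he : e.eval s ≠ 0
    · obtain ⟨τ, hτ, m'', hm', hs', ho'⟩ := hP t s m' hs
      refine ⟨_, ?_, m'', .seq hm (.ite_true (hv ▸ he) hm'), by simpa [run, he] using hs',
        fun j hj => (ho' j hj).trans (ho j hj)⟩
      simp only [cost]
      have := le_max_left (P.cost n) (Q.cost n)
      omega
    · rw [not_not] at he
      obtain ⟨τ, hτ, m'', hm', hs', ho'⟩ := hQ t s m' hs
      refine ⟨_, ?_, m'', .seq hm (.ite_false (hv ▸ he) hm'), by simpa [run, he] using hs',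
        fun j hj => (ho' j hj).trans (ho j hj)⟩
      simp only [cost]
      have := le_max_right (P.cost n) (Q.cost n)
      omega
  | loop x P hP =>
    intro t s m h
    -- the loop that is left after `a` rounds, when `r` rounds are still to come
    have main : ∀ (r a : ℕ) (s m : MachineState), Simulates n s m → m.reg (2 * t + 2) = r →
        m.reg (2 * (t + 1) + 2) = a → ∃ τ ≤ r * (P.cost n + 6) + 1, ∃ m',
        Exec (.loop (2 * t + 2) (.seq (.const (2 * x + 1) 0)
          (.seq (.add (2 * x + 1) (2 * (t + 1) + 2) (2 * x + 1))
            (.seq (P.compile (t + 2)) (.seq (.const (2 * (t + 2) + 2) 1)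
              (.seq (.add (2 * (t + 1) + 2) (2 * (t + 1) + 2) (2 * (t + 2) + 2))
                (.sub (2 * t + 2) (2 * t + 2) (2 * (t + 2) + 2)))))))) m τ m' ∧
        Simulates n ((List.range' a r).foldl (fun s j => P.run n (s.setReg x j)) s) m' ∧
        ∀ j < t, m'.reg (2 * j + 2) = m.reg (2 * j + 2) := by
      intro r
      induction r with
      | zero =>
        intro a s m h hr _
        exact ⟨1, by simp, m, .loop_exit hr, by simpa using h, fun j _ => rfl⟩
      | succ r ih =>
        intro a s m h hr ha
        have h1 := h.setReg_var x a
        obtain ⟨τ, hτ, m', hm, hs, ho⟩ := hP (t + 2) _ _ h1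
        have e1 : m'.reg (2 * t + 2) = r + 1 := by
          rw [ho t (by omega), MachineState.setReg_odd_even, hr]
        have e2 : m'.reg (2 * (t + 1) + 2) = a := by
          rw [ho (t + 1) (by omega), MachineState.setReg_odd_even, ha]
        have h3 := ((hs.setReg_scratch (t + 2) 1).setReg_scratch (t + 1) (a + 1)).setReg_scratch t r
        obtain ⟨τ', hτ', m'', hm', hs', ho'⟩ := ih (a + 1) _ _ h3
          (by simp) (by simp [Function.update])
        have body : Exec (.seq (.const (2 * x + 1) 0)
          (.seq (.add (2 * x + 1) (2 * (t + 1) + 2) (2 * x + 1))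
            (.seq (P.compile (t + 2)) (.seq (.const (2 * (t + 2) + 2) 1)
              (.seq (.add (2 * (t + 1) + 2) (2 * (t + 1) + 2) (2 * (t + 2) + 2))
                (.sub (2 * t + 2) (2 * t + 2) (2 * (t + 2) + 2))))))) m
            (1 + (1 + (τ + (1 + (1 + 1)))))
            (((m'.setReg (2 * (t + 2) + 2) 1).setReg (2 * (t + 1) + 2) (a + 1)).setReg
              (2 * t + 2) r) := by
          refine .seq (.const _ _ _) (.seq (.add _ _ _ _) ?_)
          rw [MachineState.setReg_setReg, MachineState.setReg_odd_even, ha]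
          simp only [MachineState.setReg_reg, Function.update_self, add_zero]
          refine .seq hm (.seq (.const _ _ _) ?_)
          have a1 := Exec.add (m'.setReg (2 * (t + 2) + 2) 1) (2 * (t + 1) + 2) (2 * (t + 1) + 2)
            (2 * (t + 2) + 2)
          have v1 : (m'.setReg (2 * (t + 2) + 2) 1).reg (2 * (t + 1) + 2) +
              (m'.setReg (2 * (t + 2) + 2) 1).reg (2 * (t + 2) + 2) = a + 1 := by
            simp [Function.update, ← e2]
          rw [v1] at a1
          refine .seq a1 ?_
          have a2 := Exec.sub ((m'.setReg (2 * (t + 2) + 2) 1).setReg (2 * (t + 1) + 2) (a + 1))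
            (2 * t + 2) (2 * t + 2) (2 * (t + 2) + 2)
          have v2 : ((m'.setReg (2 * (t + 2) + 2) 1).setReg (2 * (t + 1) + 2) (a + 1)).reg
              (2 * t + 2) - ((m'.setReg (2 * (t + 2) + 2) 1).setReg
              (2 * (t + 1) + 2) (a + 1)).reg (2 * (t + 2) + 2) = r := by
            simp [Function.update, e1]
          rwa [v2] at a2
        refine ⟨_, ?_, m'', .loop_next (by omega) body hm', ?_, fun j hj => ?_⟩
        · rw [Nat.succ_mul]
          omega
        · simpa [List.range'_succ] using hs'
        · rw [ho' j hj]
          have c1 : j ≠ t := by omega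
          have c2 : j ≠ t + 1 := by omega
          have c3 : j ≠ t + 2 := by omega
          have : m'.reg (2 * j + 2) = m.reg (2 * j + 2) := by
            rw [ho j (by omega), MachineState.setReg_odd_even]
          simpa [Function.update, c1, c2, c3] using this
    have h2 := (h.setReg_scratch (t + 1) 0).setReg_scratch t n
    obtain ⟨τ, hτ, m', hm, hs, ho⟩ := main n 0 s _ h2 (by simp) (by simp [Function.update])
    have a1 := Exec.add ((m.setReg (2 * (t + 1) + 2) 0).setReg (2 * t + 2) 0)
      (2 * t + 2) 0 (2 * t + 2)
    have v1 : ((m.setReg (2 * (t + 1) + 2) 0).setReg (2 * t + 2) 0).reg 0 +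
        ((m.setReg (2 * (t + 1) + 2) 0).setReg (2 * t + 2) 0).reg (2 * t + 2) = n := by
      simp [Function.update, ← h.dim]
    rw [v1, MachineState.setReg_setReg] at a1
    refine ⟨_, ?_, m', .seq (.const _ _ _) (.seq (.const _ _ _) (.seq a1 hm)), ?_, fun j hj => ?_⟩
    · simp only [cost]
      omega
    · simpa [run, List.range_eq_range'] using hs
    · rw [ho j hj]
      have c1 : j ≠ t := by omega
      have c2 : j ≠ t + 1 := by omega
      simp [Function.update, c1, c2]

/-- A for-program whose loops are nested to depth at most three yields a machine program that
needs time `O(n ^ 3)` on inputs that begin with the dimension `n`. -/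
theorem ForProgram.exists_program (P : ForProgram) (hP : P.depth ≤ 3) :
    ∃ (Q : Program) (T : ℕ → ℕ), (fun n => (T n : ℝ)) =O[atTop] (fun n => (n : ℝ) ^ 3) ∧
      ∀ (n : ℕ) (input : List ℕ), input.getD 0 0 = n →
        ∃ t ≤ T n, Q.Computes input t (P.run n (MachineState.init input)).out := by
  refine ⟨.seq (.load 0 0 0) (P.compile 0), fun n => 1 + P.cost n, ?_, fun n input hn => ?_⟩
  · obtain ⟨C, hC⟩ := P.cost_le
    refine IsBigO.of_bound (8 * (C + 1)) ?_
    filter_upwards [eventually_ge_atTop 1] with n hn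
    have h1 : 1 + P.cost n ≤ (C + 1) * (n + 1) ^ 3 := by
      have h2 : C * (n + 1) ^ P.depth ≤ C * (n + 1) ^ 3 :=
        Nat.mul_le_mul_left _ (Nat.pow_le_pow_right (Nat.succ_pos _) hP)
      have h3 : 1 ≤ (n + 1) ^ 3 := Nat.one_le_pow _ _ (Nat.succ_pos n)
      have := hC n
      nlinarith
    have h4 : (n + 1) ^ 3 ≤ (2 * n) ^ 3 := Nat.pow_le_pow_left (by omega) 3
    have h5 : 1 + P.cost n ≤ (C + 1) * (2 * n) ^ 3 := h1.trans (Nat.mul_le_mul_left _ h4)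
    have h6 : ((1 + P.cost n : ℕ) : ℝ) ≤ ((C + 1) * (2 * n) ^ 3 : ℕ) := by exact_mod_cast h5
    rw [Real.norm_of_nonneg (by positivity), Real.norm_of_nonneg (by positivity)]
    refine h6.trans (le_of_eq ?_)
    push_cast
    ring
  · have h : Simulates n (MachineState.init input) ((MachineState.init input).setReg 0 n) :=
      ⟨by simp, fun x => by simp [Function.update, MachineState.init], rfl, rfl⟩
    obtain ⟨τ, hτ, m', hm, hs, -⟩ := P.exec_compile 0 _ _ h
    refine ⟨1 + τ, by simpa using hτ, m',
      .seq (s₁ := (MachineState.init input).setReg 0 n) ?_ hm, hs.out⟩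
    have := Exec.load (MachineState.init input) 0 0 0
    simpa [MachineState.init, ← hn] using this

/-! ### Reasoning about for-programs -/

namespace ForProgram

variable {n : ℕ}

@[simp] theorem run_skip (s : MachineState) : skip.run n s = s := rfl
@[simp] theorem run_assign (x : ℕ) (e : NumExpr) (s : MachineState) :
    (assign x e).run n s = s.setReg x (e.eval s) := rfl
@[simp] theorem run_put (A : ℕ) (e e' : NumExpr) (s : MachineState) :
    (put A e e').run n s = s.setArr A (e.eval s) (e'.eval s) := rfl
@[simp] theorem run_print (e : NumExpr) (s : MachineState) :
    (print e).run n s = s.emit (e.eval s) := rfl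
@[simp] theorem run_seq (P Q : ForProgram) (s : MachineState) :
    (seq P Q).run n s = Q.run n (P.run n s) := rfl
theorem run_ite (e : NumExpr) (P Q : ForProgram) (s : MachineState) :
    (ite e P Q).run n s = if e.eval s ≠ 0 then P.run n s else Q.run n s := rfl

theorem run_loop_induction {x : ℕ} {P : ForProgram} {s : MachineState}
    (I : ℕ → MachineState → Prop) (h0 : I 0 s)
    (hs : ∀ j < n, ∀ s, I j s → I (j + 1) (P.run n (s.setReg x j))) :
    I n ((loop x P).run n s) := by
  have (j : ℕ) (hj : j ≤ n) :
      I j ((List.range j).foldl (fun s j => P.run n (s.setReg x j)) s) := by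
    induction j with
    | zero => simpa using h0
    | succ j ih =>
      rw [List.range_succ, List.foldl_append]
      exact hs j hj _ (ih (by omega))
  exact this n le_rfl

/-- The program text contains no assignment to the variable `x`, not even as a loop variable. -/
def KeepsVar (x : ℕ) : ForProgram → Prop
  | skip => True
  | assign y _ => x ≠ y
  | put _ _ _ => True
  | print _ => True
  | seq P Q => P.KeepsVar x ∧ Q.KeepsVar x
  | ite _ P Q => P.KeepsVar x ∧ Q.KeepsVar x
  | loop y P => x ≠ y ∧ P.KeepsVar x

/-- The program text contains no assignment to an entry of the array `A`. -/
def KeepsArr (A : ℕ) : ForProgram → Prop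
  | skip => True
  | assign _ _ => True
  | put B _ _ => A ≠ B
  | print _ => True
  | seq P Q => P.KeepsArr A ∧ Q.KeepsArr A
  | ite _ P Q => P.KeepsArr A ∧ Q.KeepsArr A
  | loop _ P => P.KeepsArr A

/-- The program text contains no print instruction. -/
def Silent : ForProgram → Prop
  | skip => True
  | assign _ _ => True
  | put _ _ _ => True
  | print _ => False
  | seq P Q => P.Silent ∧ Q.Silent
  | ite _ P Q => P.Silent ∧ Q.Silent
  | loop _ P => P.Silent

theorem KeepsVar.run_eq {x : ℕ} {P : ForProgram} (h : P.KeepsVar x) (s : MachineState) :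
    (P.run n s).reg x = s.reg x := by
  induction P generalizing s with
  | skip | put | print => simp
  | assign y e =>
    simp only [KeepsVar] at h
    simp [Function.update, h]
  | seq P Q hP hQ => rw [run_seq, hQ h.2, hP h.1]
  | ite e P Q hP hQ => rw [run_ite]; split_ifs <;> simp [hP h.1, hQ h.2]
  | loop y P hP =>
    refine run_loop_induction (fun _ s' => s'.reg x = s.reg x) rfl fun j _ s' hs => ?_
    rw [hP h.2, MachineState.setReg_reg, Function.update_of_ne h.1, hs]

theorem KeepsArr.run_eq {A : ℕ} {P : ForProgram} (h : P.KeepsArr A) (s : MachineState) :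
    (P.run n s).arr A = s.arr A := by
  induction P generalizing s with
  | skip | assign | print => simp
  | put B e e' =>
    simp only [KeepsArr] at h
    simp [Function.update, h]
  | seq P Q hP hQ => rw [run_seq, hQ h.2, hP h.1]
  | ite e P Q hP hQ => rw [run_ite]; split_ifs <;> simp [hP h.1, hQ h.2]
  | loop y P hP =>
    exact run_loop_induction (fun _ s' => s'.arr A = s.arr A) rfl fun j _ s' hs => by
      rw [hP h, MachineState.setReg_arr, hs]

theorem Silent.run_eq {P : ForProgram} (h : P.Silent) (s : MachineState) :
    (P.run n s).out = s.out := by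
  induction P generalizing s with
  | skip | assign | put => simp
  | print e => exact h.elim
  | seq P Q hP hQ => rw [run_seq, hQ h.2, hP h.1]
  | ite e P Q hP hQ => rw [run_ite]; split_ifs <;> simp [hP h.1, hQ h.2]
  | loop y P hP =>
    exact run_loop_induction (fun _ s' => s'.out = s.out) rfl fun j _ s' hs => by
      rw [hP h, MachineState.setReg_out, hs]

end ForProgram

/-! ### Attractors of a network and of its modules -/

/-- The attractors are the non-empty sets of states that are closed under transitions and in which
every state can be reached from every other one. -/
theorem mem_attractors_iff {S : Type*} {r : S → S → Prop} {a : Set S} :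
    a ∈ attractors r ↔ a.Nonempty ∧ (∀ y ∈ a, ∀ z, r y z → z ∈ a) ∧
      ∀ y ∈ a, ∀ z ∈ a, Relation.ReflTransGen r y z := by
  constructor
  · rintro ⟨⟨x, rfl⟩, h⟩
    exact ⟨⟨x, .refl, .refl⟩, h, fun y hy z hz => hy.2.trans hz.1⟩
  · rintro ⟨⟨x, hx⟩, h, hc⟩
    refine ⟨⟨x, ?_⟩, h⟩
    have hr : ∀ y, Relation.ReflTransGen r x y → y ∈ a := fun y hy => by
      induction hy with
      | refl => exact hx
      | tail _ h2 ih => exact h _ ih _ h2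
    ext y
    exact ⟨fun hy => ⟨hc x hx y hy, hc y hy x hx⟩, fun hy => hr y hy.1⟩

theorem reflTransGen_of_equiv {S S' : Type*} {r : S → S → Prop} {r' : S' → S' → Prop} (φ : S ≃ S')
    (h : ∀ x y, r x y ↔ r' (φ x) (φ y)) (x y : S) :
    Relation.ReflTransGen r x y ↔ Relation.ReflTransGen r' (φ x) (φ y) := by
  constructor
  · exact fun hxy => hxy.lift φ fun a b => (h a b).1
  · intro hxy
    have := hxy.lift (p := r) φ.symm fun a b hab => (h _ _).2 (by simpa using hab)
    simpa [Function.onFun] using this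

theorem preimage_mem_attractors_iff {S S' : Type*} {r : S → S → Prop} {r' : S' → S' → Prop}
    (φ : S ≃ S') (h : ∀ x y, r x y ↔ r' (φ x) (φ y)) (a : Set S') :
    φ ⁻¹' a ∈ attractors r ↔ a ∈ attractors r' := by
  simp only [mem_attractors_iff, Set.mem_preimage, h, reflTransGen_of_equiv φ h]
  refine and_congr ⟨fun ⟨x, hx⟩ => ⟨_, hx⟩, fun ⟨x, hx⟩ => ⟨φ.symm x, by simpa using hx⟩⟩
    (and_congr ?_ ?_)
  · simp [φ.forall_congr_left]
  · simp [φ.forall_congr_left]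

namespace BooleanNetwork

variable {V : Type*} {N : BooleanNetwork V}

open Classical in
/-- The state `z`, with the coordinates in `J` replaced by those of `y`. -/
noncomputable def patch (J : Set V) (z : V → Bool) (y : J → Bool) : V → Bool :=
  fun u => if h : u ∈ J then y ⟨u, h⟩ else z u

theorem patch_of_mem {J : Set V} {z : V → Bool} {y : J → Bool} {u : V} (h : u ∈ J) :
    patch J z y u = y ⟨u, h⟩ := by simp [patch, h]

theorem patch_of_notMem {J : Set V} {z : V → Bool} {y : J → Bool} {u : V} (h : u ∉ J) :
    patch J z y u = z u := by simp [patch, h]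

theorem control_f_eq {J : Set V} {w : V → Bool} (v : J) (y : J → Bool) :
    (N.control J w).f v (fun u => y u.1) = N.f v fun u => patch J w y u.1 := rfl

section Factorization

variable {k : ℕ} {I : Fin k → Set V} {ix : V → Fin k}

theorem controlledAstg_of_astg {J : Set V} {A : Set (V → Bool)} {x x' : V → Bool} (hx : x ∈ A)
    {v : V} (hv : v ∈ J) (h1 : N.f v (fun u => x u.1) = x' v) (h2 : x' v ≠ x v)
    (h3 : ∀ u, u ≠ v → x' u = x u) :
    N.controlledAstg J A (fun u => x u.1) fun u => x' u.1 := by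
  refine ⟨x, hx, ⟨v, hv⟩, ?_, h2, fun u hu => h3 _ fun h => hu (Subtype.ext h)⟩
  refine (control_f_eq ⟨v, hv⟩ fun u => x u.1).trans ?_
  convert h1 using 3 with u
  by_cases h : u.1 ∈ J
  · rw [patch_of_mem h]
  · rw [patch_of_notMem h]

/-- A transition of a controlled module lifts to every state of the network that agrees with the
controlling state on the earlier modules. -/
theorem astg_patch (hI : ∀ i v, v ∈ I i ↔ ix v = i) (ht : ∀ u v, N.G.Adj u v → ix u ≤ ix v)
    {i : Fin k} {w z : V → Bool} {y y' : I i → Bool} (h : (N.control (I i) w).astg y y')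
    (hzw : ∀ u, ix u < i → z u = w u) (hzy : ∀ u : I i, z u = y u) :
    N.astg z (patch (I i) z y') := by
  obtain ⟨v, h1, h2, h3⟩ := h
  rw [control_f_eq] at h1
  refine ⟨v, ?_, ?_, fun u hu => ?_⟩
  · rw [patch_of_mem v.2, ← h1]
    congr 1
    ext u
    by_cases h : u.1 ∈ I i
    · rw [patch_of_mem h]
      exact hzy ⟨u.1, h⟩
    · rw [patch_of_notMem h]
      have hle := ht _ _ u.2
      rw [(hI i v).1 v.2] at hle
      exact hzw _ (lt_of_le_of_ne hle fun e => h ((hI _ _).2 e))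
  · rw [patch_of_mem v.2, hzy v]
    exact h2
  · by_cases h : u ∈ I i
    · rw [patch_of_mem h, h3 ⟨u, h⟩ fun e => hu (congrArg Subtype.val e)]
      exact (hzy ⟨u, h⟩).symm
    · rw [patch_of_notMem h]

/-- A path of the network can be imitated on the modules up to `i` without touching the others. -/
theorem exists_imitation (ht : ∀ u v, N.G.Adj u v → ix u ≤ ix v) (i : Fin k) {x x' z : V → Bool}
    (h : Relation.ReflTransGen N.astg x x') (hz : ∀ u, ix u ≤ i → z u = x u) :
    ∃ z', Relation.ReflTransGen N.astg z z' ∧ (∀ u, ix u ≤ i → z' u = x' u) ∧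
      ∀ u, i < ix u → z' u = z u := by
  classical
  induction h with
  | refl => exact ⟨z, .refl, hz, fun _ _ => rfl⟩
  | @tail p p' _ hp ih =>
    obtain ⟨z', h1, h2, h3⟩ := ih
    obtain ⟨v, e1, e2, e3⟩ := hp
    by_cases hv : ix v ≤ i
    · refine ⟨Function.update z' v (p' v), h1.tail ⟨v, ?_, ?_, ?_⟩, fun u hu => ?_, fun u hu => ?_⟩
      · rw [Function.update_self, ← e1]
        congr 1
        ext u
        exact h2 _ ((ht _ _ u.2).trans hv)
      · rwa [Function.update_self, h2 v hv]
      · exact fun u hu => Function.update_of_ne hu _ _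
      · by_cases huv : u = v
        · subst huv
          simp
        · rw [Function.update_of_ne huv, h2 u hu, e3 u huv]
      · rw [Function.update_of_ne (by rintro rfl; exact absurd hu (not_lt.2 hv)), h3 u hu]
    · refine ⟨z', h1, fun u hu => ?_, h3⟩
      rw [h2 u hu, e3 u (by rintro rfl; exact hv hu)]

/-- Products of attractors of the controlled modules are attractors of the network. -/
theorem product_mem_attractors (hI : ∀ i v, v ∈ I i ↔ ix v = i)
    (ht : ∀ u v, N.G.Adj u v → ix u ≤ ix v) (a : ∀ i, Set (I i → Bool))
    (ha : ∀ i, a i ∈ attractors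
      (N.controlledAstg (I i) {x | ∀ j, j < i → (fun v : I j => x v.1) ∈ a j})) :
    {x : V → Bool | ∀ i, (fun v : I i => x v.1) ∈ a i} ∈ attractors N.astg := by
  simp only [mem_attractors_iff] at ha ⊢
  choose hne hcl hst using ha
  refine ⟨?_, ?_, ?_⟩
  · choose y hy using hne
    refine ⟨fun v => y (ix v) ⟨v, (hI _ _).2 rfl⟩, fun i => ?_⟩
    convert hy i using 1
    ext ⟨v, hv⟩
    obtain rfl := (hI i v).1 hv
    rfl
  · rintro x hx x' ⟨v, h1, h2, h3⟩ i
    by_cases hv : v ∈ I i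
    · exact hcl i _ (hx i) _ (controlledAstg_of_astg (fun j _ => hx j) hv h1 h2 h3)
    · convert hx i using 1
      ext u
      exact h3 _ fun h => hv (h ▸ u.2)
  · -- modify one module after the other, beginning with the last one
    have key (m : ℕ) (hm : m ≤ k) : ∀ x ∈ {x : V → Bool | ∀ i, (fun v : I i => x v.1) ∈ a i},
        ∀ x' ∈ {x : V → Bool | ∀ i, (fun v : I i => x v.1) ∈ a i},
        (∀ u, m ≤ (ix u : ℕ) → x u = x' u) → Relation.ReflTransGen N.astg x x' := by
      induction m with
      | zero =>
        intro x _ x' _ h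
        obtain rfl : x = x' := funext fun u => h u (Nat.zero_le _)
        exact .refl
      | succ m ih =>
        intro x hx x' hx' h
        have ih := ih (by omega)
        let i : Fin k := ⟨m, hm⟩
        -- a path of the controlled module is followed, with detours through the earlier modules
        have path (y : I i → Bool) (hy : Relation.ReflTransGen (N.controlledAstg (I i)
            {x | ∀ j, j < i → (fun v : I j => x v.1) ∈ a j}) (fun v => x v.1) y) :
            ∃ z, (∀ i, (fun v : I i => z v.1) ∈ a i) ∧ (∀ u : I i, z u = y u) ∧
              (∀ u, i < ix u → z u = x u) ∧ Relation.ReflTransGen N.astg x z := by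
          induction hy with
          | refl => exact ⟨x, hx, fun _ => rfl, fun _ _ => rfl, .refl⟩
          | @tail y y' _ hyy ih2 =>
            obtain ⟨z, hz, hzy, hzx, hp⟩ := ih2
            have hy' : y' ∈ a i := by
              refine hcl i y ?_ _ hyy
              convert hz i using 1
              ext u
              exact (hzy u).symm
            obtain ⟨w, hw, hs⟩ := hyy
            classical
            let z' : V → Bool := fun u => if ix u < i then w u else z u
            have hz' : ∀ j, (fun v : I j => z' v.1) ∈ a j := fun j => by
              by_cases hj : j < i
              · convert hw j hj using 1
                ext u
                simp only [z', (hI j u).1 u.2, hj, if_true]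
              · convert hz j using 1
                ext u
                simp only [z', (hI j u).1 u.2, hj, if_false]
            have p1 := ih z hz z' hz' fun u hu => by
              have : ¬ ix u < i := fun hlt => absurd (Fin.lt_def.1 hlt) (not_lt.2 hu)
              simp only [z', this, if_false]
            have p2 := astg_patch hI ht hs (z := z') (fun u hu => by simp only [z', hu, if_true])
              fun u => by
                have : ¬ ix u.1 < i := by rw [(hI i u).1 u.2]; exact lt_irrefl i
                simp only [z', this, if_false, hzy]
            refine ⟨patch (I i) z' y', fun j => ?_, fun u => patch_of_mem u.2, fun u hu => ?_,
              (hp.trans p1).tail p2⟩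
            · by_cases hj : j = i
              · subst hj
                convert hy' using 1
                ext u
                exact patch_of_mem u.2
              · convert hz' j using 1
                ext u
                exact patch_of_notMem fun hu => hj (by
                  rw [← (hI j u).1 u.2, (hI i u).1 hu])
            · have h1 : u ∉ I i := fun hu' => hu.ne' ((hI i u).1 hu')
              have h2 : ¬ ix u < i := not_lt.2 hu.le
              rw [patch_of_notMem h1]
              simp only [z', h2, if_false, hzx u hu]
        obtain ⟨z, hz, hzy, hzx, hp⟩ := path (fun v => x' v.1) (hst i _ (hx i) _ (hx' i))
        refine hp.trans (ih z hz x' hx' fun u hu => ?_)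
        by_cases hu' : ix u = i
        · exact hzy ⟨u, (hI i u).2 hu'⟩
        · have h1 : m ≠ (ix u : ℕ) := fun e => hu' (Fin.ext e.symm)
          have h2 : i < ix u := Fin.lt_def.2 (lt_of_le_of_ne hu h1)
          rw [hzx u h2, h u (lt_of_le_of_ne hu h1)]
    exact fun x hx x' hx' => key k le_rfl x hx x' hx' fun u hu =>
      absurd (ix u).2 (not_lt.2 hu)

/-- Every attractor of the network is the product of its projections to the modules, and these are
attractors of the controlled modules. -/
theorem attractor_eq_product (hI : ∀ i v, v ∈ I i ↔ ix v = i)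
    (ht : ∀ u v, N.G.Adj u v → ix u ≤ ix v) {A : Set (V → Bool)} (hA : A ∈ attractors N.astg) :
    {x : V → Bool | ∀ i, (fun v : I i => x v.1) ∈ (fun x (v : I i) => x v.1) '' A} = A ∧
    ∀ i, (fun x (v : I i) => x v.1) '' A ∈ attractors (N.controlledAstg (I i)
      {x | ∀ j, j < i → (fun v : I j => x v.1) ∈ (fun x (v : I j) => x v.1) '' A}) := by
  obtain ⟨hne, hcl, hst⟩ := mem_attractors_iff.1 hA
  have hcl' : ∀ x ∈ A, ∀ x', Relation.ReflTransGen N.astg x x' → x' ∈ A := fun x hx x' h => by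
    induction h with
    | refl => exact hx
    | tail _ h2 ih => exact hcl _ ih _ h2
  -- the projections to different modules can be combined arbitrarily
  have mix (m : ℕ) (hm : m ≤ k) : ∀ x ∈ A, ∀ z : V → Bool,
      (∀ j : Fin k, (j : ℕ) < m → (fun v : I j => z v.1) ∈ (fun x (v : I j) => x v.1) '' A) →
      (∀ u, m ≤ (ix u : ℕ) → z u = x u) → z ∈ A := by
    induction m with
    | zero =>
      intro x hx z _ h
      obtain rfl : z = x := funext fun u => h u (Nat.zero_le _)
      exact hx
    | succ m ih =>
      intro x hx z hz h
      let i : Fin k := ⟨m, hm⟩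
      obtain ⟨w, hw, hwz⟩ := hz i (Nat.lt_succ_self m)
      obtain ⟨x', p1, p2, p3⟩ := exists_imitation ht i (hst x hx w hw) (z := x) fun _ _ => rfl
      refine ih (by omega) x' (hcl' x hx x' p1) z (fun j hj => hz j (by omega)) fun u hu => ?_
      by_cases hu' : ix u = i
      · rw [p2 u hu'.le]
        exact (congrFun hwz ⟨u, (hI i u).2 hu'⟩).symm
      · have h1 : m ≠ (ix u : ℕ) := fun e => hu' (Fin.ext e.symm)
        have h2 : i < ix u := Fin.lt_def.2 (lt_of_le_of_ne hu h1)
        rw [p3 u h2, h u (lt_of_le_of_ne hu h1)]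
  refine ⟨?_, fun i => ?_⟩
  · ext z
    refine ⟨fun hz => ?_, fun hz i => ⟨z, hz, rfl⟩⟩
    obtain ⟨x, hx⟩ := hne
    exact mix k le_rfl x hx z (fun j _ => hz j) fun u hu => absurd (ix u).2 (not_lt.2 hu)
  · refine mem_attractors_iff.2 ⟨hne.image _, ?_, ?_⟩
    · rintro _ ⟨w, hw, rfl⟩ y' ⟨x, hx, hs⟩
      classical
      let z : V → Bool := fun u => if ix u < i then x u else w u
      have hz : z ∈ A := by
        refine mix i i.2.le w hw z (fun j hj => ?_) fun u hu => ?_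
        · convert hx j (Fin.lt_def.2 hj) using 1
          ext u
          have : j < i := Fin.lt_def.2 hj
          simp only [z, (hI j u).1 u.2, this, if_true]
        · have : ¬ ix u < i := fun hlt => absurd (Fin.lt_def.1 hlt) (not_lt.2 hu)
          simp only [z, this, if_false]
      refine ⟨_, hcl z hz _ (astg_patch hI ht hs (fun u hu => by simp only [z, hu, if_true])
        fun u => ?_), ?_⟩
      · have : ¬ ix u.1 < i := by rw [(hI i u).1 u.2]; exact lt_irrefl i
        simp only [z, this, if_false]
      · ext u
        exact patch_of_mem u.2
    · rintro _ ⟨x, hx, rfl⟩ _ ⟨x', hx', rfl⟩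
      have hp := hst x hx x' hx'
      have : Relation.ReflTransGen (N.controlledAstg (I i)
          {x | ∀ j, j < i → (fun v : I j => x v.1) ∈ (fun x (v : I j) => x v.1) '' A})
          (fun v => x v.1) (fun v => x' v.1) ∧ x' ∈ A := by
        induction hp with
        | refl => exact ⟨.refl, hx⟩
        | @tail p p' _ hs ih =>
          obtain ⟨h1, hp⟩ := ih (hcl' x hx _ ‹_›)
          have hp' := hcl p hp p' hs
          obtain ⟨v, e1, e2, e3⟩ := hs
          refine ⟨?_, hp'⟩
          by_cases hv : v ∈ I i
          · exact h1.tail (controlledAstg_of_astg (fun j _ => ⟨p, hp, rfl⟩) hv e1 e2 e3)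
          · convert h1 using 1
            ext u
            exact e3 _ fun h => hv (h ▸ u.2)
      exact this.1

end Factorization

end BooleanNetwork

/-! ### Tables of modules -/

/-- A labelling of the vertices by the numbers below `k` whose classes are the strong modules,
numbered in a topological order. Only the values at vertices matter. -/
structure IsModuleLabelling {n : ℕ} (N : BooleanNetwork (Fin n)) (idx : ℕ → ℕ) (k : ℕ) : Prop where
  lt : ∀ u : Fin n, idx u < k
  surj : ∀ i < k, ∃ u : Fin n, idx u = i
  eq_iff : ∀ u v : Fin n, idx u = idx v ↔
    Relation.ReflTransGen N.G.Adj u v ∧ Relation.ReflTransGen N.G.Adj v u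
  mono : ∀ u v : Fin n, N.G.Adj u v → idx u ≤ idx v

/-- The vertices with label `i`, in increasing order. -/
def moduleVerts (n : ℕ) (idx : ℕ → ℕ) (i : ℕ) : List (Fin n) :=
  (List.finRange n).filter fun u => idx u = i

open Classical in
/-- The labels, other than `i`, of the in-neighbours of the vertices with label `i`. -/
noncomputable def moduleParents {n : ℕ} (N : BooleanNetwork (Fin n)) (idx : ℕ → ℕ) (i : ℕ) :
    List ℕ :=
  (List.range n).filter fun p => p ≠ i ∧ ∃ u v : Fin n, N.G.Adj u v ∧ idx u = p ∧ idx v = i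

/-- The numbers that together describe how a module reads itself and its parents. -/
inductive Query : Type
  /-- the number of vertices -/
  | card : Query
  /-- the number of parents -/
  | arity : Query
  /-- the number of vertices of parent number `s` -/
  | width (s : ℕ) : Query
  /-- the number of in-neighbours of vertex number `a` -/
  | deg (a : ℕ) : Query
  /-- where in-neighbour number `b` of vertex number `a` lies: `0` for the module itself, `s + 1`
  for parent number `s` -/
  | slot (a b : ℕ) : Query
  /-- the position of in-neighbour number `b` of vertex number `a` in the module that contains it -/
  | place (a b : ℕ) : Query
  /-- entry number `t` of the truth table of vertex number `a` -/
  | table (a t : ℕ) : Query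

/-- Answers to all queries. -/
abbrev Profile := Query → ℕ

/-- The answers `π` describe the module with label `i`. -/
structure IsProfile {n : ℕ} (N : BooleanNetwork (Fin n)) (idx : ℕ → ℕ) (i : ℕ) (π : Profile) :
    Prop where
  card : π .card = (moduleVerts n idx i).length
  arity : π .arity = (moduleParents N idx i).length
  width : ∀ s p, (moduleParents N idx i)[s]? = some p →
    π (.width s) = (moduleVerts n idx p).length
  deg : ∀ a v, (moduleVerts n idx i)[a]? = some v → π (.deg a) = (N.inNbrs v).length
  inner : ∀ (a : ℕ) (v : Fin n) (b : ℕ) (u : Fin n), (moduleVerts n idx i)[a]? = some v →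
    (N.inNbrs v)[b]? = some u → idx u = i →
    π (.slot a b) = 0 ∧ (moduleVerts n idx i)[π (.place a b)]? = some u
  outer : ∀ (a : ℕ) (v : Fin n) (b : ℕ) (u : Fin n), (moduleVerts n idx i)[a]? = some v →
    (N.inNbrs v)[b]? = some u → idx u ≠ i →
    ∃ s, π (.slot a b) = s + 1 ∧ (moduleParents N idx i)[s]? = some (idx u) ∧
      (moduleVerts n idx (idx u))[π (.place a b)]? = some u
  table : ∀ a v t, (moduleVerts n idx i)[a]? = some v → t < 2 ^ (N.inNbrs v).length →
    π (.table a t) = (N.f v fun u => t.testBit ((N.inNbrs v).idxOf u.1)).toNat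

/-- The transitions of a module with profile `π` and `m` vertices, controlled by the sets `κs` of
states of its parents. In the witness `z`, entry `0` is the state of the module itself, and entry
`s + 1` that of parent number `s`. -/
def localStep (m : ℕ) (π : Profile) (κs : List StateList) (y y' : Fin m → Bool) : Prop :=
  ∃ z : ℕ → List Bool, z 0 = List.ofFn y ∧ (∀ s κ, κs[s]? = some κ → z (s + 1) ∈ κ) ∧
    ∃ a : Fin m, (∃ t < 2 ^ π (.deg a), (∀ b < π (.deg a),
        t.testBit b = (z (π (.slot a b))).getD (π (.place a b)) false) ∧
        π (.table a t) = (y' a).toNat) ∧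
      y' a ≠ y a ∧ ∀ b, b ≠ a → y' b = y b

/-- All lists of `w` bits. -/
noncomputable def boolLists (w : ℕ) : StateList :=
  (Finset.univ : Finset (Fin w → Bool)).toList.map List.ofFn

open Classical in
/-- The attractors of `localStep`, written out. -/
noncomputable def localAttractors (m : ℕ) (π : Profile) (κs : List StateList) : List StateList :=
  ((Finset.univ : Finset (Finset (Fin m → Bool))).filter
    fun S : Finset (Fin m → Bool) =>
      (S : Set (Fin m → Bool)) ∈ attractors (localStep m π κs)).toList.map
    fun S : Finset (Fin m → Bool) => S.toList.map List.ofFn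

/-- The rows of the table of a module with profile `π`: one for each choice of sets of states of
the parents. -/
noncomputable def tableRows (π : Profile) : List (List StateList × List StateList) :=
  (((List.range (π .arity)).map fun s => (boolLists (π (.width s))).sublists).sections).map
    fun κs => (κs, localAttractors (π .card) π κs)

/-- `b` is a correct block for the module with label `i`. -/
structure IsModuleBlock {n : ℕ} (N : BooleanNetwork (Fin n)) (idx : ℕ → ℕ) (i : ℕ) (b : Block n) :
    Prop where
  verts : b.verts = moduleVerts n idx i
  parents : b.parents = moduleParents N idx i
  rows : ∃ π, IsProfile N idx i π ∧ b.rows = tableRows π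

theorem mem_boolLists {w : ℕ} {l : List Bool} : l ∈ boolLists w ↔ l.length = w := by
  simp only [boolLists, List.mem_map, Finset.mem_toList, Finset.mem_univ, true_and]
  constructor
  · rintro ⟨y, rfl⟩
    simp
  · rintro rfl
    exact ⟨fun i => l[i], by simp⟩

section Verts

variable {n : ℕ} {idx : ℕ → ℕ}

theorem mem_moduleVerts {i : ℕ} {u : Fin n} : u ∈ moduleVerts n idx i ↔ idx u = i := by
  simp [moduleVerts]

theorem nodup_moduleVerts (i : ℕ) : (moduleVerts n idx i).Nodup :=
  (List.nodup_finRange n).filter _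

theorem nodup_moduleParents (N : BooleanNetwork (Fin n)) (i : ℕ) :
    (moduleParents N idx i).Nodup :=
  List.nodup_range.filter _

theorem BooleanNetwork.mem_inNbrs {N : BooleanNetwork (Fin n)} {u v : Fin n} :
    u ∈ N.inNbrs v ↔ N.G.Adj u v := by
  simp [BooleanNetwork.inNbrs]

end Verts

theorem List.getD_map_of_getElem? {α β : Type*} {l : List α} {p : ℕ} {u : α} (h : l[p]? = some u)
    (x : α → β) (d : β) : (l.map x).getD p d = x u := by
  simp [List.getD_eq_getElem?_getD, h]

/-- The truth table, read at the bits found by way of the profile, gives the local function. -/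
theorem IsProfile.exists_row_iff {n : ℕ} {N : BooleanNetwork (Fin n)} {idx : ℕ → ℕ} {i : ℕ}
    {π : Profile} (hπ : IsProfile N idx i π) {a : ℕ} {v : Fin n}
    (ha : (moduleVerts n idx i)[a]? = some v) (x : Fin n → Bool) {z : ℕ → List Bool}
    (hz0 : z 0 = (moduleVerts n idx i).map x)
    (hz : ∀ s p, (moduleParents N idx i)[s]? = some p → z (s + 1) = (moduleVerts n idx p).map x)
    (β : Bool) :
    (∃ t < 2 ^ π (.deg a), (∀ b < π (.deg a),
        t.testBit b = (z (π (.slot a b))).getD (π (.place a b)) false) ∧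
        π (.table a t) = β.toNat) ↔ N.f v (fun u => x u.1) = β := by
  have hd := hπ.deg a v ha
  have hbit (b : ℕ) (hb : b < (N.inNbrs v).length) :
      (z (π (.slot a b))).getD (π (.place a b)) false = x (N.inNbrs v)[b] := by
    have hu : (N.inNbrs v)[b]? = some (N.inNbrs v)[b] := by simp
    by_cases h : idx (N.inNbrs v)[b] = i
    · obtain ⟨h1, h2⟩ := hπ.inner a v b _ ha hu h
      rw [h1, hz0, List.getD_map_of_getElem? h2]
    · obtain ⟨s, h1, h2, h3⟩ := hπ.outer a v b _ ha hu h
      rw [h1, hz s _ h2, List.getD_map_of_getElem? h3]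
  have hval (t : ℕ) (ht : t < 2 ^ (N.inNbrs v).length)
      (hb : ∀ b (hb : b < (N.inNbrs v).length), t.testBit b = x (N.inNbrs v)[b]) :
      π (.table a t) = (N.f v fun u => x u.1).toNat := by
    rw [hπ.table a v t ha ht]
    congr 2
    ext u
    have hu : u.1 ∈ N.inNbrs v := BooleanNetwork.mem_inNbrs.2 u.2
    rw [hb _ (List.idxOf_lt_length_iff.2 hu), List.getElem_idxOf]
  rw [hd]
  constructor
  · rintro ⟨t, ht, hb, htab⟩
    rw [hval t ht fun b hb' => (hb b hb').trans (hbit b hb')] at htab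
    revert htab
    cases N.f v (fun u => x u.1) <;> cases β <;> simp
  · rintro rfl
    refine ⟨Nat.ofBits fun b : Fin (N.inNbrs v).length => x (N.inNbrs v)[b],
      Nat.ofBits_lt_two_pow _, fun b hb => ?_, hval _ (Nat.ofBits_lt_two_pow _) fun b hb => ?_⟩
    · rw [Nat.testBit_ofBits_lt _ _ hb, hbit b hb]
      rfl
    · rw [Nat.testBit_ofBits_lt _ _ hb]
      rfl

namespace Block

variable {n : ℕ} (b : Block n)

/-- A state of a module, written as a list of bits. -/
def bits (y : b.support → Bool) : List Bool := b.verts.attach.map fun v => y ⟨v.1, v.2⟩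

theorem mem_toSet {l : StateList} {y : b.support → Bool} : y ∈ b.toSet l ↔ b.bits y ∈ l := Iff.rfl

@[simp] theorem length_bits (y : b.support → Bool) : (b.bits y).length = b.verts.length := by
  simp [bits]

theorem bits_restrict (x : Fin n → Bool) : b.bits (fun v => x v.1) = b.verts.map x := by
  simp [bits]

variable {b}

/-- States of a module as functions of the position of a vertex in the list of vertices. -/
def statesEquiv (hb : b.verts.Nodup) :
    (b.support → Bool) ≃ (Fin b.verts.length → Bool) :=
  Equiv.arrowCongr (hb.getEquiv b.verts).symm (Equiv.refl Bool)

theorem statesEquiv_apply (hb : b.verts.Nodup) (y : b.support → Bool)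
    (a : Fin b.verts.length) : statesEquiv hb y a = y ⟨b.verts[a], List.getElem_mem _⟩ := rfl

theorem ofFn_statesEquiv (hb : b.verts.Nodup) (y : b.support → Bool) :
    List.ofFn (statesEquiv hb y) = b.bits y := by
  apply List.ext_getElem
  · simp
  · intro p h1 h2
    simp [bits, statesEquiv_apply]

theorem bits_injective (hb : b.verts.Nodup) : Function.Injective b.bits := fun y y' h => by
  rw [← ofFn_statesEquiv hb, ← ofFn_statesEquiv hb] at h
  exact (statesEquiv hb).injective (List.ofFn_injective h)

theorem exists_bits_eq (hb : b.verts.Nodup) {l : List Bool} (hl : l.length = b.verts.length) :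
    ∃ y, b.bits y = l := by
  refine ⟨(statesEquiv hb).symm fun a => l[a], ?_⟩
  rw [← ofFn_statesEquiv hb, Equiv.apply_symm_apply]
  apply List.ext_getElem <;> simp [hl]

theorem toSet_ofFn (hb : b.verts.Nodup) (S : Finset (Fin b.verts.length → Bool)) :
    b.toSet (S.toList.map List.ofFn) = statesEquiv hb ⁻¹' S := by
  ext y
  rw [mem_toSet, ← ofFn_statesEquiv hb]
  simp [List.ofFn_injective.eq_iff]

/-- The written-out attractors of a relation that corresponds to `r`. -/
theorem toSet_localAttractors (hb : b.verts.Nodup) {π : Profile} {κs : List StateList}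
    {r : (b.support → Bool) → (b.support → Bool) → Prop}
    (h : ∀ y y', r y y' ↔ localStep b.verts.length π κs (statesEquiv hb y) (statesEquiv hb y'))
    (s : Set (b.support → Bool)) :
    (∃ l ∈ localAttractors b.verts.length π κs, b.toSet l = s) ↔ s ∈ _root_.attractors r := by
  classical
  simp only [localAttractors, List.mem_map, Finset.mem_toList, Finset.mem_filter, Finset.mem_univ,
    true_and]
  constructor
  · rintro ⟨l, ⟨S, hS, rfl⟩, rfl⟩
    rw [toSet_ofFn hb]
    exact (preimage_mem_attractors_iff _ h _).2 hS
  · intro hs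
    have e : statesEquiv hb ⁻¹' (statesEquiv hb '' s) = s :=
      Set.preimage_image_eq _ (statesEquiv hb).injective
    refine ⟨_, ⟨(statesEquiv hb '' s).toFinset, ?_, rfl⟩, ?_⟩
    · rw [Set.coe_toFinset, ← preimage_mem_attractors_iff _ h, e]
      exact hs
    · rw [toSet_ofFn hb, Set.coe_toFinset, e]

end Block

/-! ### Correctness of the tables -/

section Represents

variable {n k : ℕ} {N : BooleanNetwork (Fin n)} {idx : ℕ → ℕ} {R : FactorizedRep n}

theorem IsModuleBlock.nodup {i : ℕ} {b : Block n} (h : IsModuleBlock N idx i b) : b.verts.Nodup :=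
  h.verts ▸ nodup_moduleVerts i

theorem IsModuleBlock.mem_support {i : ℕ} {b : Block n} (h : IsModuleBlock N idx i b) {u : Fin n} :
    u ∈ b.support ↔ idx u = i := by
  rw [Block.support, Set.mem_ofPred_eq, h.verts, mem_moduleVerts]

theorem IsModuleLabelling.lt_of_mem_parents (hL : IsModuleLabelling N idx k) {i p : ℕ}
    (hp : p ∈ moduleParents N idx i) : p < i := by
  simp only [moduleParents, List.mem_filter, decide_eq_true_eq] at hp
  obtain ⟨-, hne, u, v, huv, rfl, rfl⟩ := hp
  exact lt_of_le_of_ne (hL.mono u v huv) hne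

/-- With sets of states of the parents that match the labels of a row, the local transitions are
those of the controlled module. -/
theorem controlledAstg_iff_localStep (hL : IsModuleLabelling N idx k)
    (hR : ∀ i : Fin R.length, IsModuleBlock N idx i (R.get i)) {i : Fin R.length} {a : R.Choice}
    (ha : ∀ j, j < i → (a j).Nonempty) {π : Profile} (hπ : IsProfile N idx i π)
    {κs : List StateList}
    (hκ : List.Forall₂ (fun (p : ℕ) (κ : StateList) =>
      ∃ h : p < R.length, (R.get ⟨p, h⟩).toSet κ = a ⟨p, h⟩) (R.get i).parents κs)
    (hlen : ∀ (s : ℕ) (κ : StateList), κs[s]? = some κ → ∀ w ∈ κ, w.length = π (.width s))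
    (y y' : (R.get i).support → Bool) :
    N.controlledAstg (R.get i).support (R.context i a) y y' ↔
      localStep (R.get i).verts.length π κs (Block.statesEquiv (hR i).nodup y)
        (Block.statesEquiv (hR i).nodup y') := by
  classical
  rw [(hR i).parents] at hκ
  obtain ⟨hκl, hκ⟩ := List.forall₂_iff_get.1 hκ
  have hκ' (s p : ℕ) (κ : StateList) (hp : (moduleParents N idx i)[s]? = some p)
      (hs : κs[s]? = some κ) : ∃ h : p < R.length, (R.get ⟨p, h⟩).toSet κ = a ⟨p, h⟩ := by
    obtain ⟨h1, rfl⟩ := List.getElem?_eq_some_iff.1 hp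
    obtain ⟨h2, rfl⟩ := List.getElem?_eq_some_iff.1 hs
    exact hκ s h1 h2
  have hverts (c : Fin (R.get i).verts.length) :
      (moduleVerts n idx i)[(c : ℕ)]? = some (R.get i).verts[c] := by
    rw [← (hR i).verts]
    simp
  have hown (x : Fin n → Bool) : List.ofFn (Block.statesEquiv (hR i).nodup y) =
      (moduleVerts n idx i).map (BooleanNetwork.patch (R.get i).support x y) := by
    rw [← (hR i).verts, Block.ofFn_statesEquiv, ← Block.bits_restrict]
    congr 1
    ext u
    rw [BooleanNetwork.patch_of_mem u.2]
  have hother (x : Fin n → Bool) {p : ℕ} (hp : p ∈ moduleParents N idx i) :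
      (moduleVerts n idx p).map (BooleanNetwork.patch (R.get i).support x y) =
        (moduleVerts n idx p).map x := by
    refine List.map_congr_left fun u hu => BooleanNetwork.patch_of_notMem fun h => ?_
    rw [(hR i).mem_support] at h
    rw [mem_moduleVerts] at hu
    exact (hL.lt_of_mem_parents hp).ne (hu.symm.trans h)
  constructor
  · rintro ⟨x, hx, v, h1, h2, h3⟩
    rw [BooleanNetwork.control_f_eq] at h1
    obtain ⟨c, hc⟩ := ((hR i).nodup.getEquiv _).surjective v
    have hcv : (R.get i).verts[c] = v.1 := congrArg Subtype.val hc
    let z : ℕ → List Bool := fun s => match s with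
      | 0 => List.ofFn (Block.statesEquiv (hR i).nodup y)
      | s + 1 => (moduleVerts n idx ((moduleParents N idx i).getD s 0)).map x
    refine ⟨z, rfl, ?_, c, ?_, ?_, ?_⟩
    · intro s κ hs
      have h : s < (moduleParents N idx i).length :=
        hκl ▸ (List.getElem?_eq_some_iff.1 hs).1
      have hp : (moduleParents N idx i)[s]? = some (moduleParents N idx i)[s] := by simp [h]
      obtain ⟨hR', hset⟩ := hκ' s _ κ hp hs
      have := hx ⟨_, hR'⟩ (hL.lt_of_mem_parents (List.getElem_mem h))
      rw [← hset, Block.mem_toSet, Block.bits_restrict, (hR _).verts] at this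
      simpa [z, List.getD_eq_getElem?_getD, h] using this
    · refine (hπ.exists_row_iff (hverts c) (BooleanNetwork.patch (R.get i).support x y) (z := z)
        (hown x) (fun s p hp => ?_) _).2 ?_
      · rw [hother x (List.mem_of_getElem? hp)]
        simp [z, List.getD_eq_getElem?_getD, hp]
      · rw [Block.statesEquiv_apply]
        have e : (⟨(R.get i).verts[c], List.getElem_mem _⟩ : (R.get i).support) = v :=
          Subtype.ext hcv
        rw [e, ← h1]
        obtain ⟨v, hv⟩ := v
        subst hcv
        rfl
    · rw [Block.statesEquiv_apply, Block.statesEquiv_apply]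
      have e : (⟨(R.get i).verts[c], List.getElem_mem _⟩ : (R.get i).support) = v :=
        Subtype.ext hcv
      rwa [e]
    · intro c' hc'
      rw [Block.statesEquiv_apply, Block.statesEquiv_apply]
      refine h3 _ fun e => hc' (((hR i).nodup.getEquiv _).injective ?_)
      rw [hc, ← e]
      rfl
  · rintro ⟨z, hz0, hz, c, h1, h2, h3⟩
    -- states of the earlier modules, on the parents those given by `z`
    have hα (j : Fin R.length) (hj : j < i) : ∃ α ∈ a j, ∀ s : ℕ,
        (moduleParents N idx i)[s]? = some j.1 → (R.get j).bits α = z (s + 1) := by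
      by_cases hs : ∃ s : ℕ, (moduleParents N idx i)[s]? = some j.1
      · obtain ⟨s, hs⟩ := hs
        have hs' := (List.getElem?_eq_some_iff.1 hs).1
        have hκs : κs[s]? = some (κs[s]'(hκl ▸ hs')) := by simp
        obtain ⟨hR', hset⟩ := hκ' s _ _ hs hκs
        have hzs := hz s _ hκs
        obtain ⟨α, hα⟩ := Block.exists_bits_eq (b := R.get j) (hR j).nodup (l := z (s + 1)) (by
          rw [hlen s _ hκs _ hzs, hπ.width s _ hs, (hR j).verts])
        refine ⟨α, ?_, fun s' hs2 => ?_⟩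
        · rw [← hset, Block.mem_toSet]
          exact hα.symm ▸ hzs
        · have := (nodup_moduleParents (idx := idx) N i).getElem_inj_iff
            (hi := (List.getElem?_eq_some_iff.1 hs2).1) (hj := hs')
          have e : s' = s := this.1 (by
            rw [(List.getElem?_eq_some_iff.1 hs2).2, (List.getElem?_eq_some_iff.1 hs).2])
          rw [e, hα]
      · obtain ⟨α, hα⟩ := ha j hj
        exact ⟨α, hα, fun s hs' => absurd ⟨s, hs'⟩ hs⟩
    choose α hα hαz using hα
    let x : Fin n → Bool := fun u =>
      if h : idx u < i then α ⟨idx u, h.trans i.2⟩ h ⟨u, (hR _).mem_support.2 rfl⟩ else false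
    have hxα (j : Fin R.length) (hj : j < i) : (fun v : (R.get j).support => x v.1) = α j hj := by
      ext ⟨u, hu⟩
      obtain ⟨j, hj'⟩ := j
      obtain rfl := (hR _).mem_support.1 hu
      have : idx u < i := hj
      simp only [x, this, dif_pos]
    refine ⟨x, fun j hj => hxα j hj ▸ hα j hj, ⟨(R.get i).verts[c], List.getElem_mem _⟩, ?_, h2,
      fun u hu => ?_⟩
    · rw [BooleanNetwork.control_f_eq]
      refine (hπ.exists_row_iff (hverts c) (BooleanNetwork.patch (R.get i).support x y)
        (hz0.trans (hown x)) (fun s p hp => ?_) _).1 h1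
      have hpm := List.mem_of_getElem? hp
      have hpi := hL.lt_of_mem_parents hpm
      rw [hother x hpm]
      have := hαz ⟨p, hpi.trans i.2⟩ hpi s hp
      rw [← this, ← hxα ⟨p, hpi.trans i.2⟩ hpi, Block.bits_restrict, (hR _).verts]
    · obtain ⟨c', rfl⟩ := ((hR i).nodup.getEquiv _).surjective u
      exact h3 c' fun e => hu (by rw [e]; rfl)

theorem mem_sections_width {π : Profile} {κs : List StateList}
    (h : κs ∈ ((List.range (π .arity)).map fun s => (boolLists (π (.width s))).sublists).sections)
    (s : ℕ) (κ : StateList) (hs : κs[s]? = some κ) (w : List Bool) (hw : w ∈ κ) :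
    w.length = π (.width s) := by
  rw [List.mem_sections, List.forall₂_iff_get] at h
  obtain ⟨hs', rfl⟩ := List.getElem?_eq_some_iff.1 hs
  have := h.2 s hs' (h.1 ▸ hs')
  simp only [List.get_eq_getElem, List.getElem_map, List.getElem_range, List.mem_sublists] at this
  exact mem_boolLists.1 (this.subset hw)

theorem lookup_nonempty (hR : ∀ i : Fin R.length, IsModuleBlock N idx i (R.get i))
    {i : Fin R.length} {a : R.Choice} {s : Set ((R.get i).support → Bool)}
    (hs : s ∈ R.lookup i a) : s.Nonempty := by
  classical
  obtain ⟨row, hrow, -, l, hl, rfl⟩ := hs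
  obtain ⟨π, hπ, hrows⟩ := (hR i).rows
  rw [hrows, tableRows] at hrow
  obtain ⟨κs, -, rfl⟩ := List.mem_map.1 hrow
  dsimp only at hl
  rw [hπ.card, ← (hR i).verts] at hl
  simp only [localAttractors, List.mem_map, Finset.mem_toList, Finset.mem_filter] at hl
  obtain ⟨S, ⟨-, hS⟩, rfl⟩ := hl
  rw [Block.toSet_ofFn (hR i).nodup]
  exact (mem_attractors_iff.1 hS).1.preimage (Block.statesEquiv _).surjective

/-- The table of a module lists the attractors of the controlled module. -/
theorem lookup_eq_attractors (hL : IsModuleLabelling N idx k)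
    (hR : ∀ i : Fin R.length, IsModuleBlock N idx i (R.get i)) {i : Fin R.length} {a : R.Choice}
    (ha : ∀ j, j < i → (a j).Nonempty) :
    R.lookup i a = attractors (N.controlledAstg (R.get i).support (R.context i a)) := by
  classical
  obtain ⟨π, hπ, hrows⟩ := (hR i).rows
  have hcard : π .card = (R.get i).verts.length := by rw [hπ.card, (hR i).verts]
  ext s
  simp only [FactorizedRep.lookup, hrows, tableRows, Set.mem_ofPred_eq, List.mem_map, hcard]
  constructor
  · rintro ⟨_, ⟨κs, hκs, rfl⟩, hmatch, hl⟩
    exact (Block.toSet_localAttractors (hR i).nodup (controlledAstg_iff_localStep hL hR ha hπ hmatch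
      (mem_sections_width hκs)) s).1 hl
  · intro hs
    let C (p : ℕ) : Set (List Bool) :=
      {l | ∃ h : p < R.length, ∃ y ∈ a ⟨p, h⟩, (R.get ⟨p, h⟩).bits y = l}
    let κ (s : ℕ) : StateList :=
      (boolLists (π (.width s))).filter fun l => l ∈ C ((moduleParents N idx i).getD s 0)
    have hκs : (List.range (π .arity)).map κ ∈
        ((List.range (π .arity)).map fun s => (boolLists (π (.width s))).sublists).sections := by
      rw [List.mem_sections, List.forall₂_map_left_iff, List.forall₂_map_right_iff,
        List.forall₂_same]
      exact fun s _ => List.mem_sublists.2 List.filter_sublist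
    have hmatch : List.Forall₂ (fun (p : ℕ) (κ : StateList) =>
        ∃ h : p < R.length, (R.get ⟨p, h⟩).toSet κ = a ⟨p, h⟩) (R.get i).parents
          ((List.range (π .arity)).map κ) := by
      rw [(hR i).parents, List.forall₂_iff_get]
      refine ⟨by simp [hπ.arity], fun s h1 h2 => ?_⟩
      have hp := hL.lt_of_mem_parents (List.getElem_mem h1)
      have hpR := hp.trans i.2
      have e : ((List.range (π .arity)).map κ).get ⟨s, h2⟩ = κ s := by simp
      rw [e]
      change ∃ h : (moduleParents N idx i)[s] < R.length,
        (R.get ⟨(moduleParents N idx i)[s], h⟩).toSet (κ s) = a ⟨(moduleParents N idx i)[s], h⟩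
      refine ⟨hpR, ?_⟩
      ext y
      have hw := hπ.width s _ (List.getElem?_eq_getElem h1)
      have hlen : ((R.get ⟨_, hpR⟩).bits y).length = π (.width s) := by
        rw [hw, Block.length_bits, (hR _).verts]
      have hC : (moduleParents N idx i).getD s 0 = (moduleParents N idx i)[s] := by
        simp [List.getD_eq_getElem?_getD, h1]
      have hmem (l : List Bool) :
          l ∈ κ s ↔ l.length = π (.width s) ∧ l ∈ C (moduleParents N idx i)[s] := by
        simp only [κ, List.mem_filter, mem_boolLists, hC, decide_eq_true_eq]
      rw [Block.mem_toSet, hmem]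
      constructor
      · rintro ⟨-, _, y', hy', h⟩
        rwa [← Block.bits_injective (hR _).nodup h]
      · exact fun hy => ⟨hlen, hpR, y, hy, rfl⟩
    exact ⟨_, ⟨_, hκs, rfl⟩, hmatch, (Block.toSet_localAttractors (hR i).nodup
      (controlledAstg_iff_localStep hL hR ha hπ hmatch (mem_sections_width hκs)) s).2 hs⟩

/-- Correct blocks for all modules form a factorized representation. -/
theorem IsModuleLabelling.represents (hL : IsModuleLabelling N idx k) (hk : R.length = k)
    (hR : ∀ i : Fin R.length, IsModuleBlock N idx i (R.get i)) : R.Represents N := by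
  have hI (i : Fin R.length) (v : Fin n) :
      v ∈ (R.get i).support ↔ (⟨idx v, hk ▸ hL.lt v⟩ : Fin R.length) = i := by
    rw [(hR i).mem_support, Fin.ext_iff]
  have ht (u v : Fin n) (huv : N.G.Adj u v) :
      (⟨idx u, hk ▸ hL.lt u⟩ : Fin R.length) ≤ ⟨idx v, hk ▸ hL.lt v⟩ := hL.mono u v huv
  have hmod (a : R.Choice) (i : Fin R.length) (ha : ∀ j, j < i → a j ∈ R.lookup j a) :
      R.lookup i a = attractors (N.controlledAstg (R.get i).support (R.context i a)) :=
    lookup_eq_attractors hL hR fun j hj => lookup_nonempty hR (ha j hj)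
  refine ⟨fun i => (hR i).nodup, fun C => ⟨?_, ?_⟩, fun i j hij => ?_, ?_, fun i p hp => ?_, ?_,
    hmod, ?_, ?_, ?_⟩
  · rintro ⟨v, rfl⟩
    refine ⟨⟨idx v, hk ▸ hL.lt v⟩, ?_⟩
    ext u
    rw [(hR _).mem_support]
    exact (hL.eq_iff u v).trans and_comm
  · rintro ⟨i, rfl⟩
    obtain ⟨v, hv⟩ := hL.surj i (hk ▸ i.2)
    refine ⟨v, ?_⟩
    ext u
    rw [(hR _).mem_support, ← hv]
    exact (hL.eq_iff u v).trans and_comm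
  · obtain ⟨v, hv⟩ := hL.surj i (hk ▸ i.2)
    have : v ∈ (R.get j).support := by
      have : v ∈ (R.get i).support := (hR i).mem_support.2 hv
      dsimp only at hij
      rwa [hij] at this
    exact Fin.ext (hv.symm.trans ((hR j).mem_support.1 this))
  · intro i j u hu v hv huv
    have := hL.mono u v huv
    rw [(hR i).mem_support.1 hu, (hR j).mem_support.1 hv] at this
    exact this
  · rw [(hR i).parents] at hp
    exact hL.lt_of_mem_parents hp
  · intro i row hrow l hl w hw
    obtain ⟨π, hπ, hrows⟩ := (hR i).rows
    rw [hrows, tableRows] at hrow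
    obtain ⟨κs, -, rfl⟩ := List.mem_map.1 hrow
    dsimp only at hl
    rw [hπ.card, ← (hR i).verts] at hl
    simp only [localAttractors, List.mem_map] at hl
    obtain ⟨S, -, rfl⟩ := hl
    obtain ⟨y, -, rfl⟩ := List.mem_map.1 hw
    simp
  · intro a ha
    refine BooleanNetwork.product_mem_attractors hI ht a fun i => ?_
    have := ha i
    rw [hmod a i fun j _ => ha j] at this
    exact this
  · intro a ha a' ha' haa'
    have proj (a : R.Choice) (ha : R.Admissible a) (i : Fin R.length) :
        (fun x (v : (R.get i).support) => x v.1) '' R.product a = a i := by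
      choose y hy using fun j => lookup_nonempty hR (ha j)
      ext z
      constructor
      · rintro ⟨x, hx, rfl⟩
        exact hx i
      · intro hz
        classical
        have hup : ∀ j, Function.update y i z j ∈ a j := fun j => by
          by_cases hj : j = i
          · subst hj
            simpa using hz
          · simpa [hj] using hy j
        have hpt (j : Fin R.length) (v : Fin n) (hv : v ∈ (R.get j).support) :
            Function.update y i z ⟨idx v, hk ▸ hL.lt v⟩ ⟨v, (hI _ _).2 rfl⟩ =
              Function.update y i z j ⟨v, hv⟩ := by
          obtain rfl := (hI j v).1 hv
          rfl
        refine ⟨fun v => Function.update y i z ⟨idx v, hk ▸ hL.lt v⟩ ⟨v, (hI _ _).2 rfl⟩,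
          fun j => ?_, ?_⟩
        · convert hup j using 1
          ext v
          exact hpt j v.1 v.2
        · ext v
          exact (hpt i v.1 v.2).trans (by simp)
    ext1 i
    rw [← proj a ha i, ← proj a' ha' i, haa']
  · intro A hA
    obtain ⟨h1, h2⟩ := BooleanNetwork.attractor_eq_product hI ht hA
    let a : R.Choice := fun i => (fun x (v : (R.get i).support) => x v.1) '' A
    refine ⟨a, fun i => ?_, h1⟩
    induction i using WellFoundedLT.induction with
    | ind i ih =>
      rw [hmod _ i ih]
      exact h2 i

end Represents

/-! ### Conditions, counting and tabulation in for-programs -/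

namespace NumExpr

variable {s : MachineState}

/-- An expression, read as a condition, holds when its value is not zero. -/
def Holds (s : MachineState) (e : NumExpr) : Prop := e.eval s ≠ 0

/-- The condition `e < e'`. -/
def lt (e e' : NumExpr) : NumExpr := sub e' e

/-- The condition `e = e'`. -/
def eq (e e' : NumExpr) : NumExpr := sub (num 1) (add (sub e e') (sub e' e))

/-- Conjunction. -/
def and (e e' : NumExpr) : NumExpr := sub (num 1) (add (sub (num 1) e) (sub (num 1) e'))

/-- The sum of `f b` over `b < d`; as a condition, the disjunction. -/
def sum (f : ℕ → NumExpr) : ℕ → NumExpr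
  | 0 => num 0
  | d + 1 => add (sum f d) (f d)

@[simp] theorem eval_var (x : ℕ) : (var x).eval s = s.reg x := rfl
@[simp] theorem eval_num (k : ℕ) : (num k).eval s = k := rfl
@[simp] theorem eval_get (A : ℕ) (e : NumExpr) : (get A e).eval s = s.arr A (e.eval s) := rfl
@[simp] theorem eval_add (e e' : NumExpr) :
    (add e e').eval s = e.eval s + e'.eval s := rfl
@[simp] theorem eval_sub (e e' : NumExpr) :
    (sub e e').eval s = e.eval s - e'.eval s := rfl

@[simp] theorem holds_get (A : ℕ) (e : NumExpr) :
    (get A e).Holds s ↔ s.arr A (e.eval s) ≠ 0 := Iff.rfl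

@[simp] theorem holds_lt {e e' : NumExpr} : (lt e e').Holds s ↔ e.eval s < e'.eval s := by
  simp only [Holds, lt, eval_sub]
  omega

@[simp] theorem holds_eq {e e' : NumExpr} : (eq e e').Holds s ↔ e.eval s = e'.eval s := by
  simp only [Holds, eq, eval_sub, eval_add, eval_num]
  omega

@[simp] theorem holds_and {e e' : NumExpr} : (and e e').Holds s ↔ e.Holds s ∧ e'.Holds s := by
  simp only [Holds, and, eval_sub, eval_add, eval_num]
  omega

@[simp] theorem holds_add {e e' : NumExpr} : (add e e').Holds s ↔ e.Holds s ∨ e'.Holds s := by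
  simp only [Holds, eval_add]
  omega

@[simp] theorem holds_not {e : NumExpr} : (sub (num 1) e).Holds s ↔ ¬ e.Holds s := by
  simp only [Holds, eval_sub, eval_num]
  omega

@[simp] theorem holds_sum {f : ℕ → NumExpr} {d : ℕ} :
    (sum f d).Holds s ↔ ∃ b < d, (f b).Holds s := by
  induction d with
  | zero => simp [sum, Holds]
  | succ d ih => simp only [sum, holds_add, ih, Nat.lt_succ_iff_lt_or_eq, or_and_right, exists_or,
      exists_eq_left]

end NumExpr

theorem List.length_filter_range (p : ℕ → Prop) [DecidablePred p] (n : ℕ) :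
    ((List.range n).filter p).length = Nat.count p n := by
  induction n with
  | zero => simp
  | succ n ih =>
    rw [List.range_succ, List.filter_append, List.length_append, ih, Nat.count_succ]
    by_cases h : p n <;> simp [h]

theorem List.getElem?_filter_range {p : ℕ → Prop} [DecidablePred p] {n u : ℕ} (hu : u < n)
    (hp : p u) : ((List.range n).filter p)[Nat.count p u]? = some u := by
  induction n with
  | zero => omega
  | succ n ih =>
    rw [List.range_succ, List.filter_append]
    rcases Nat.lt_succ_iff_lt_or_eq.1 hu with h | rfl
    · rw [List.getElem?_append_left (by
        rw [List.length_filter_range]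
        exact Nat.count_strict_mono hp h), ih h]
    · rw [List.getElem?_append_right (by rw [List.length_filter_range]), List.length_filter_range]
      simp [hp]

namespace ForProgram

open NumExpr

variable {n : ℕ}

theorem run_ite_of_holds {e : NumExpr} {P Q : ForProgram} {s : MachineState} (h : e.Holds s) :
    (ite e P Q).run n s = P.run n s := if_pos h

theorem run_ite_of_not_holds {e : NumExpr} {P Q : ForProgram} {s : MachineState}
    (h : ¬ e.Holds s) : (ite e P Q).run n s = Q.run n s := if_neg h

/-- Put the number of values of the variable `1` that satisfy `e` into the variable `2`. -/
def count (e : NumExpr) : ForProgram :=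
  seq (assign 2 (num 0)) (loop 1 (ite e (assign 2 (add (var 2) (num 1))) skip))

theorem reg_run_count {e : NumExpr} {s : MachineState} (p : ℕ → Prop) [DecidablePred p]
    (h : ∀ s' : MachineState, s'.arr = s.arr → (∀ x, x ≠ 1 → x ≠ 2 → s'.reg x = s.reg x) →
      ∀ j < n, s'.reg 1 = j → (e.Holds s' ↔ p j)) :
    ((count e).run n s).reg 2 = Nat.count p n := by
  have := run_loop_induction (n := n) (x := 1)
    (P := ite e (assign 2 (add (var 2) (num 1))) skip) (s := s.setReg 2 0)
    (fun j s' => s'.arr = s.arr ∧ (∀ x, x ≠ 1 → x ≠ 2 → s'.reg x = s.reg x) ∧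
      s'.reg 2 = Nat.count p j)
    ⟨rfl, fun x _ h2 => by simp [Function.update, h2], by simp⟩ (by
      rintro j hj s' ⟨h1, h2, h3⟩
      have hs := h (s'.setReg 1 j) h1
        (fun x hx hx' => by simp [Function.update, hx, h2 x hx hx']) j hj (by simp)
      by_cases hp : p j
      · rw [run_ite_of_holds (hs.2 hp)]
        refine ⟨h1, fun x hx hx' => by simp [Function.update, hx, hx', h2 x hx hx'], ?_⟩
        simp [Nat.count_succ, hp, h3]
      · rw [run_ite_of_not_holds fun e => hp (hs.1 e)]
        refine ⟨h1, fun x hx hx' => by simp [Function.update, hx, h2 x hx hx'], ?_⟩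
        simp [Nat.count_succ, hp, h3])
  exact this.2.2

/-- Put into the array `A`, at every value of the variable `0`, the number of values of the
variable `1` that satisfy `e`. -/
def tabulate (A : ℕ) (e : NumExpr) : ForProgram :=
  loop 0 (seq (count e) (put A (var 0) (var 2)))

theorem arr_run_tabulate {A : ℕ} {e : NumExpr} {s : MachineState} (p : ℕ → ℕ → Prop)
    [∀ i, DecidablePred (p i)]
    (h : ∀ s' : MachineState, (∀ B, B ≠ A → s'.arr B = s.arr B) →
      (∀ x, x ≠ 0 → x ≠ 1 → x ≠ 2 → s'.reg x = s.reg x) →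
      ∀ i < n, ∀ j < n, s'.reg 0 = i → s'.reg 1 = j → (e.Holds s' ↔ p i j))
    {i : ℕ} (hi : i < n) : ((tabulate A e).run n s).arr A i = Nat.count (p i) n := by
  have := run_loop_induction (n := n) (x := 0) (P := seq (count e) (put A (var 0) (var 2))) (s := s)
    (fun j s' => (∀ B, B ≠ A → s'.arr B = s.arr B) ∧
      (∀ x, x ≠ 0 → x ≠ 1 → x ≠ 2 → s'.reg x = s.reg x) ∧
      ∀ i < j, s'.arr A i = Nat.count (p i) n)
    ⟨fun _ _ => rfl, fun _ _ _ _ => rfl, by simp⟩ (by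
      rintro j hj s' ⟨h1, h2, h3⟩
      have ha (B : ℕ) : ((count e).run n (s'.setReg 0 j)).arr B = s'.arr B :=
        KeepsArr.run_eq (by simp [count, KeepsArr]) _
      have hr (x : ℕ) (hx1 : x ≠ 1) (hx2 : x ≠ 2) :
          ((count e).run n (s'.setReg 0 j)).reg x = (s'.setReg 0 j).reg x :=
        KeepsVar.run_eq (by simp [count, KeepsVar, hx1, hx2]) _
      have hc := reg_run_count (n := n) (e := e) (s := s'.setReg 0 j) (p j)
        fun s'' h1' h2' k hk hk' => h s'' (fun B hB => by rw [h1']; exact h1 B hB)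
          (fun x hx0 hx1 hx2 => by
            rw [h2' x hx1 hx2, ← h2 x hx0 hx1 hx2]; simp [Function.update, hx0])
          j hj k hk (by rw [h2' 0 (by simp) (by simp)]; simp) hk'
      refine ⟨fun B hB => ?_, fun x h0 h1 h2' => ?_, fun i hi => ?_⟩
      · simp [Function.update, hB, ha, h1 B hB]
      · rw [run_seq, run_put, MachineState.setArr_reg, hr x h1 h2', MachineState.setReg_reg,
          Function.update_of_ne h0, h2 x h0 h1 h2']
      · rw [run_seq, run_put, MachineState.setArr_arr, Function.update_self, eval_var, eval_var, hc,
          hr 0 (by simp) (by simp), ha, MachineState.setReg_reg, Function.update_self]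
        by_cases hij : i = j
        · simp [hij]
        · rw [Function.update_of_ne hij]
          exact h3 i (by omega))
  exact this.2.2 i hi

/-- Put the values of the variable `0` that satisfy `e` into the array `A`, each at the
position `r`. -/
def scatter (A : ℕ) (e r : NumExpr) : ForProgram :=
  loop 0 (ite e (put A r (var 0)) skip)

/-- When `r` is the rank, `scatter` lists the values in increasing order. -/
theorem arr_run_scatter {A : ℕ} {e r : NumExpr} {s : MachineState} (p : ℕ → Prop) [DecidablePred p]
    (h : ∀ s' : MachineState, (∀ B, B ≠ A → s'.arr B = s.arr B) →
      (∀ x, x ≠ 0 → s'.reg x = s.reg x) → ∀ j < n, s'.reg 0 = j →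
      (e.Holds s' ↔ p j) ∧ (p j → r.eval s' = Nat.count p j))
    {a u : ℕ} (ha : ((List.range n).filter p)[a]? = some u) :
    ((scatter A e r).run n s).arr A a = u := by
  have := run_loop_induction (n := n) (x := 0) (P := ite e (put A r (var 0)) skip) (s := s)
    (fun j s' => (∀ B, B ≠ A → s'.arr B = s.arr B) ∧ (∀ x, x ≠ 0 → s'.reg x = s.reg x) ∧
      ∀ a u, ((List.range j).filter p)[a]? = some u → s'.arr A a = u)
    ⟨fun _ _ => rfl, fun _ _ => rfl, by simp⟩ (by
      rintro j hj s' ⟨h1, h2, h3⟩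
      obtain ⟨hs, hv⟩ := h (s'.setReg 0 j) h1 (fun x hx => by simp [Function.update, hx, h2 x hx])
        j hj (by simp)
      by_cases hp : p j
      · rw [run_ite_of_holds (hs.2 hp), run_put, hv hp]
        refine ⟨fun B hB => by simp [Function.update, hB, h1 B hB],
          fun x hx => by simp [Function.update, hx, h2 x hx], fun a u hau => ?_⟩
        rw [List.range_succ, List.filter_append] at hau
        simp only [MachineState.setArr_arr, Function.update_self, eval_var, MachineState.setReg_reg,
          MachineState.setReg_arr]
        rcases lt_trichotomy a (Nat.count p j) with hlt | rfl | hgt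
        · rw [List.getElem?_append_left (by rwa [List.length_filter_range])] at hau
          rw [Function.update_of_ne hlt.ne]
          exact h3 a u hau
        · rw [List.getElem?_append_right (by rw [List.length_filter_range]),
            List.length_filter_range] at hau
          simpa [hp] using hau
        · have := (List.getElem?_eq_some_iff.1 hau).1
          rw [List.length_append, List.length_filter_range] at this
          simp [hp] at this
          omega
      · rw [run_ite_of_not_holds fun e => hp (hs.1 e)]
        refine ⟨h1, fun x hx => by simp [Function.update, hx, h2 x hx], fun a u hau => h3 a u ?_⟩
        rw [List.range_succ, List.filter_append] at hau
        simpa [hp] using hau)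
  exact this.2.2 a u ha

/-- Print the values of the variable `0` that satisfy `e`. -/
def printFilter (e : NumExpr) : ForProgram := loop 0 (ite e (print (var 0)) skip)

theorem out_run_printFilter {e : NumExpr} {s : MachineState} (p : ℕ → Prop) [DecidablePred p]
    (h : ∀ s' : MachineState, s'.arr = s.arr → (∀ x, x ≠ 0 → s'.reg x = s.reg x) →
      ∀ j < n, s'.reg 0 = j → (e.Holds s' ↔ p j)) :
    ((printFilter e).run n s).out = s.out ++ (List.range n).filter p := by
  have := run_loop_induction (n := n) (x := 0) (P := ite e (print (var 0)) skip) (s := s)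
    (fun j s' => s'.arr = s.arr ∧ (∀ x, x ≠ 0 → s'.reg x = s.reg x) ∧
      s'.out = s.out ++ (List.range j).filter p)
    ⟨rfl, fun _ _ => rfl, by simp⟩ (by
      rintro j hj s' ⟨h1, h2, h3⟩
      have hs := h (s'.setReg 0 j) h1 (fun x hx => by simp [Function.update, hx, h2 x hx])
        j hj (by simp)
      rw [List.range_succ, List.filter_append]
      by_cases hp : p j
      · rw [run_ite_of_holds (hs.2 hp)]
        exact ⟨h1, fun x hx => by simp [Function.update, hx, h2 x hx], by simp [h3, hp]⟩
      · rw [run_ite_of_not_holds fun e => hp (hs.1 e)]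
        exact ⟨h1, fun x hx => by simp [Function.update, hx, h2 x hx], by simp [h3, hp]⟩)
  exact this.2.2

/-- Print a fixed list. -/
def printList : List ℕ → ForProgram
  | [] => skip
  | k :: l => seq (print (num k)) (printList l)

theorem run_printList (l : List ℕ) (s : MachineState) :
    ((printList l).run n s) = { s with out := s.out ++ l } := by
  induction l generalizing s with
  | nil => simp [printList]
  | cons k l ih => simp [printList, ih, MachineState.emit]

/-- Branch according to the value of `e`, if it is at most `K`; larger values count as `0`. -/
def caseOn (e : NumExpr) (f : ℕ → ForProgram) : ℕ → ForProgram
  | 0 => f 0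
  | K + 1 => ite (eq e (num (K + 1))) (f (K + 1)) (caseOn e f K)

theorem run_caseOn (e : NumExpr) (f : ℕ → ForProgram) (K : ℕ) (s : MachineState) :
    (caseOn e f K).run n s = (f (if e.eval s ≤ K then e.eval s else 0)).run n s := by
  induction K with
  | zero =>
    rw [caseOn]
    split_ifs with h
    · rw [Nat.le_zero.1 h]
    · rfl
  | succ K ih =>
    by_cases h : e.eval s = K + 1
    · rw [caseOn, run_ite_of_holds (by simpa using h)]
      simp [h]
    · rw [caseOn, run_ite_of_not_holds (by simpa using h), ih]
      congr 2
      have : e.eval s ≤ K ↔ e.eval s ≤ K + 1 := by omega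
      simp only [this]

open Classical in
/-- A decision tree: branch according to the values of the expressions `e j` for `j ∈ l`. -/
noncomputable def dispatch {ι : Type*} (K : ℕ) (e : ι → NumExpr) :
    List ι → ((ι → ℕ) → ForProgram) → ForProgram
  | [], leaf => leaf fun _ => 0
  | j :: l, leaf => caseOn (e j) (fun x => dispatch K e l fun g => leaf (Function.update g j x)) K

open Classical in
theorem run_dispatch {ι : Type*} (K : ℕ) (e : ι → NumExpr) (l : List ι)
    (leaf : (ι → ℕ) → ForProgram) (s : MachineState) :
    (dispatch K e l leaf).run n s = (leaf fun j =>
      if j ∈ l ∧ (e j).eval s ≤ K then (e j).eval s else 0).run n s := by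
  induction l generalizing leaf with
  | nil => simp [dispatch]
  | cons j l ih =>
    rw [dispatch, run_caseOn, ih]
    congr 2
    ext j'
    by_cases h : j' = j
    · subst h
      simp
    · simp [h]

theorem depth_printList (l : List ℕ) : (printList l).depth = 0 := by
  induction l with
  | nil => rfl
  | cons k l ih => simp [printList, depth, ih]

theorem depth_caseOn {e : NumExpr} {f : ℕ → ForProgram} {K : ℕ} (hf : ∀ x, (f x).depth = 0) :
    (caseOn e f K).depth = 0 := by
  induction K with
  | zero => exact hf 0
  | succ K ih => simp [caseOn, depth, ih, hf]

theorem depth_dispatch {ι : Type*} {K : ℕ} {e : ι → NumExpr} {l : List ι}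
    {leaf : (ι → ℕ) → ForProgram} (hf : ∀ g, (leaf g).depth = 0) :
    (dispatch K e l leaf).depth = 0 := by
  induction l generalizing leaf with
  | nil => exact hf _
  | cons j l ih => exact depth_caseOn fun x => ih fun g => hf _

/-- Execute `f 0, …, f (d - 1)`. -/
def unroll (f : ℕ → ForProgram) : ℕ → ForProgram
  | 0 => skip
  | d + 1 => seq (unroll f d) (f d)

end ForProgram

/-! ### Reading the input -/

section Implementation

open NumExpr ForProgram

/-- The arrays `0` and `1` hold the input and the positions where the records of the vertices
begin. -/
structure HasNetwork {n : ℕ} (N : BooleanNetwork (Fin n)) (s : MachineState) : Prop where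
  deg : ∀ v : Fin n, s.arr 0 (s.arr 1 v) = (N.inNbrs v).length
  nbr : ∀ (v : Fin n) (b : ℕ) (u : Fin n), (N.inNbrs v)[b]? = some u →
    s.arr 0 (s.arr 1 v + (b + 1)) = u
  table : ∀ (v : Fin n) (t : ℕ), t < 2 ^ (N.inNbrs v).length →
    s.arr 0 (s.arr 1 v + ((N.inNbrs v).length + (t + 1))) =
      (N.f v fun u => t.testBit ((N.inNbrs v).idxOf u.1)).toNat

theorem HasNetwork.congr {n : ℕ} {N : BooleanNetwork (Fin n)} {s s' : MachineState}
    (h : HasNetwork N s) (h0 : s'.arr 0 = s.arr 0) (h1 : s'.arr 1 = s.arr 1) : HasNetwork N s' := by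
  obtain ⟨a, b, c⟩ := h
  exact ⟨by rwa [h0, h1], by rwa [h0, h1], by rwa [h0, h1]⟩

/-- The in-degree of the vertex `v`. -/
def degreeExpr (v : NumExpr) : NumExpr := get 0 (get 1 v)

/-- In-neighbour number `b` of the vertex `v`. -/
def nbrExpr (v : NumExpr) (b : ℕ) : NumExpr := get 0 (add (get 1 v) (num (b + 1)))

/-- Entry number `t` of the truth table of the vertex `v`. -/
def tableExpr (v : NumExpr) (t : ℕ) : NumExpr :=
  get 0 (add (get 1 v) (add (degreeExpr v) (num (t + 1))))

/-- Fill the array `1`. The variable `8` holds the position of the current record, and the variable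
`9` becomes the length of its truth table, a power of two. -/
def locateRecords (d : ℕ) : ForProgram :=
  seq (assign 8 (num 1)) (loop 3 (seq (put 1 (var 3) (var 8)) (seq (assign 9 (num 1))
    (seq (unroll (fun j => ite (lt (num j) (get 0 (var 8)))
          (assign 9 (add (var 9) (var 9))) skip) d)
      (assign 8 (add (var 8) (add (get 0 (var 8)) (add (num 1) (var 9)))))))))

/-- The position of the record of vertex number `j` in the encoding of a network. -/
noncomputable def BooleanNetwork.recordPos {n : ℕ} (N : BooleanNetwork (Fin n)) (j : ℕ) : ℕ :=
  1 + (((List.finRange n).take j).flatMap fun v =>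
    encodeList (fun u : Fin n => [u.1]) (N.inNbrs v) ++ N.truthTable v).length

theorem BooleanNetwork.recordPos_succ {n : ℕ} (N : BooleanNetwork (Fin n)) (v : Fin n) :
    N.recordPos (v + 1) =
      N.recordPos v + ((N.inNbrs v).length + (1 + 2 ^ (N.inNbrs v).length)) := by
  have h : (v : ℕ) < (List.finRange n).length := by simp
  rw [recordPos, recordPos, List.take_add_one, List.getElem?_eq_getElem h]
  simp [encodeList, truthTable]
  omega

theorem BooleanNetwork.getD_encode {n : ℕ} (N : BooleanNetwork (Fin n)) (v : Fin n) {p : ℕ}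
    (hp : p < (N.inNbrs v).length + (1 + 2 ^ (N.inNbrs v).length)) :
    N.encode.getD (N.recordPos v + p) 0 =
      (encodeList (fun u : Fin n => [u.1]) (N.inNbrs v) ++ N.truthTable v).getD p 0 := by
  have h : (v : ℕ) < (List.finRange n).length := by simp
  have e : List.finRange n = (List.finRange n).take v ++ v :: (List.finRange n).drop (v + 1) := by
    conv_lhs => rw [← List.take_append_drop v (List.finRange n)]
    rw [List.drop_eq_getElem_cons h]
    simp
  have e' (F : Fin n → List ℕ) : (List.finRange n).flatMap F =
      ((List.finRange n).take v).flatMap F ++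
        (F v ++ ((List.finRange n).drop (v + 1)).flatMap F) := by
    conv_lhs => rw [e]
    rw [List.flatMap_append, List.flatMap_cons]
  rw [encode, recordPos, add_assoc, add_comm 1, List.getD_cons_succ, e',
    List.getD_append_right _ _ _ _ (by omega), Nat.add_sub_cancel_left, List.getD_append]
  simpa [encodeList, truthTable, add_assoc, add_comm, add_left_comm] using hp

theorem hasNetwork_of_eq {n : ℕ} {N : BooleanNetwork (Fin n)} {s : MachineState}
    (h0 : s.arr 0 = fun p => N.encode.getD p 0) (h1 : ∀ v < n, s.arr 1 v = N.recordPos v) :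
    HasNetwork N s := by
  have hf (l : List (Fin n)) : l.flatMap (fun u => [u.1]) = l.map Fin.val := by
    induction l with
    | nil => rfl
    | cons a l ih => simp [ih]
  refine ⟨fun v => ?_, fun v b u hu => ?_, fun v t ht => ?_⟩
  · rw [h0, h1 v v.2]
    have := N.getD_encode v (p := 0) (by positivity)
    simpa [encodeList] using this
  · have hb := (List.getElem?_eq_some_iff.1 hu).1
    rw [h0, h1 v v.2]
    have hpow := Nat.one_le_two_pow (n := (N.inNbrs v).length)
    have := N.getD_encode v (p := b + 1) (by omega)
    dsimp only
    rw [this, encodeList, List.cons_append, List.getD_cons_succ, hf,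
      List.getD_append _ _ _ _ (by simpa using hb)]
    simp [List.getD_eq_getElem?_getD, hu]
  · rw [h0, h1 v v.2]
    have := N.getD_encode v (p := (N.inNbrs v).length + (t + 1)) (by omega)
    dsimp only
    rw [this, encodeList, List.cons_append, ← add_assoc, List.getD_cons_succ, hf,
      List.getD_append_right _ _ _ _ (by simp)]
    simp [BooleanNetwork.truthTable, List.getD_eq_getElem?_getD, ht]

theorem hasNetwork_locateRecords {n : ℕ} {N : BooleanNetwork (Fin n)} {d : ℕ}
    (hd : ∀ v, (N.inNbrs v).length ≤ d) :
    HasNetwork N ((locateRecords d).run n (MachineState.init N.encode)) := by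
  -- after `j` doublings
  have hpow (s : MachineState) (j : ℕ) : (unroll (fun j => ite (lt (num j) (get 0 (var 8)))
      (assign 9 (add (var 9) (var 9))) skip) j).run n (s.setReg 9 1) =
      s.setReg 9 (2 ^ min j (s.arr 0 (s.reg 8))) := by
    induction j with
    | zero => simp [unroll]
    | succ j ih =>
      rw [unroll, run_seq, ih]
      by_cases h : j < s.arr 0 (s.reg 8)
      · rw [run_ite_of_holds (by simpa [Function.update] using h), run_assign,
          MachineState.setReg_setReg, min_eq_left h.le, min_eq_left (Nat.succ_le_of_lt h)]
        simp [pow_succ, mul_two]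
      · rw [run_ite_of_not_holds (by simpa [Function.update] using h), run_skip,
          min_eq_right (by omega), min_eq_right (by omega)]
  have := run_loop_induction (n := n) (x := 3)
    (P := seq (put 1 (var 3) (var 8)) (seq (assign 9 (num 1))
      (seq (unroll (fun j => ite (lt (num j) (get 0 (var 8)))
          (assign 9 (add (var 9) (var 9))) skip) d)
      (assign 8 (add (var 8) (add (get 0 (var 8)) (add (num 1) (var 9))))))))
    (s := (MachineState.init N.encode).setReg 8 1)
    (fun j s => s.arr 0 = (fun p => N.encode.getD p 0) ∧ (∀ v < j, s.arr 1 v = N.recordPos v) ∧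
      s.reg 8 = N.recordPos j)
    ⟨by simp [MachineState.init], by simp, by simp [BooleanNetwork.recordPos]⟩ (by
      rintro j hj s ⟨h0, h1, h8⟩
      have hdeg : N.encode.getD (N.recordPos j) 0 = (N.inNbrs ⟨j, hj⟩).length := by
        have := N.getD_encode ⟨j, hj⟩ (p := 0) (by positivity)
        simpa [encodeList] using this
      have h9 (s : MachineState) : (assign 9 (num 1)).run n s = s.setReg 9 1 := rfl
      rw [run_seq, run_seq, run_seq, run_put, h9, hpow, run_assign]
      refine ⟨by simpa [Function.update] using h0, fun v hv => ?_, ?_⟩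
      · by_cases hvj : v = j
        · subst hvj
          simp [Function.update, h8]
        · have := h1 v (by omega)
          simpa [Function.update, hvj] using this
      · have hm : min d (N.inNbrs ⟨j, hj⟩).length = (N.inNbrs ⟨j, hj⟩).length :=
          min_eq_right (hd _)
        have := N.recordPos_succ ⟨j, hj⟩
        dsimp only at this
        rw [this]
        simp only [List.getD_eq_getElem?_getD] at hdeg h0
        simp [Function.update, h8, h0, hdeg, hm])
  exact hasNetwork_of_eq this.1 this.2.1

/-! ### Numbering the strong modules -/

section Rank

variable {n : ℕ} {N : BooleanNetwork (Fin n)}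

/-- The number of vertices that can be reached from `u`. -/
noncomputable def BooleanNetwork.numDesc (N : BooleanNetwork (Fin n)) (u : Fin n) : ℕ :=
  {w | Relation.ReflTransGen N.G.Adj u w}.ncard

theorem BooleanNetwork.numDesc_le {u v : Fin n} (h : Relation.ReflTransGen N.G.Adj u v) :
    N.numDesc v ≤ N.numDesc u :=
  Set.ncard_le_ncard (fun _ hw => h.trans hw) (Set.toFinite _)

/-- A descendant with as many descendants lies in the same strong module. -/
theorem BooleanNetwork.reach_of_numDesc_eq {u v : Fin n}
    (h : Relation.ReflTransGen N.G.Adj u v) (he : N.numDesc v = N.numDesc u) :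
    Relation.ReflTransGen N.G.Adj v u := by
  have := Set.eq_of_subset_of_ncard_le (s := {w | Relation.ReflTransGen N.G.Adj v w})
    (t := {w | Relation.ReflTransGen N.G.Adj u w}) (fun _ hw => h.trans hw) he.ge (Set.toFinite _)
  have hu : u ∈ {w | Relation.ReflTransGen N.G.Adj u w} := .refl
  rwa [← this] at hu

/-- Numbering the strong modules by the rank of their leaders, in the order of decreasing numbers of
descendants, is a topological numbering. -/
theorem isModuleLabelling_rank {cnt lead idx : ℕ → ℕ} {k : ℕ}
    (hcnt : ∀ u : Fin n, cnt u = N.numDesc u)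
    (hlead : ∀ u : Fin n, ∃ l : Fin n, lead u = l ∧ Relation.ReflTransGen N.G.Adj u l ∧
      Relation.ReflTransGen N.G.Adj l u)
    (hlead' : ∀ u v : Fin n, Relation.ReflTransGen N.G.Adj u v →
      Relation.ReflTransGen N.G.Adj v u → lead u = lead v)
    (hidx : ∀ u < n, idx u = Nat.count (fun w => lead w = w ∧
      (cnt u < cnt w ∨ cnt u = cnt w ∧ w < lead u)) n)
    (hk : k = Nat.count (fun w => lead w = w) n) : IsModuleLabelling N idx k := by
  classical
  simp only [Nat.count_eq_card_filter_range] at hidx hk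
  have hcl (u : Fin n) : cnt (lead u) = cnt u := by
    obtain ⟨l, h1, h2, h3⟩ := hlead u
    rw [h1, hcnt, hcnt]
    exact le_antisymm (N.numDesc_le h2) (N.numDesc_le h3)
  have hll (u : Fin n) : lead (lead u) = lead u := by
    obtain ⟨l, h1, h2, h3⟩ := hlead u
    rw [h1, ← hlead' u l h2 h3, h1]
  have hln (u : Fin n) : lead u < n := by
    obtain ⟨l, h1, -⟩ := hlead u
    exact h1 ▸ l.2
  have hsame (u v : Fin n) (h : lead u = lead v) : Relation.ReflTransGen N.G.Adj u v := by
    obtain ⟨l, h1, h2, -⟩ := hlead u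
    obtain ⟨l', h1', -, h3'⟩ := hlead v
    obtain rfl : l = l' := Fin.ext (by rw [← h1, ← h1', h])
    exact h2.trans h3'
  have hlt (u v : Fin n) (h : cnt v < cnt u ∨ cnt v = cnt u ∧ lead u < lead v) :
      idx u < idx v := by
    rw [hidx u u.2, hidx v v.2]
    refine Finset.card_lt_card (Finset.ssubset_iff_of_subset ?_ |>.2 ⟨lead u, ?_, ?_⟩)
    · intro w hw
      simp only [Finset.mem_filter, Finset.mem_range] at hw ⊢
      refine ⟨hw.1, hw.2.1, ?_⟩
      omega
    · simp only [Finset.mem_filter, Finset.mem_range]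
      refine ⟨hln u, hll u, ?_⟩
      rwa [hcl u]
    · simp only [Finset.mem_filter, Finset.mem_range, hcl u]
      omega
  have heq (u v : Fin n) : idx u = idx v ↔ lead u = lead v := by
    constructor
    · intro h
      by_contra hne
      rcases lt_trichotomy (cnt u) (cnt v) with hc | hc | hc
      · exact (hlt v u (.inl hc)).ne' h
      · rcases Nat.lt_or_gt_of_ne hne with hl | hl
        · exact (hlt u v (.inr ⟨hc.symm, hl⟩)).ne h
        · exact (hlt v u (.inr ⟨hc, hl⟩)).ne' h
      · exact (hlt u v (.inl hc)).ne h
    · intro h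
      have : cnt u = cnt v := by rw [← hcl u, h, hcl v]
      rw [hidx u u.2, hidx v v.2, h, this]
  have hltk (u : Fin n) : idx u < k := by
    rw [hidx u u.2, hk]
    refine Finset.card_lt_card (Finset.ssubset_iff_of_subset ?_ |>.2 ⟨lead u, ?_, ?_⟩)
    · intro w hw
      simp only [Finset.mem_filter] at hw ⊢
      exact ⟨hw.1, hw.2.1⟩
    · simp only [Finset.mem_filter, Finset.mem_range]
      exact ⟨hln u, hll u⟩
    · simp only [Finset.mem_filter, hcl u]
      omega
  refine ⟨hltk, fun i hi => ?_, fun u v => ?_, fun u v huv => ?_⟩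
  · -- leaders have different numbers, hence all numbers below `k` occur
    have himg : ((Finset.range n).filter fun w => lead w = w).image idx = Finset.range k := by
      refine Finset.eq_of_subset_of_card_le (fun j hj => ?_) ?_
      · obtain ⟨w, hw, rfl⟩ := Finset.mem_image.1 hj
        exact Finset.mem_range.2 (hltk ⟨w, by simpa using (Finset.mem_filter.1 hw).1⟩)
      · rw [Finset.card_range, Finset.card_image_of_injOn, ← hk]
        intro w hw w' hw' h
        simp only [Finset.coe_filter, Finset.mem_range, Set.mem_ofPred_eq] at hw hw'
        have := (heq ⟨w, hw.1⟩ ⟨w', hw'.1⟩).1 h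
        rw [← hw.2, ← hw'.2]
        exact this
    have := Finset.mem_range.2 hi
    rw [← himg] at this
    obtain ⟨w, hw, rfl⟩ := Finset.mem_image.1 this
    exact ⟨⟨w, by simpa using (Finset.mem_filter.1 hw).1⟩, rfl⟩
  · rw [heq]
    exact ⟨fun h => ⟨hsame u v h, hsame v u h.symm⟩, fun h => hlead' u v h.1 h.2⟩
  · by_contra hlt'
    rw [not_le] at hlt'
    have h1 := N.numDesc_le (.single huv)
    rw [← hcnt, ← hcnt] at h1
    rcases h1.lt_or_eq with h | h
    · exact (hlt u v (.inl h)).not_gt hlt'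
    · have h2 := N.reach_of_numDesc_eq (.single huv) (by rw [← hcnt, ← hcnt, h])
      exact hlt'.ne ((heq v u).2 (hlead' v u h2 (.single huv)))

end Rank

/-- Mark in the array `2` all vertices of which an in-neighbour is marked. -/
def spreadMarks (d : ℕ) : ForProgram :=
  loop 0 (ite (NumExpr.sum (fun b => NumExpr.and (lt (num b) (degreeExpr (var 0)))
    (get 2 (nbrExpr (var 0) b))) d) (put 2 (var 0) (num 1)) skip)

/-- Mark in the array `2` the vertices that can be reached from the value of the variable `3`. -/
def markDesc (d : ℕ) : ForProgram :=
  seq (loop 0 (put 2 (var 0) (num 0))) (seq (put 2 (var 3) (num 1)) (loop 4 (spreadMarks d)))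

section Marks

variable {n d : ℕ} {N : BooleanNetwork (Fin n)}

theorem exists_inNbr_iff (hd : ∀ v, (N.inNbrs v).length ≤ d) (v : Fin n) (p : Fin n → Prop) :
    (∃ b < d, ∃ u, (N.inNbrs v)[b]? = some u ∧ p u) ↔ ∃ u, N.G.Adj u v ∧ p u := by
  constructor
  · rintro ⟨b, -, u, hu, hp⟩
    exact ⟨u, BooleanNetwork.mem_inNbrs.1 (List.mem_of_getElem? hu), hp⟩
  · rintro ⟨u, hu, hp⟩
    obtain ⟨b, hb⟩ := List.mem_iff_getElem?.1 (BooleanNetwork.mem_inNbrs.2 hu)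
    exact ⟨b, (List.getElem?_eq_some_iff.1 hb).1.trans_le (hd v), u, hb, hp⟩

/-- A condition on some in-neighbour of a vertex, as an expression. -/
theorem HasNetwork.holds_sum_nbr {s : MachineState} (hs : HasNetwork N s)
    (hd : ∀ v, (N.inNbrs v).length ≤ d) {e : NumExpr} {v : Fin n} (he : e.eval s = v)
    (f : NumExpr → NumExpr) (p : Fin n → Prop)
    (hf : ∀ (e : NumExpr) (u : Fin n), e.eval s = u → ((f e).Holds s ↔ p u)) :
    (NumExpr.sum (fun b => NumExpr.and (lt (num b) (degreeExpr e)) (f (nbrExpr e b))) d).Holds s ↔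
      ∃ u, N.G.Adj u v ∧ p u := by
  rw [holds_sum, ← exists_inNbr_iff hd]
  refine exists_congr fun b => and_congr_right fun _ => ?_
  rw [holds_and, holds_lt, eval_num, degreeExpr, eval_get, eval_get, he, hs.deg]
  have hn (u : Fin n) (hu : (N.inNbrs v)[b]? = some u) : (nbrExpr e b).eval s = u := by
    rw [nbrExpr, eval_get, eval_add, eval_get, he, eval_num, hs.nbr v b u hu]
  constructor
  · rintro ⟨hb, h⟩
    have hu : (N.inNbrs v)[b]? = some (N.inNbrs v)[b] := by simp [hb]
    exact ⟨_, hu, (hf _ _ (hn _ hu)).1 h⟩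
  · rintro ⟨u, hu, hp⟩
    exact ⟨(List.getElem?_eq_some_iff.1 hu).1, (hf _ _ (hn u hu)).2 hp⟩

theorem HasNetwork.run {s : MachineState} (hs : HasNetwork N s) {P : ForProgram}
    (h0 : P.KeepsArr 0) (h1 : P.KeepsArr 1) : HasNetwork N (P.run n s) :=
  hs.congr (h0.run_eq s) (h1.run_eq s)

theorem HasNetwork.run_setReg {s : MachineState} (hs : HasNetwork N s) {x k : ℕ} {P : ForProgram}
    (h0 : P.KeepsArr 0) (h1 : P.KeepsArr 1) : HasNetwork N (P.run n (s.setReg x k)) :=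
  hs.congr (h0.run_eq _) (h1.run_eq _)

theorem run_spreadMarks {s : MachineState} (hs : HasNetwork N s)
    (hd : ∀ v, (N.inNbrs v).length ≤ d) :
    (∀ w : Fin n, s.arr 2 w ≠ 0 → ((spreadMarks d).run n s).arr 2 w ≠ 0) ∧
    (∀ u w : Fin n, N.G.Adj u w → s.arr 2 u ≠ 0 → ((spreadMarks d).run n s).arr 2 w ≠ 0) ∧
    ∀ C : Set (Fin n), (∀ u w, N.G.Adj u w → u ∈ C → w ∈ C) → (∀ w : Fin n, s.arr 2 w ≠ 0 → w ∈ C) →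
      ∀ w : Fin n, ((spreadMarks d).run n s).arr 2 w ≠ 0 → w ∈ C := by
  have := run_loop_induction (n := n) (x := 0) (P := ite (NumExpr.sum (fun b =>
    NumExpr.and (lt (num b) (degreeExpr (var 0))) (get 2 (nbrExpr (var 0) b))) d)
    (put 2 (var 0) (num 1)) skip) (s := s)
    (fun j s' => HasNetwork N s' ∧ (∀ w : Fin n, s.arr 2 w ≠ 0 → s'.arr 2 w ≠ 0) ∧
      (∀ u w : Fin n, w.1 < j → N.G.Adj u w → s.arr 2 u ≠ 0 → s'.arr 2 w ≠ 0) ∧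
      ∀ C : Set (Fin n), (∀ u w, N.G.Adj u w → u ∈ C → w ∈ C) →
        (∀ w : Fin n, s.arr 2 w ≠ 0 → w ∈ C) → ∀ w : Fin n, s'.arr 2 w ≠ 0 → w ∈ C)
    ⟨hs, fun _ h => h, fun _ _ h => absurd h (Nat.not_lt_zero _), fun _ _ h => h⟩ (by
      rintro j hj s' ⟨hn, h1, h2, h3⟩
      have hc := HasNetwork.holds_sum_nbr (s := s'.setReg 0 j) (hn.congr rfl rfl) hd
        (e := var 0) (v := ⟨j, hj⟩) (by simp) (get 2) (fun u => s'.arr 2 u ≠ 0)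
        fun e u hu => by simp [hu]
      by_cases h : ∃ u, N.G.Adj u ⟨j, hj⟩ ∧ s'.arr 2 u ≠ 0
      · rw [run_ite_of_holds (hc.2 h)]
        have hv (w : ℕ) : ((put 2 (var 0) (num 1)).run n (s'.setReg 0 j)).arr 2 w =
            if w = j then 1 else s'.arr 2 w := by simp [Function.update]
        refine ⟨hn.run_setReg (by simp [KeepsArr]) (by simp [KeepsArr]),
          fun w hw => ?_, fun u w hw huw hu => ?_, fun C hC hsC w hw => ?_⟩
        · rw [hv]
          split_ifs
          · simp
          · exact h1 w hw
        · rw [hv]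
          split_ifs with hwj
          · simp
          · exact h2 u w (by omega) huw hu
        · rw [hv] at hw
          split_ifs at hw with hwj
          · obtain ⟨u, hu, hu'⟩ := h
            obtain rfl : w = ⟨j, hj⟩ := Fin.ext hwj
            exact hC u _ hu (h3 C hC hsC u hu')
          · exact h3 C hC hsC w hw
      · rw [run_ite_of_not_holds fun e => h (hc.1 e)]
        refine ⟨hn.congr rfl rfl, h1, fun u w hw huw hu => ?_, h3⟩
        by_cases hwj : w.1 = j
        · obtain rfl : w = ⟨j, hj⟩ := Fin.ext hwj
          exact absurd ⟨u, huw, h1 u hu⟩ h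
        · exact h2 u w (by omega) huw hu)
  exact ⟨this.2.1, fun u w => this.2.2.1 u w w.2, this.2.2.2⟩

/-- After `n` rounds all descendants are marked, because every round before the last one marks at
least one more vertex. -/
theorem run_markDesc {s : MachineState} (hs : HasNetwork N s) (hd : ∀ v, (N.inNbrs v).length ≤ d)
    {v : Fin n} (hv : s.reg 3 = v) (w : Fin n) :
    ((markDesc d).run n s).arr 2 w ≠ 0 ↔ Relation.ReflTransGen N.G.Adj v w := by
  set s₀ := (loop 0 (put 2 (var 0) (num 0))).run n s with hs₀
  have hn₀ : HasNetwork N s₀ := hs.run (by simp [KeepsArr]) (by simp [KeepsArr])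
  have hv₀ : s₀.reg 3 = v := by
    rw [hs₀, KeepsVar.run_eq (by simp [KeepsVar]), hv]
  have hz : ∀ w < n, s₀.arr 2 w = 0 :=
    run_loop_induction (n := n) (fun j s' => ∀ w < j, s'.arr 2 w = 0) (by simp) (by
      intro j _ s' h w hw
      by_cases hwj : w = j
      · simp [hwj]
      · simpa [hwj] using h w (by omega))
  let marked (s : MachineState) : Set (Fin n) := {w | s.arr 2 w ≠ 0}
  have := run_loop_induction (n := n) (x := 4) (P := spreadMarks d)
    (s := (put 2 (var 3) (num 1)).run n s₀)
    (fun j s' => HasNetwork N s' ∧ s'.arr 2 v ≠ 0 ∧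
      (∀ w : Fin n, s'.arr 2 w ≠ 0 → Relation.ReflTransGen N.G.Adj v w) ∧
      ((∀ u w : Fin n, N.G.Adj u w → s'.arr 2 u ≠ 0 → s'.arr 2 w ≠ 0) ∨
        j + 1 ≤ (marked s').ncard)) ?_ ?_
  · obtain ⟨-, h1, h2, h3⟩ := this
    have hcl : ∀ u w : Fin n, N.G.Adj u w → ((markDesc d).run n s).arr 2 u ≠ 0 →
        ((markDesc d).run n s).arr 2 w ≠ 0 := by
      refine h3.resolve_right fun h => ?_
      have := Set.ncard_le_card (marked ((loop 4 (spreadMarks d)).run n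
        ((put 2 (var 3) (num 1)).run n s₀)))
      rw [Nat.card_eq_fintype_card, Fintype.card_fin] at this
      omega
    refine ⟨h2 w, fun h => ?_⟩
    induction h with
    | refl => exact h1
    | tail _ huw ih => exact hcl _ _ huw ih
  · have hput (w : ℕ) : ((put 2 (var 3) (num 1)).run n s₀).arr 2 w =
        if w = v then 1 else s₀.arr 2 w := by simp [Function.update, hv₀]
    refine ⟨hn₀.run (by simp [KeepsArr]) (by simp [KeepsArr]), by rw [hput]; simp, fun w hw => ?_,
      .inr ?_⟩
    · rw [hput] at hw
      split_ifs at hw with h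
      · rw [Fin.ext h]
      · exact absurd (hz w w.2) hw
    · rw [Nat.zero_add]
      refine (Set.ncard_pos (Set.toFinite _)).2 ⟨v, ?_⟩
      change ((put 2 (var 3) (num 1)).run n s₀).arr 2 v ≠ 0
      rw [hput]
      simp
  · rintro j hj s' ⟨hn, h1, h2, h3⟩
    obtain ⟨a1, a2, a3⟩ := run_spreadMarks (s := s'.setReg 4 j) (hn.congr rfl rfl) hd
    refine ⟨hn.run_setReg (by simp [spreadMarks, KeepsArr])
      (by simp [spreadMarks, KeepsArr]), a1 v h1,
      a3 _ (fun u w huw hu => Relation.ReflTransGen.tail hu huw) h2, ?_⟩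
    by_cases hcl : ∀ u w : Fin n, N.G.Adj u w → s'.arr 2 u ≠ 0 → s'.arr 2 w ≠ 0
    · left
      intro u w huw hu
      exact a1 w (hcl u w huw (a3 (marked s') hcl (fun _ h => h) u hu))
    · right
      have h4 := h3.resolve_left hcl
      push Not at hcl
      obtain ⟨u, w, huw, hu, hw⟩ := hcl
      have : marked s' ⊂ marked ((spreadMarks d).run n (s'.setReg 4 j)) :=
        (Set.ssubset_iff_of_subset fun x hx => a1 x hx).2 ⟨w, a2 u w huw hu, fun h => h hw⟩
      have := Set.ncard_lt_ncard this (Set.toFinite _)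
      omega

end Marks

/-- Put the numbers of descendants into the array `3`. -/
def countDescs (d : ℕ) : ForProgram :=
  loop 3 (seq (markDesc d) (seq (count (get 2 (var 1))) (put 3 (var 3) (var 2))))

/-- Put into the array `4` the last vertex of the strong module of each vertex. -/
def findLeaders (d : ℕ) : ForProgram :=
  loop 3 (seq (markDesc d) (seq (assign 2 (num 0)) (seq
    (loop 0 (ite (NumExpr.and (get 2 (var 0)) (NumExpr.eq (get 3 (var 0)) (get 3 (var 3))))
      (assign 2 (var 0)) skip))
    (put 4 (var 3) (var 2)))))

/-- Put the numbers of the strong modules into the array `5`, and their total number into the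
variable `6`. -/
def numberModules (d : ℕ) : ForProgram :=
  seq (countDescs d) (seq (findLeaders d) (seq
    (tabulate 5 (NumExpr.and (NumExpr.eq (get 4 (var 1)) (var 1))
      (add (lt (get 3 (var 0)) (get 3 (var 1)))
        (NumExpr.and (NumExpr.eq (get 3 (var 0)) (get 3 (var 1))) (lt (var 1) (get 4 (var 0)))))))
    (seq (count (NumExpr.eq (get 4 (var 1)) (var 1))) (assign 6 (var 2)))))

section Numbering

variable {n d : ℕ} {N : BooleanNetwork (Fin n)} {s : MachineState}

theorem Nat.count_fin (p : Fin n → Prop) (q : ℕ → Prop) [DecidablePred q]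
    (h : ∀ u : Fin n, q u ↔ p u) : Nat.count q n = {u | p u}.ncard := by
  rw [Nat.count_eq_card_filter_range, ← Set.ncard_coe_finset,
    ← Set.ncard_image_of_injective _ Fin.val_injective]
  congr 1
  ext u
  simp only [Finset.coe_filter, Finset.mem_range, Set.mem_ofPred_eq, Set.mem_image]
  constructor
  · rintro ⟨hu, hq⟩
    exact ⟨⟨u, hu⟩, (h ⟨u, hu⟩).1 hq, rfl⟩
  · rintro ⟨u, hu, rfl⟩
    exact ⟨u.2, (h u).2 hu⟩

theorem arr_run_countDescs (hs : HasNetwork N s) (hd : ∀ v, (N.inNbrs v).length ≤ d) (v : Fin n) :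
    ((countDescs d).run n s).arr 3 v = N.numDesc v := by
  have := run_loop_induction (n := n) (x := 3)
    (P := seq (markDesc d) (seq (count (get 2 (var 1))) (put 3 (var 3) (var 2)))) (s := s)
    (fun j s' => HasNetwork N s' ∧ ∀ v : Fin n, v.1 < j → s'.arr 3 v = N.numDesc v)
    ⟨hs, fun v hv => absurd hv (Nat.not_lt_zero _)⟩ (by
      rintro j hj s' ⟨hn, h⟩
      refine ⟨hn.run_setReg (by simp [markDesc, spreadMarks, count, KeepsArr])
        (by simp [markDesc, spreadMarks, count, KeepsArr]), fun v hv => ?_⟩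
      have hm := run_markDesc (s := s'.setReg 3 j) (hn.congr rfl rfl) hd (v := ⟨j, hj⟩) (by simp)
      set s₁ := (markDesc d).run n (s'.setReg 3 j) with hs₁
      have h3 : s₁.reg 3 = j := by
        rw [hs₁, KeepsVar.run_eq (by simp [markDesc, spreadMarks, KeepsVar])]
        simp
      have ha : s₁.arr 3 = s'.arr 3 := by
        rw [hs₁, KeepsArr.run_eq (by simp [markDesc, spreadMarks, KeepsArr])]
        rfl
      have hc := reg_run_count (n := n) (e := get 2 (var 1)) (s := s₁) (fun w => s₁.arr 2 w ≠ 0)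
        fun s'' e1 _ k _ hk => by simp [e1, hk]
      rw [Nat.count_fin (fun w => Relation.ReflTransGen N.G.Adj ⟨j, hj⟩ w) _ hm] at hc
      have hr : ((count (get 2 (var 1))).run n s₁).reg 3 = j := by
        rw [KeepsVar.run_eq (by simp [count, KeepsVar]), h3]
      have ha' : ((count (get 2 (var 1))).run n s₁).arr 3 = s'.arr 3 := by
        rw [KeepsArr.run_eq (by simp [count, KeepsArr]), ha]
      simp only [run_seq, run_put, ← hs₁, MachineState.setArr_arr, Function.update_self, eval_var,
        hr, ha', hc]
      by_cases hvj : v.1 = j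
      · obtain rfl : v = ⟨j, hj⟩ := Fin.ext hvj
        simp [BooleanNetwork.numDesc]
      · rw [Function.update_of_ne hvj]
        exact h v (by omega))
  exact this.2 v v.2

theorem arr_run_findLeaders (hs : HasNetwork N s) (hd : ∀ v, (N.inNbrs v).length ≤ d)
    (hcnt : ∀ v : Fin n, s.arr 3 v = N.numDesc v) (v : Fin n) :
    ∃ l : Fin n, ((findLeaders d).run n s).arr 4 v = l ∧ (Relation.ReflTransGen N.G.Adj v l ∧
      Relation.ReflTransGen N.G.Adj l v) ∧ ∀ u : Fin n, Relation.ReflTransGen N.G.Adj v u →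
        Relation.ReflTransGen N.G.Adj u v → u ≤ l := by
  have := run_loop_induction (n := n) (x := 3)
    (P := seq (markDesc d) (seq (assign 2 (num 0)) (seq
      (loop 0 (ite (NumExpr.and (get 2 (var 0)) (NumExpr.eq (get 3 (var 0)) (get 3 (var 3))))
        (assign 2 (var 0)) skip))
      (put 4 (var 3) (var 2))))) (s := s)
    (fun j s' => HasNetwork N s' ∧ s'.arr 3 = s.arr 3 ∧ ∀ v : Fin n, v.1 < j →
      ∃ l : Fin n, s'.arr 4 v = l ∧ (Relation.ReflTransGen N.G.Adj v l ∧
        Relation.ReflTransGen N.G.Adj l v) ∧ ∀ u : Fin n, Relation.ReflTransGen N.G.Adj v u →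
        Relation.ReflTransGen N.G.Adj u v → u ≤ l)
    ⟨hs, rfl, fun v hv => absurd hv (Nat.not_lt_zero _)⟩ (by
      rintro j hj s' ⟨hn, h3, h⟩
      refine ⟨hn.run_setReg (by simp [markDesc, spreadMarks, KeepsArr])
        (by simp [markDesc, spreadMarks, KeepsArr]), ?_, fun v hv => ?_⟩
      · rw [KeepsArr.run_eq (by simp [markDesc, spreadMarks, KeepsArr])]
        exact h3
      have hm := run_markDesc (s := s'.setReg 3 j) (hn.congr rfl rfl) hd (v := ⟨j, hj⟩) (by simp)
      set s₁ := (markDesc d).run n (s'.setReg 3 j) with hs₁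
      have e3 : s₁.reg 3 = j := by
        rw [hs₁, KeepsVar.run_eq (by simp [markDesc, spreadMarks, KeepsVar])]
        simp
      have ha : s₁.arr 3 = s.arr 3 := by
        rw [hs₁, KeepsArr.run_eq (by simp [markDesc, spreadMarks, KeepsArr])]
        exact h3
      have ha4 : s₁.arr 4 = s'.arr 4 := by
        rw [hs₁, KeepsArr.run_eq (by simp [markDesc, spreadMarks, KeepsArr])]
        rfl
      have hcls (u : Fin n) : (s₁.arr 2 u ≠ 0 ∧ s₁.arr 3 u = s₁.arr 3 j) ↔
          Relation.ReflTransGen N.G.Adj ⟨j, hj⟩ u ∧ Relation.ReflTransGen N.G.Adj u ⟨j, hj⟩ := by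
        have := hcnt ⟨j, hj⟩
        dsimp only at this
        rw [hm, ha, hcnt, this]
        exact and_congr_right fun h1 => ⟨fun h2 => N.reach_of_numDesc_eq h1 h2,
          fun h2 => le_antisymm (N.numDesc_le h1) (N.numDesc_le h2)⟩
      -- the variable `2` holds the last vertex of the strong module of `j` found so far
      have hlast := run_loop_induction (n := n) (x := 0)
        (P := ite (NumExpr.and (get 2 (var 0)) (NumExpr.eq (get 3 (var 0)) (get 3 (var 3))))
          (assign 2 (var 0)) skip) (s := s₁.setReg 2 0)
        (fun i s'' => s''.arr = s₁.arr ∧ s''.reg 3 = j ∧ ∀ u : Fin n, u.1 < i →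
          (s₁.arr 2 u ≠ 0 ∧ s₁.arr 3 u = s₁.arr 3 j) → ∃ l : Fin n, s''.reg 2 = l ∧
            (s₁.arr 2 l ≠ 0 ∧ s₁.arr 3 l = s₁.arr 3 j) ∧ u ≤ l ∧ l.1 < i)
        ⟨rfl, by simpa [Function.update] using e3, fun u hu => absurd hu (Nat.not_lt_zero _)⟩ (by
          rintro i hi s'' ⟨b1, b2, b3⟩
          by_cases hp : s₁.arr 2 i ≠ 0 ∧ s₁.arr 3 i = s₁.arr 3 j
          · rw [run_ite_of_holds (by simpa [Function.update, b1, b2] using hp)]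
            refine ⟨b1, by simpa [Function.update] using b2, fun u hu _ =>
              ⟨⟨i, hi⟩, by simp, hp, Fin.le_def.2 (Nat.lt_succ_iff.1 hu), Nat.lt_succ_self i⟩⟩
          · rw [run_ite_of_not_holds (by simpa [Function.update, b1, b2] using hp)]
            refine ⟨b1, by simpa [Function.update] using b2, fun u hu hup => ?_⟩
            have : u.1 ≠ i := fun e => hp (e ▸ hup)
            obtain ⟨l, c1, c2, c3, c4⟩ := b3 u (by omega) hup
            exact ⟨l, by simpa [Function.update] using c1, c2, c3, by omega⟩)
      obtain ⟨b1, b2, b3⟩ := hlast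
      have h2 (s : MachineState) : (assign 2 (num 0)).run n s = s.setReg 2 0 := rfl
      rw [run_seq, run_seq, run_seq, run_put, h2, MachineState.setArr_arr, Function.update_self,
        eval_var, eval_var, b2, b1, ha4]
      by_cases hvj : v.1 = j
      · obtain rfl : v = ⟨j, hj⟩ := Fin.ext hvj
        obtain ⟨l, c1, c2, c3, -⟩ := b3 ⟨j, hj⟩ hj ((hcls _).2 ⟨.refl, .refl⟩)
        refine ⟨l, (Function.update_self _ _ _).trans c1, (hcls l).1 c2, fun u hu hu' => ?_⟩
        obtain ⟨l', c1', -, c3', -⟩ := b3 u u.2 ((hcls u).2 ⟨hu, hu'⟩)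
        rwa [Fin.ext (c1.symm.trans c1')]
      · rw [Function.update_of_ne hvj]
        exact h v (by omega))
  exact this.2.2 v v.2

theorem isModuleLabelling_numberModules (hs : HasNetwork N s)
    (hd : ∀ v, (N.inNbrs v).length ≤ d) :
    IsModuleLabelling N (((numberModules d).run n s).arr 5)
      (((numberModules d).run n s).reg 6) := by
  set s₁ := (countDescs d).run n s with hs₁
  have hn₁ : HasNetwork N s₁ := hs.run
    (by simp [countDescs, markDesc, spreadMarks, count, KeepsArr])
    (by simp [countDescs, markDesc, spreadMarks, count, KeepsArr])
  have hcnt := arr_run_countDescs hs hd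
  rw [← hs₁] at hcnt
  set s₂ := (findLeaders d).run n s₁ with hs₂
  have hlead := arr_run_findLeaders hn₁ hd hcnt
  rw [← hs₂] at hlead
  have h3 : s₂.arr 3 = s₁.arr 3 := by
    rw [hs₂, KeepsArr.run_eq (by simp [findLeaders, markDesc, spreadMarks, KeepsArr])]
  set e : NumExpr := NumExpr.and (NumExpr.eq (get 4 (var 1)) (var 1))
      (add (lt (get 3 (var 0)) (get 3 (var 1)))
        (NumExpr.and (NumExpr.eq (get 3 (var 0)) (get 3 (var 1))) (lt (var 1) (get 4 (var 0)))))
      with he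
  have hidx (u : ℕ) (hu : u < n) := arr_run_tabulate (A := 5) (e := e) (s := s₂) (n := n)
    (fun u w => s₂.arr 4 w = w ∧
      (s₂.arr 3 u < s₂.arr 3 w ∨ s₂.arr 3 u = s₂.arr 3 w ∧ w < s₂.arr 4 u))
    (fun s' ha _ i _ j _ h0 h1 => by
      simp [he, h0, h1, ha 3 (by simp), ha 4 (by simp)]) hu
  set s₃ := (tabulate 5 e).run n s₂ with hs₃
  have h4 : s₃.arr 4 = s₂.arr 4 := by
    rw [hs₃, KeepsArr.run_eq (by simp [tabulate, count, KeepsArr])]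
  have hk := reg_run_count (n := n) (e := NumExpr.eq (get 4 (var 1)) (var 1)) (s := s₃)
    (fun w => s₂.arr 4 w = w) fun s' ha _ j _ h1 => by simp [ha, h4, h1]
  have hrun : (numberModules d).run n s = (assign 6 (var 2)).run n
      ((count (NumExpr.eq (get 4 (var 1)) (var 1))).run n s₃) := rfl
  refine isModuleLabelling_rank (cnt := s₂.arr 3) (lead := s₂.arr 4) (fun u => h3 ▸ hcnt u)
    (fun u => ?_) (fun u v huv hvu => ?_) (fun u hu => ?_) ?_
  · obtain ⟨l, h1, h2, -⟩ := hlead u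
    exact ⟨l, h1, h2⟩
  · obtain ⟨l, h1, h2, h3⟩ := hlead u
    obtain ⟨l', h1', h2', h3'⟩ := hlead v
    have := le_antisymm (h3' l (hvu.trans h2.1) (h2.2.trans huv))
      (h3 l' (huv.trans h2'.1) (h2'.2.trans hvu))
    rw [h1, h1', this]
  · rw [hrun, run_assign, MachineState.setReg_arr, KeepsArr.run_eq (by simp [count, KeepsArr])]
    exact hidx u hu
  · rw [hrun, run_assign]
    simpa using hk

end Numbering

/-! ### Printing the block of a module -/

/-- The expression that answers a query about the module whose number is the value of the
variable `5`. -/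
def queryExpr : Query → NumExpr
  | .card => get 7 (var 5)
  | .arity => var 7
  | .width s => get 7 (get 11 (num s))
  | .deg a => degreeExpr (get 8 (num a))
  | .slot a b => get 10 (get 5 (nbrExpr (get 8 (num a)) b))
  | .place a b => get 6 (nbrExpr (get 8 (num a)) b)
  | .table a t => tableExpr (get 8 (num a)) t

/-- The queries that matter when modules have at most `c` vertices and in-degrees are at
most `d`. -/
def queries (c d : ℕ) : List Query :=
  .card :: .arity :: ((List.range (c * d)).map .width ++ (List.range c).map .deg ++
    (List.range c).flatMap (fun a => (List.range d).map (.slot a)) ++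
    (List.range c).flatMap (fun a => (List.range d).map (.place a)) ++
    (List.range c).flatMap fun a => (List.range (2 ^ d)).map (.table a))

/-- The encoding of the table with profile `π`. -/
noncomputable def encodeRows (π : Profile) : List ℕ :=
  encodeList (fun row : List StateList × List StateList =>
    encodeList StateList.encode row.1 ++ encodeList StateList.encode row.2) (tableRows π)

/-- The condition that the value of the variable `0` is the number of a parent of the module whose
number is the value of the variable `5`, because the value of the variable `1` lies in the module
and has an in-neighbour in the parent. -/
def parentCond (d : ℕ) : NumExpr :=
  NumExpr.and (sub (num 1) (NumExpr.eq (var 0) (var 5)))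
    (NumExpr.and (NumExpr.eq (get 5 (var 1)) (var 5))
      (NumExpr.sum (fun b => NumExpr.and (lt (num b) (degreeExpr (var 1)))
        (NumExpr.eq (get 5 (nbrExpr (var 1) b)) (var 0))) d))

/-- Compute what is needed to answer the queries about a module: the list of its vertices in the
array `8`, the marks of its parents in `9`, their ranks plus one in `10`, and the list of the
parents in `11`. The number of parents goes to the variable `7`. -/
def prepareModule (d : ℕ) : ForProgram :=
  seq (scatter 8 (NumExpr.eq (get 5 (var 0)) (var 5)) (get 6 (var 0)))
    (seq (tabulate 9 (parentCond d))
      (seq (tabulate 10 (NumExpr.and (lt (var 1) (add (var 0) (num 1)))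
          (NumExpr.and (get 9 (var 1)) (get 9 (var 0)))))
        (seq (scatter 11 (get 9 (var 0)) (sub (get 10 (var 0)) (num 1)))
          (seq (count (get 9 (var 1))) (assign 7 (var 2))))))

/-- Print the block of the module whose number is the value of the variable `5`. The decision tree
distinguishes values up to `c + c * d + d + 1`, which bounds the answers to all queries that
matter. -/
noncomputable def printModule (c d : ℕ) : ForProgram :=
  seq (prepareModule d)
    (seq (print (get 7 (var 5))) (seq (printFilter (NumExpr.eq (get 5 (var 0)) (var 5)))
      (seq (print (var 7)) (seq (printFilter (get 9 (var 0)))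
        (dispatch (c + c * d + d + 1) queryExpr (queries c d) fun π =>
          printList (encodeRows π))))))

section Module

variable {n c d k : ℕ} {N : BooleanNetwork (Fin n)} {s : MachineState} {i : ℕ}

theorem map_val_filter_finRange (p : ℕ → Prop) [DecidablePred p] :
    ((List.finRange n).filter fun u => p u.1).map Fin.val = (List.range n).filter p := by
  rw [← List.map_coe_finRange_eq_range, List.filter_map]
  rfl

theorem map_val_moduleVerts (idx : ℕ → ℕ) (i : ℕ) :
    (moduleVerts n idx i).map Fin.val = (List.range n).filter fun u => idx u = i :=
  map_val_filter_finRange fun u => idx u = i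

theorem length_moduleVerts (idx : ℕ → ℕ) (i : ℕ) :
    (moduleVerts n idx i).length = Nat.count (fun u => idx u = i) n := by
  rw [← List.length_filter_range, ← map_val_moduleVerts, List.length_map]

/-- The position of a vertex in its module. -/
theorem getElem?_moduleVerts (idx : ℕ → ℕ) (u : Fin n) :
    (moduleVerts n idx (idx u))[Nat.count (fun w => idx w = idx u) u]? = some u := by
  have := List.getElem?_filter_range (p := fun w => idx w = idx u) u.2 rfl
  rw [← map_val_moduleVerts, List.getElem?_map, Option.map_eq_some_iff] at this
  obtain ⟨u', h, hu'⟩ := this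
  obtain rfl : u' = u := Fin.ext hu'
  exact h

/-- A module has at most as many parents as it has in-neighbours, counted with multiplicity. -/
theorem length_moduleParents_le {idx : ℕ → ℕ} (hd : ∀ v, (N.inNbrs v).length ≤ d)
    (hc : (moduleVerts n idx i).length ≤ c) : (moduleParents N idx i).length ≤ c * d := by
  have hsub : moduleParents N idx i ⊆
      ((moduleVerts n idx i).flatMap N.inNbrs).map fun u => idx u.1 := by
    intro p hp
    simp only [moduleParents, List.mem_filter, decide_eq_true_eq] at hp
    obtain ⟨-, -, u, v, huv, rfl, hv⟩ := hp
    exact List.mem_map.2 ⟨u, List.mem_flatMap.2 ⟨v, mem_moduleVerts.2 hv,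
      BooleanNetwork.mem_inNbrs.2 huv⟩, rfl⟩
  refine ((List.subperm_of_subset (nodup_moduleParents N i) hsub).length_le).trans ?_
  rw [List.length_map, List.length_flatMap]
  refine (List.sum_le_card_nsmul _ d fun x hx => ?_).trans ?_
  · obtain ⟨v, -, rfl⟩ := List.mem_map.1 hx
    exact hd v
  · rw [List.length_map, smul_eq_mul]
    exact Nat.mul_le_mul_right d hc

/-- What is known about the memory when the block of a module is printed: besides the network, the
array `5` holds the numbers of the modules of the vertices, `6` the positions of the vertices in
their modules, and `7` the sizes of the modules. -/
structure ModuleReady (N : BooleanNetwork (Fin n)) (s : MachineState) : Prop where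
  network : HasNetwork N s
  pos : ∀ u : Fin n, s.arr 6 u = Nat.count (fun w => s.arr 5 w = s.arr 5 u) u
  siz : ∀ p < n, s.arr 7 p = (moduleVerts n (s.arr 5) p).length

theorem ModuleReady.congr {s' : MachineState} (h : ModuleReady N s)
    (h' : ∀ A, A ≤ 7 → s'.arr A = s.arr A) : ModuleReady N s' := by
  obtain ⟨a, b, c⟩ := h
  refine ⟨a.congr (h' 0 (by simp)) (h' 1 (by simp)), ?_, ?_⟩
  · rwa [h' 5 (by simp), h' 6 (by simp)]
  · rwa [h' 5 (by simp), h' 7 (by simp)]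

/-- The contents of the arrays `8`, `9`, `10`, `11` and of the variable `7` after the
preparation. -/
theorem run_prepareModule (hs : ModuleReady N s) (hd : ∀ v, (N.inNbrs v).length ≤ d)
    (hi : s.reg 5 = i) :
    ((prepareModule d).run n s).reg 7 = (moduleParents N (s.arr 5) i).length ∧
    (∀ (a : ℕ) (v : Fin n), (moduleVerts n (s.arr 5) i)[a]? = some v →
      ((prepareModule d).run n s).arr 8 a = v) ∧
    (∀ p < n, ((prepareModule d).run n s).arr 9 p ≠ 0 ↔ p ∈ moduleParents N (s.arr 5) i) ∧
    (∀ p < n, p ∉ moduleParents N (s.arr 5) i → ((prepareModule d).run n s).arr 10 p = 0) ∧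
    (∀ p ∈ moduleParents N (s.arr 5) i, ∃ j : ℕ, ((prepareModule d).run n s).arr 10 p = j + 1 ∧
      (moduleParents N (s.arr 5) i)[j]? = some p) ∧
    (∀ j p : ℕ, (moduleParents N (s.arr 5) i)[j]? = some p →
      ((prepareModule d).run n s).arr 11 j = p) := by
  classical
  set idx := s.arr 5 with hidx
  -- the vertices of the module
  have h8 (a u : ℕ) (ha : ((List.range n).filter fun u => idx u = i)[a]? = some u) :=
    arr_run_scatter (n := n) (A := 8) (e := NumExpr.eq (get 5 (var 0)) (var 5))
      (r := get 6 (var 0)) (s := s) (fun u => idx u = i) (fun s' h1 h2 j hj h0 => by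
        refine ⟨by simp [h1 5 (by simp), h2 5 (by simp), h0, hi, hidx], fun hji => ?_⟩
        rw [eval_get, eval_var, h0, h1 6 (by simp)]
        have := hs.pos ⟨j, hj⟩
        rw [← hidx] at this
        dsimp only at this
        rw [this]
        simp only [hji]) ha
  set s₁ := (scatter 8 (NumExpr.eq (get 5 (var 0)) (var 5)) (get 6 (var 0))).run n s with hs₁
  have k₁ (A : ℕ) (hA : A ≠ 8) : s₁.arr A = s.arr A := by
    rw [hs₁, KeepsArr.run_eq (by simp [scatter, KeepsArr, hA])]
  have i₁ : s₁.reg 5 = i := by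
    rw [hs₁, KeepsVar.run_eq (by simp [scatter, KeepsVar]), hi]
  -- the marks of the parents
  have h9 (p : ℕ) (hp : p < n) := arr_run_tabulate (n := n) (A := 9) (e := parentCond d) (s := s₁)
    (fun p v => p ≠ i ∧ idx v = i ∧ ∃ hv : v < n, ∃ u, N.G.Adj u ⟨v, hv⟩ ∧ idx u = p)
    (fun s' h1 h2 p _ v hv e0 e1 => by
      have hn : HasNetwork N s' := hs.network.congr
        (by rw [h1 0 (by simp), k₁ 0 (by simp)]) (by rw [h1 1 (by simp), k₁ 1 (by simp)])
      have a5 : s'.arr 5 = idx := by rw [h1 5 (by simp), k₁ 5 (by simp)]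
      have r5 : s'.reg 5 = i := by rw [h2 5 (by simp) (by simp) (by simp), i₁]
      rw [parentCond, holds_and, holds_not, holds_eq, holds_and, holds_eq,
        hn.holds_sum_nbr hd (e := var 1) (v := ⟨v, hv⟩) e1
          (fun e => NumExpr.eq (get 5 e) (var 0)) (fun u => idx u = p)
          fun e u hu => by simp [hu, a5, e0]]
      simp [e0, e1, a5, r5, hv]) hp
  set s₂ := (tabulate 9 (parentCond d)).run n s₁ with hs₂
  have k₂ (A : ℕ) (hA : A ≠ 9) : s₂.arr A = s₁.arr A := by
    rw [hs₂, KeepsArr.run_eq (by simp [tabulate, count, KeepsArr, hA])]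
  have h9' (p : ℕ) (hp : p < n) : s₂.arr 9 p ≠ 0 ↔ p ∈ moduleParents N idx i := by
    rw [h9 p hp, ← List.length_filter_range, Ne, List.length_eq_zero_iff, List.filter_eq_nil_iff]
    simp only [moduleParents, List.mem_filter, List.mem_range, decide_eq_true_eq, hp, true_and]
    push Not
    constructor
    · rintro ⟨v, hv, h1, h2, h3, u, h4, h5⟩
      exact ⟨h1, u, ⟨v, hv⟩, h4, h5, h2⟩
    · rintro ⟨h1, u, v, h4, h5, h2⟩
      exact ⟨v, v.2, h1, h2, v.2, u, h4, h5⟩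
  have hpar : moduleParents N idx i = (List.range n).filter fun p => s₂.arr 9 p ≠ 0 := by
    rw [moduleParents]
    refine List.filter_congr fun p hp => ?_
    have := h9' p (List.mem_range.1 hp)
    rw [moduleParents, List.mem_filter] at this
    rw [decide_eq_decide]
    simpa [List.mem_range.1 hp] using this.symm
  -- their ranks
  have h10 (p : ℕ) (hp : p < n) := arr_run_tabulate (n := n) (A := 10)
    (e := NumExpr.and (lt (var 1) (add (var 0) (num 1)))
      (NumExpr.and (get 9 (var 1)) (get 9 (var 0)))) (s := s₂)
    (fun p q => q < p + 1 ∧ s₂.arr 9 q ≠ 0 ∧ s₂.arr 9 p ≠ 0)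
    (fun s' h1 h2 p _ q _ e0 e1 => by simp [e0, e1, h1 9 (by simp)]) hp
  set s₃ := (tabulate 10 (NumExpr.and (lt (var 1) (add (var 0) (num 1)))
      (NumExpr.and (get 9 (var 1)) (get 9 (var 0))))).run n s₂ with hs₃
  have k₃ (A : ℕ) (hA : A ≠ 10) : s₃.arr A = s₂.arr A := by
    rw [hs₃, KeepsArr.run_eq (by simp [tabulate, count, KeepsArr, hA])]
  have h10a (p : ℕ) (hp : p < n) (hp' : s₂.arr 9 p = 0) : s₃.arr 10 p = 0 := by
    rw [h10 p hp, ← List.length_filter_range]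
    simp [hp']
  have h10b (p : ℕ) (hp : p < n) (hp' : s₂.arr 9 p ≠ 0) :
      s₃.arr 10 p = Nat.count (fun q => s₂.arr 9 q ≠ 0) p + 1 := by
    -- the count stops at `p`, so that the bound `n` may be replaced by `p + 1`
    have hm (m : ℕ) (hm : p < m) : Nat.count (fun q => q < p + 1 ∧ s₂.arr 9 q ≠ 0 ∧
        s₂.arr 9 p ≠ 0) m = Nat.count (fun q => s₂.arr 9 q ≠ 0) (p + 1) := by
      induction m, hm using Nat.le_induction with
      | base =>
        rw [← List.length_filter_range, ← List.length_filter_range]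
        congr 1
        refine List.filter_congr fun q hq => ?_
        simp [hp', List.mem_range.1 hq]
      | succ m hm ih =>
        rw [Nat.count_succ, ih, if_neg (by omega), add_zero]
    rw [h10 p hp, hm n hp, Nat.count_succ, if_pos hp']
  -- the list of the parents
  have h11 (j p : ℕ) (hj : ((List.range n).filter fun p => s₂.arr 9 p ≠ 0)[j]? = some p) :=
    arr_run_scatter (n := n) (A := 11) (e := get 9 (var 0)) (r := sub (get 10 (var 0)) (num 1))
      (s := s₃) (fun p => s₂.arr 9 p ≠ 0) (fun s' h1 h2 p hp h0 => by
        refine ⟨by simp [h0, h1 9 (by simp), k₃ 9 (by simp)], fun hp' => ?_⟩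
        simp only [eval_sub, eval_get, eval_var, h0, h1 10 (by simp), h10b p hp hp', eval_num,
          Nat.add_sub_cancel]) hj
  set s₄ := (scatter 11 (get 9 (var 0)) (sub (get 10 (var 0)) (num 1))).run n s₃ with hs₄
  have k₄ (A : ℕ) (hA : A ≠ 11) : s₄.arr A = s₃.arr A := by
    rw [hs₄, KeepsArr.run_eq (by simp [scatter, KeepsArr, hA])]
  have hc := reg_run_count (n := n) (e := get 9 (var 1)) (s := s₄) (fun p => s₂.arr 9 p ≠ 0)
    fun s' h1 _ p _ e1 => by simp [h1, e1, k₄ 9 (by simp), k₃ 9 (by simp)]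
  have hrun : (prepareModule d).run n s =
    (assign 7 (var 2)).run n ((count (get 9 (var 1))).run n s₄) := rfl
  have kf (A : ℕ) : ((prepareModule d).run n s).arr A = s₄.arr A := by
    rw [hrun, run_assign, MachineState.setReg_arr, KeepsArr.run_eq (by simp [count, KeepsArr])]
  refine ⟨?_, fun a v ha => ?_, fun p hp => ?_, fun p hp hp' => ?_, fun p hp => ?_,
    fun j p hj => ?_⟩
  · rw [hrun, run_assign, MachineState.setReg_reg, Function.update_self, eval_var, hc, hpar,
      List.length_filter_range]
  · rw [kf, k₄ 8 (by simp), k₃ 8 (by simp), k₂ 8 (by simp)]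
    refine h8 a v ?_
    rw [← map_val_moduleVerts, List.getElem?_map, ha]
    rfl
  · rw [kf, k₄ 9 (by simp), k₃ 9 (by simp), h9' p hp]
  · rw [kf, k₄ 10 (by simp)]
    exact h10a p hp (not_not.1 fun h => hp' ((h9' p hp).1 h))
  · have hpn : p < n := List.mem_range.1 (List.mem_filter.1 hp).1
    have hp' := (h9' p hpn).2 hp
    refine ⟨Nat.count (fun q => s₂.arr 9 q ≠ 0) p, ?_, ?_⟩
    · rw [kf, k₄ 10 (by simp)]
      exact h10b p hpn hp'
    · rw [hpar]
      exact List.getElem?_filter_range (p := fun p => s₂.arr 9 p ≠ 0) hpn hp'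
  · rw [kf]
    exact h11 j p (hpar ▸ hj)

theorem mem_queries {c d : ℕ} : ∀ q : Query, q ∈ queries c d ↔ match q with
    | .card => True
    | .arity => True
    | .width s => s < c * d
    | .deg a => a < c
    | .slot a b => a < c ∧ b < d
    | .place a b => a < c ∧ b < d
    | .table a t => a < c ∧ t < 2 ^ d := by
  intro q
  cases q <;> simp [queries]

/-- The block of a module is printed correctly. -/
theorem run_printModule (hs : ModuleReady N s) (hd : ∀ v, (N.inNbrs v).length ≤ d)
    (hL : IsModuleLabelling N (s.arr 5) k) (hc : ∀ p, (moduleVerts n (s.arr 5) p).length ≤ c)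
    (hi : s.reg 5 = i) (hin : i < n) :
    (∀ A, A ≤ 7 → ((printModule c d).run n s).arr A = s.arr A) ∧
    ((printModule c d).run n s).reg 6 = s.reg 6 ∧
    ∃ b : Block n, IsModuleBlock N (s.arr 5) i b ∧
      ((printModule c d).run n s).out = s.out ++ b.encode := by
  classical
  obtain ⟨h7, h8, h9, h10, h10', h11⟩ := run_prepareModule hs hd hi
  set idx := s.arr 5 with hidx
  set s' := (prepareModule d).run n s with hs'
  have ka (A : ℕ) (hA : A ≤ 7) : s'.arr A = s.arr A := by
    have : A ≠ 8 ∧ A ≠ 9 ∧ A ≠ 10 ∧ A ≠ 11 := by omega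
    rw [hs', KeepsArr.run_eq (by simp [prepareModule, scatter, tabulate, count, KeepsArr, this])]
  have kr5 : s'.reg 5 = i := by
    rw [hs', KeepsVar.run_eq (by simp [prepareModule, scatter, tabulate, count, KeepsVar]), hi]
  have kr6 : s'.reg 6 = s.reg 6 := by
    rw [hs', KeepsVar.run_eq (by simp [prepareModule, scatter, tabulate, count, KeepsVar])]
  have ko : s'.out = s.out := by
    rw [hs', Silent.run_eq (by simp [prepareModule, scatter, tabulate, count, Silent])]
  have hr : ModuleReady N s' := hs.congr ka
  have a5 : s'.arr 5 = idx := ka 5 (by simp)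
  -- the printed lists
  have o1 (o : List ℕ) := out_run_printFilter (n := n) (e := NumExpr.eq (get 5 (var 0)) (var 5))
    (s := { s' with out := o }) (fun u => idx u = i) fun s'' e1 e2 j _ e0 => by
      simp [e1, e2 5 (by simp), e0, a5, kr5]
  have o2 (s₂ : MachineState) (e : s₂.arr = s'.arr) := out_run_printFilter (n := n)
    (e := get 9 (var 0)) (s := s₂) (fun p => s'.arr 9 p ≠ 0) fun s'' e1 e2 j _ e0 => by
      simp [e1, e, e0]
  set s₁ := (printFilter (NumExpr.eq (get 5 (var 0)) (var 5))).run n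
    ((print (get 7 (var 5))).run n s') with hs₁
  set s₂ := (printFilter (get 9 (var 0))).run n ((print (var 7)).run n s₁) with hs₂
  have ka₁ : s₁.arr = s'.arr := by
    ext A : 1
    rw [hs₁, KeepsArr.run_eq (by simp [printFilter, KeepsArr]),
      KeepsArr.run_eq (by simp [KeepsArr])]
  have kr₁ (x : ℕ) (hx : x ≠ 0) : s₁.reg x = s'.reg x := by
    rw [hs₁, KeepsVar.run_eq (by simp [printFilter, KeepsVar, hx]),
      KeepsVar.run_eq (by simp [KeepsVar])]
  have ka₂ : s₂.arr = s'.arr := by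
    ext A : 1
    rw [hs₂, KeepsArr.run_eq (by simp [printFilter, KeepsArr]),
      KeepsArr.run_eq (by simp [KeepsArr]), ka₁]
  have kr₂ (x : ℕ) (hx : x ≠ 0) : s₂.reg x = s'.reg x := by
    rw [hs₂, KeepsVar.run_eq (by simp [printFilter, KeepsVar, hx]),
      KeepsVar.run_eq (by simp [KeepsVar]), kr₁ x hx]
  have hpar : (List.range n).filter (fun p => s'.arr 9 p ≠ 0) = moduleParents N idx i := by
    rw [moduleParents]
    refine List.filter_congr fun p hp => ?_
    have := h9 p (List.mem_range.1 hp)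
    rw [moduleParents, List.mem_filter] at this
    rw [decide_eq_decide]
    simpa [List.mem_range.1 hp] using this
  have ho₁ : s₁.out = s.out ++ ((moduleVerts n idx i).length ::
      (moduleVerts n idx i).map Fin.val) := by
    have := o1 (s'.out ++ [s'.arr 7 i])
    rw [← map_val_moduleVerts] at this
    have e : (print (get 7 (var 5))).run n s' = { s' with out := s'.out ++ [s'.arr 7 i] } := by
      simp [MachineState.emit, kr5]
    rw [hs₁, e, this, ko, hr.siz i hin, a5]
    simp
  have ho₂ : s₂.out = s₁.out ++ ((moduleParents N idx i).length :: moduleParents N idx i) := by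
    rw [hs₂, o2 _ (by simpa using ka₁), hpar]
    simp [kr₁ 7 (by simp), h7]
  set π : Profile := fun q => if q ∈ queries c d ∧ (queryExpr q).eval s₂ ≤ c + c * d + d + 1 then
    (queryExpr q).eval s₂ else 0 with hπ
  have hrun : (printModule c d).run n s = { s₂ with out := s₂.out ++ encodeRows π } := by
    rw [← run_printList (n := n), hπ]
    exact run_dispatch _ _ _ _ s₂
  have hval (q : Query) (x : ℕ) (hq : q ∈ queries c d) (hx : (queryExpr q).eval s₂ = x)
      (hle : x ≤ c + c * d + d + 1) : π q = x := by
    simp only [hπ, hq, hx, hle, and_self, if_true]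
  have hlenp := length_moduleParents_le (i := i) hd (hc i)
  have hV (a : ℕ) (v : Fin n) (ha : (moduleVerts n idx i)[a]? = some v) :
      (get 8 (num a)).eval s₂ = v := by
    rw [eval_get, ka₂, eval_num, h8 a v ha]
  have hVc (a : ℕ) (v : Fin n) (ha : (moduleVerts n idx i)[a]? = some v) : a < c :=
    (List.getElem?_eq_some_iff.1 ha).1.trans_le (hc i)
  have hD (a : ℕ) (v : Fin n) (ha : (moduleVerts n idx i)[a]? = some v) :
      (degreeExpr (get 8 (num a))).eval s₂ = (N.inNbrs v).length := by
    rw [degreeExpr, eval_get, eval_get, hV a v ha, ka₂, hr.network.deg]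
  have hN (a : ℕ) (v : Fin n) (b : ℕ) (u : Fin n) (ha : (moduleVerts n idx i)[a]? = some v)
      (hb : (N.inNbrs v)[b]? = some u) : (nbrExpr (get 8 (num a)) b).eval s₂ = u := by
    rw [nbrExpr, eval_get, eval_add, eval_get, hV a v ha, ka₂, eval_num, hr.network.nbr v b u hb]
  have hbd (v : Fin n) (b : ℕ) (u : Fin n) (hb : (N.inNbrs v)[b]? = some u) : b < d :=
    (List.getElem?_eq_some_iff.1 hb).1.trans_le (hd v)
  have hplace (a : ℕ) (v : Fin n) (b : ℕ) (u : Fin n) (ha : (moduleVerts n idx i)[a]? = some v)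
      (hb : (N.inNbrs v)[b]? = some u) :
      (moduleVerts n idx (idx u))[π (.place a b)]? = some u := by
    have hu := getElem?_moduleVerts idx u
    have hle := (List.getElem?_eq_some_iff.1 hu).1.le.trans (hc _)
    rw [hval (.place a b) (Nat.count (fun w => idx w = idx u) u)
      ((mem_queries _).2 ⟨hVc a v ha, hbd v b u hb⟩) ?_ (by omega)]
    · exact hu
    · rw [queryExpr, eval_get, hN a v b u ha hb, ka₂, hr.pos, a5]
  have hprof : IsProfile N idx i π := by
    refine ⟨?_, ?_, fun j p hj => ?_, fun a v ha => ?_, fun a v b u ha hb hu => ?_,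
      fun a v b u ha hb hu => ?_, fun a v t ha ht => ?_⟩
    · have := hc i
      refine hval _ _ ((mem_queries _).2 trivial) ?_ (by omega)
      rw [queryExpr, eval_get, eval_var, kr₂ 5 (by simp), kr5, ka₂, hr.siz i hin, a5]
    · refine hval _ _ ((mem_queries _).2 trivial) ?_ (by omega)
      rw [queryExpr, eval_var, kr₂ 7 (by simp), h7]
    · have := hc p
      have hjl := (List.getElem?_eq_some_iff.1 hj).1
      have hp := List.mem_range.1 (List.mem_filter.1 (List.mem_of_getElem? hj)).1
      refine hval _ _ ((mem_queries _).2 (hjl.trans_le hlenp)) ?_ (by omega)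
      rw [queryExpr, eval_get, eval_get, eval_num, ka₂, h11 j p hj, hr.siz p hp, a5]
    · have := hd v
      exact hval _ _ ((mem_queries _).2 (hVc a v ha)) (hD a v ha) (by omega)
    · refine ⟨?_, hu ▸ hplace a v b u ha hb⟩
      refine hval _ _ ((mem_queries _).2 ⟨hVc a v ha, hbd v b u hb⟩) ?_ (Nat.zero_le _)
      rw [queryExpr, eval_get, eval_get, hN a v b u ha hb, ka₂, a5, hu]
      exact h10 i hin fun h => lt_irrefl i (hL.lt_of_mem_parents h)
    · have hmem : idx u ∈ moduleParents N idx i := by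
        rw [moduleParents, List.mem_filter, decide_eq_true_eq, List.mem_range]
        have hv : idx v = i := mem_moduleVerts.1 (List.mem_of_getElem? ha)
        have hadj := BooleanNetwork.mem_inNbrs.1 (List.mem_of_getElem? hb)
        exact ⟨((hL.mono u v hadj).trans hv.le).trans_lt hin, hu, u, v, hadj, rfl, hv⟩
      obtain ⟨j, h1, h2⟩ := h10' _ hmem
      have hj := (List.getElem?_eq_some_iff.1 h2).1
      refine ⟨j, ?_, h2, hplace a v b u ha hb⟩
      refine hval _ _ ((mem_queries _).2 ⟨hVc a v ha, hbd v b u hb⟩) ?_ (by omega)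
      rw [queryExpr, eval_get, eval_get, hN a v b u ha hb, ka₂, a5, h1]
    · have hbit := Bool.toNat_le (N.f v fun u => t.testBit ((N.inNbrs v).idxOf u.1))
      refine hval _ _ ((mem_queries _).2 ⟨hVc a v ha, ht.trans_le
        (Nat.pow_le_pow_right (by simp) (hd v))⟩) ?_ (by omega)
      rw [queryExpr, tableExpr, eval_get, eval_add, eval_add, eval_num, hD a v ha, eval_get,
        hV a v ha, ka₂, hr.network.table v t ht]
  refine ⟨fun A hA => by rw [hrun, ka₂, ka A hA], by rw [hrun, ← kr6, ← kr₂ 6 (by simp)],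
    ⟨moduleVerts n idx i, moduleParents N idx i, tableRows π⟩, ⟨rfl, rfl, π, hprof, rfl⟩, ?_⟩
  have hf {α : Type} (f : α → ℕ) (l : List α) : l.flatMap (fun u => [f u]) = l.map f := by
    induction l with
    | nil => rfl
    | cons a l ih => simp [ih]
  rw [hrun, ho₂, ho₁]
  simp [Block.encode, encodeRows, encodeList, hf]

end Module

/-! ### The whole program -/

/-- Compute and print a factorized representation, for networks with modules of at most `c`
vertices and with in-degrees at most `d`. -/
noncomputable def factorize (c d : ℕ) : ForProgram :=
  seq (locateRecords d) (seq (numberModules d) (seq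
    (tabulate 6 (NumExpr.and (lt (var 1) (var 0)) (NumExpr.eq (get 5 (var 1)) (get 5 (var 0)))))
    (seq (tabulate 7 (NumExpr.eq (get 5 (var 1)) (var 0)))
      (seq (print (var 6)) (loop 5 (ite (lt (var 5) (var 6)) (printModule c d) skip))))))

theorem depth_factorize (c d : ℕ) : (factorize c d).depth ≤ 3 := by
  have h1 (f : ℕ → ForProgram) (hf : ∀ j, (f j).depth = 0) (d : ℕ) : (unroll f d).depth = 0 := by
    induction d with
    | zero => rfl
    | succ d ih => simp [unroll, depth, ih, hf]
  have h2 := depth_dispatch (K := c + c * d + d + 1) (e := queryExpr) (l := queries c d)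
    (leaf := fun π => printList (encodeRows π)) fun π => depth_printList _
  have h3 := h1 (fun j => ite (lt (num j) (get 0 (var 8))) (assign 9 (add (var 9) (var 9))) skip)
    (fun j => rfl) d
  simp [factorize, locateRecords, numberModules, countDescs, findLeaders, markDesc, spreadMarks,
    tabulate, count, printModule, prepareModule, scatter, printFilter, depth, h2, h3]

theorem silent_unroll {f : ℕ → ForProgram} (hf : ∀ j, (f j).Silent) (d : ℕ) :
    (unroll f d).Silent := by
  induction d with
  | zero => trivial
  | succ d ih => exact ⟨ih, hf d⟩

theorem Nat.count_lt_and (p : ℕ → Prop) [DecidablePred p] {u n : ℕ} (hu : u ≤ n) :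
    Nat.count (fun w => w < u ∧ p w) n = Nat.count p u := by
  induction n, hu using Nat.le_induction with
  | base =>
    rw [← List.length_filter_range, ← List.length_filter_range]
    congr 1
    refine List.filter_congr fun q hq => ?_
    simp [List.mem_range.1 hq]
  | succ m hm ih =>
    rw [Nat.count_succ, ih, if_neg (by omega), add_zero]

/-- The program prints a factorized representation. After `j` rounds of the last loop the blocks of
the modules before `j` have been printed; the number `k` of modules is at most `n`, so that `n`
rounds are enough. -/
theorem exists_represents_run_factorize {n c d : ℕ} {N : BooleanNetwork (Fin n)}
    (hd : ∀ v, {u | N.G.Adj u v}.ncard ≤ d)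
    (hc : ∀ C : Set (Fin n), N.IsStrongModule C → C.ncard ≤ c) :
    ∃ R : FactorizedRep n, R.Represents N ∧
      ((factorize c d).run n (MachineState.init N.encode)).out = R.encode := by
  classical
  have hd' (v : Fin n) : (N.inNbrs v).length ≤ d := by
    refine le_trans (le_of_eq ?_) (hd v)
    have hnd : (N.inNbrs v).Nodup := (List.nodup_finRange n).filter _
    rw [← List.toFinset_card_of_nodup hnd, ← Set.ncard_coe_finset]
    congr 1
    ext u
    simp [BooleanNetwork.mem_inNbrs]
  have hn := hasNetwork_locateRecords hd'
  have q₁ : ((locateRecords d).run n (MachineState.init N.encode)).out = [] := by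
    rw [Silent.run_eq]
    · rfl
    · refine ⟨trivial, trivial, trivial, silent_unroll (fun j => ?_) d, trivial⟩
      exact ⟨trivial, trivial⟩
  set s₁ := (locateRecords d).run n (MachineState.init N.encode) with hs₁
  have hL := isModuleLabelling_numberModules hn hd'
  have q₂ : ((numberModules d).run n s₁).out = [] := by
    rw [Silent.run_eq (by simp [numberModules, countDescs, findLeaders, markDesc, spreadMarks,
      tabulate, count, Silent]), q₁]
  have n₂ : HasNetwork N ((numberModules d).run n s₁) := hn.run
    (by simp [numberModules, countDescs, findLeaders, markDesc, spreadMarks, tabulate, count,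
      KeepsArr])
    (by simp [numberModules, countDescs, findLeaders, markDesc, spreadMarks, tabulate, count,
      KeepsArr])
  set s₂ := (numberModules d).run n s₁ with hs₂
  set idx := s₂.arr 5 with hidx
  set k := s₂.reg 6 with hk
  have h6 (u : ℕ) (hu : u < n) := arr_run_tabulate (n := n) (A := 6) (e := NumExpr.and
    (lt (var 1) (var 0)) (NumExpr.eq (get 5 (var 1)) (get 5 (var 0)))) (s := s₂)
    (fun u w => w < u ∧ idx w = idx u)
    (fun s' h1 _ i _ j _ e0 e1 => by simp [e0, e1, h1 5 (by simp), hidx]) hu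
  set s₃ := (tabulate 6 (NumExpr.and (lt (var 1) (var 0))
    (NumExpr.eq (get 5 (var 1)) (get 5 (var 0))))).run n s₂ with hs₃
  have k₃ (A : ℕ) (hA : A ≠ 6) : s₃.arr A = s₂.arr A := by
    rw [hs₃, KeepsArr.run_eq (by simp [tabulate, count, KeepsArr, hA])]
  have h7 (p : ℕ) (hp : p < n) := arr_run_tabulate (n := n) (A := 7)
    (e := NumExpr.eq (get 5 (var 1)) (var 0)) (s := s₃) (fun p w => idx w = p)
    (fun s' h1 _ i _ j _ e0 e1 => by simp [e0, e1, h1 5 (by simp), k₃ 5 (by simp), hidx]) hp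
  set s₄ := (tabulate 7 (NumExpr.eq (get 5 (var 1)) (var 0))).run n s₃ with hs₄
  have k₄ (A : ℕ) (hA : A ≠ 7) : s₄.arr A = s₃.arr A := by
    rw [hs₄, KeepsArr.run_eq (by simp [tabulate, count, KeepsArr, hA])]
  have a5 : s₄.arr 5 = idx := by rw [k₄ 5 (by simp), k₃ 5 (by simp)]
  have r6 : s₄.reg 6 = k := by
    rw [hs₄, KeepsVar.run_eq (by simp [tabulate, count, KeepsVar]), hs₃,
      KeepsVar.run_eq (by simp [tabulate, count, KeepsVar])]
  have q₄ : s₄.out = [] := by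
    rw [hs₄, Silent.run_eq (by simp [tabulate, count, Silent]), hs₃,
      Silent.run_eq (by simp [tabulate, count, Silent]), q₂]
  have hr : ModuleReady N s₄ := by
    refine ⟨n₂.congr (by rw [k₄ 0 (by simp), k₃ 0 (by simp)])
      (by rw [k₄ 1 (by simp), k₃ 1 (by simp)]), fun u => ?_, fun p hp => ?_⟩
    · rw [k₄ 6 (by simp), h6 u u.2, a5, Nat.count_lt_and _ u.2.le]
    · rw [h7 p hp, a5, length_moduleVerts]
  have hcard (p : ℕ) : (moduleVerts n idx p).length ≤ c := by
    rcases (moduleVerts n idx p).eq_nil_or_concat with h | ⟨l, v, h⟩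
    · simp [h]
    · have hv : idx v = p := mem_moduleVerts.1 (h ▸ by simp)
      have := hc {u | Relation.ReflTransGen N.G.Adj v u ∧ Relation.ReflTransGen N.G.Adj u v}
        ⟨v, rfl⟩
      rw [← List.toFinset_card_of_nodup (nodup_moduleVerts p), ← Set.ncard_coe_finset]
      refine le_of_eq_of_le ?_ this
      congr 1
      ext u
      simp only [List.coe_toFinset, Set.mem_ofPred_eq, mem_moduleVerts, ← hv]
      exact (hL.eq_iff u v).trans and_comm
  have hkn : k ≤ n := by
    choose f hf using hL.surj
    have hinj : Function.Injective fun i : Fin k => f i i.2 := fun i j hij => by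
      have h1 := hf i i.2
      have h2 := hf j j.2
      dsimp only at hij
      rw [hij] at h1
      exact Fin.ext (h1.symm.trans h2)
    simpa using Fintype.card_le_of_injective _ hinj
  have hrun : (factorize c d).run n (MachineState.init N.encode) =
      (loop 5 (ite (lt (var 5) (var 6)) (printModule c d) skip)).run n (s₄.emit k) := by
    rw [← r6]
    rfl
  have := run_loop_induction (n := n) (x := 5)
    (P := ite (lt (var 5) (var 6)) (printModule c d) skip) (s := s₄.emit k)
    (fun j s => (∀ A, A ≤ 7 → s.arr A = s₄.arr A) ∧ s.reg 6 = k ∧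
      ∃ R : FactorizedRep n, R.length = min j k ∧ s.out = [k] ++ R.flatMap Block.encode ∧
        ∀ i : Fin R.length, IsModuleBlock N idx i (R.get i))
    ⟨fun _ _ => rfl, r6, [], by simp, by simp [q₄], fun i => i.elim0⟩ (by
      rintro j hj s ⟨h1, h2, R, hR1, hR2, hR3⟩
      have hr' : ModuleReady N (s.setReg 5 j) := hr.congr h1
      have a5' : (s.setReg 5 j).arr 5 = idx := by rw [← a5]; exact h1 5 (by simp)
      by_cases hjk : j < k
      · rw [run_ite_of_holds (by simpa [Function.update, h2] using hjk)]
        obtain ⟨e1, e2, b, hb, e3⟩ := run_printModule (c := c) (k := k) (i := j) hr' hd'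
          (by rwa [a5']) (by rwa [a5']) (by simp) hj
        rw [a5'] at hb
        have hRj : R.length = j := by rw [hR1, min_eq_left hjk.le]
        refine ⟨fun A hA => (e1 A hA).trans (h1 A hA), by rw [e2]; simpa [Function.update] using h2,
          R ++ [b], by simp [hRj, Nat.succ_le_of_lt hjk], by simp [e3, hR2], fun i => ?_⟩
        rw [List.get_eq_getElem]
        by_cases hi : (i : ℕ) < R.length
        · rw [List.getElem_append_left hi]
          exact hR3 ⟨i, hi⟩
        · have hij : (i : ℕ) = j := by
            have : (i : ℕ) < R.length + 1 := by simpa using i.2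
            omega
          rw [List.getElem_append_right (not_lt.1 hi)]
          simpa [hij] using hb
      · rw [run_ite_of_not_holds (by simpa [Function.update, h2] using hjk)]
        exact ⟨h1, by simpa [Function.update] using h2, R, by rw [hR1]; omega, hR2, hR3⟩)
  obtain ⟨-, -, R, hR1, hR2, hR3⟩ := this
  rw [min_eq_right hkn] at hR1
  refine ⟨R, hL.represents hR1 hR3, ?_⟩
  rw [hrun, hR2, FactorizedRep.encode, encodeList, hR1]
  rfl

end Implementation

theorem theorem3 (F : ∀ n : ℕ, Set (BooleanNetwork (Fin n)))
    (hsparse : IsSparse F) (hbounded : HasBoundedStrongModules F) :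
    ∃ (P : Program) (T : ℕ → ℕ),
      (fun n => (T n : ℝ)) =O[atTop] (fun n => (n : ℝ) ^ 3) ∧
      ∀ n, ∀ N ∈ F n, ∃ R : FactorizedRep n, R.Represents N ∧
        ∃ t ≤ T n, P.Computes N.encode t R.encode := by
  obtain ⟨d, hd⟩ := hsparse
  obtain ⟨c, hc⟩ := hbounded
  obtain ⟨P, T, hT, hP⟩ := (factorize c d).exists_program (depth_factorize c d)
  refine ⟨P, T, hT, fun n N hN => ?_⟩
  obtain ⟨R, hR, hout⟩ := exists_represents_run_factorize (hd n N hN) (hc n N hN)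
  refine ⟨R, hR, ?_⟩
  rw [← hout]
  exact hP n N.encode rfl
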